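/- Let $m,n\ge 1$ and let $N$ be a (nonempty) smooth connected $n$-manifold without boundary (Hausdorff, second countable), with base point $x_0$. A pair of maps $f_1,f_2\colon S^m\to N$ is called \emph{loose} if there are homotopies $f_1\sim f_1'$, $f_2\sim f_2'$ with $f_1'(x)\ne f_2'(x)$ for all $x\in S^m$. The pair $(f,f)$ is \emph{loose by small deformation} if for every metric on $N$ (inducing its topology) and every $\varepsilon>0$ there is a map $f'\colon S^m\to N$ which is $\varepsilon$-close to $f$ and satisfies $f'(x)\neq f(x)$ for all $x$. The map $f$ is \emph{coincidence producing} if there is no map $f'\colon S^m\to N$ such that the pair $(f,f')$ is loose. Choose a Riemannian metric on $N$ and let $STN\to N$ be the bundle of unit tangent vectors. Identify its fibre over $x_0$ with $S^{n-1}$ by a linear isometry $\mathbb R^n\cong T_{x_0}N$. Let $\partial_N\colon\pi_m(N,x_0)\to\pi_{m-1}(S^{n-1})$ be the boundary homomorphism in the exact homotopy sequence of this fibration if $m\ge2$ (it is well defined), and put $\partial_N\equiv0$ if $m=1$. Let $j_N\colon S^{n-1}\to N-\{x_0\}$ be the inclusion of the boundary sphere of a small smooth $n$-ball centred at $x_0$,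 parametrized by $S^{n-1}$ compatibly (in orientation) with the chosen isometry $\mathbb R^n\cong T_{x_0}N$; base points are chosen so that $j_N$ preserves them. Let $j_{N*}\colon\pi_{m-1}(S^{n-1})\to\pi_{m-1}(N-\{x_0\})$ be the induced map and $\ker j_{N*}$ the preimage of the neutral element (of the base point if $m=1$). \textbf{Theorem.} (a) For every map $f\colon S^m\to N$: if $(f,f)$ is loose by small deformation, then $(f,f)$ is loose; and if $(f,f)$ is loose, then $f$ is not coincidence producing. (b) For every base point preserving map $f\colon S^m\to N$: $f$ is not coincidence producing if and only if $j_{N*}(\partial_N[f])=0$ in $\pi_{m-1}(N-\{x_0\})$. (c) The three conditions ``$(f,f)$ is loose by small deformation'', ``$(f,f)$ is loose'', ``$f$ is not coincidence producing'' are equivalent for all maps $f\colon S^m\to N$ if and only if $$\partial_N(\pi_m(N,x_0))\cap\ker j_{N*}=\{0\}.\qquad(*)$$ (d) If $N$ is not simply connected, or if $N$ is (homeomorphic to) a projective space $\mathbb KP(n')$ with $n'\ge2$ and $\mathbb K=\mathbb R,\mathbb C$ or $\mathbb H$, then $(*)$ holds; and moreover $\ker j_{N*}=\{0\}$, unless $m=n=1$.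 -/

import Mathlib

open scoped Manifold ContDiff Topology unitInterval
open Topology.Homotopy

noncomputable section

namespace Coincidence

/-! ### Looseness -/

section Loose

variable {X N : Type*} [TopologicalSpace X] [TopologicalSpace N]

/-- A pair of maps is loose if the two maps can be deformed away from one another. -/
def Loose (f₁ f₂ : C(X, N)) : Prop :=
  ∃ f₁' f₂' : C(X, N), ContinuousMap.Homotopic f₁ f₁' ∧ ContinuousMap.Homotopic f₂ f₂' ∧
    ∀ x, f₁' x ≠ f₂' x

/-- `f` is coincidence producing if `(f, f')` is loose for no map `f'`. -/
def CoincidenceProducing (f : C(X, N)) : Prop :=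
  ∀ f' : C(X, N), ¬ Loose f f'

end Loose

/-- The pair `(f, f)` is loose by small deformation: for every metric `d` on `N` which induces the
topology `t` of `N`, and every `ε > 0`, there is an `ε`-approximation of `f` which has no
coincidence with `f`. -/
def LooseBySmallDeformation {X N : Type*} [TopologicalSpace X] [t : TopologicalSpace N]
    (f : C(X, N)) : Prop :=
  ∀ d : MetricSpace N,
    d.toPseudoMetricSpace.toUniformSpace.toTopologicalSpace = t →
      ∀ ε : ℝ, 0 < ε → ∃ f' : X → N, Continuous[_, t] f' ∧
        ∀ x, d.dist (f' x) (f x) < ε ∧ f' x ≠ f x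

/-! ### Homotopy groups -/

section HomotopyGroups

variable {X Y : Type*} [TopologicalSpace X] [TopologicalSpace Y]

/-- The neutral element of `π_k(X, x)` (for `k = 0`: the base point of the pointed set `π_0`). -/
def zeroClass (k : ℕ) (x : X) : π_ k X x := Quotient.mk _ GenLoop.const

/-- The map induced on homotopy groups by a continuous map. -/
def inducedMap (k : ℕ) (j : C(X, Y)) (x : X) : π_ k X x → π_ k Y (j x) :=
  Quotient.map
    (fun g => ⟨j.comp g.1, fun y hy => congrArg j (g.2 y hy)⟩)
    (fun _ _ h => h.comp_continuousMap j)

/-- The kernel of the map induced on homotopy groups by a continuous map. -/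
def inducedKer (k : ℕ) (j : C(X, Y)) (x : X) : Set (π_ k X x) :=
  {β | inducedMap k j x β = zeroClass k (j x)}

/-- The graph of the boundary map `π_{k+1}(B, b₀) → π_k(F, f₀)` in the homotopy sequence of a
fibration `p : E → B` whose fibre over `b₀` is identified with `F` through `ι : F → E`: lift a
representative `g : I^{k+1} → B` of `α` to a map `G : I^{k+1} → E` which is constant, with value
`ι f₀`, on all faces of the cube except possibly the face `t₀ = 0`; the restriction of `G` to that
face then represents the image `β` of `α`. -/
def BoundaryRel {F E B : Type*} [TopologicalSpace F] [TopologicalSpace E] [TopologicalSpace B]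
    (ι : F → E) (p : E → B) (k : ℕ) (f₀ : F) (b₀ : B)
    (α : π_ (k + 1) B b₀) (β : π_ k F f₀) : Prop :=
  ∃ (g : Ω^ (Fin (k + 1)) B b₀) (c : Ω^ (Fin k) F f₀) (G : C(I^(Fin (k + 1)), E)),
    (Quotient.mk _ g : π_ (k + 1) B b₀) = α ∧ (Quotient.mk _ c : π_ k F f₀) = β ∧
    (∀ t, p (G t) = g t) ∧
    (∀ t : I^(Fin (k + 1)), (t 0 = 1 ∨ ∃ i : Fin k, t i.succ = 0 ∨ t i.succ = 1) → G t = ι f₀) ∧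
    ∀ s : I^(Fin k), G (Fin.cons 0 s) = ι (c s)

end HomotopyGroups

/-! ### Spheres -/

/-- The unit sphere `S^{n-1}` in `ℝ^n`. -/
abbrev USphere (n : ℕ) : Type := Metric.sphere (0 : EuclideanSpace ℝ (Fin n)) 1

/-- The base point `(1, 0, …, 0)` of `S^m ⊆ ℝ^{m+1}`. -/
def pole (m : ℕ) : USphere (m + 1) := ⟨EuclideanSpace.single 0 1, by simp⟩

/-- `2 t - 1`, the vector from the centre of the cube (rescaled to `[-1, 1]^m`) to `t`. -/
def cubeVec (m : ℕ) (t : I^(Fin m)) (i : Fin m) : ℝ := 2 * (t i : ℝ) - 1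

/-- A function on the cube which vanishes precisely on the boundary. -/
def cubeBdry (m : ℕ) (t : I^(Fin m)) : ℝ := ∏ i, (t i : ℝ) * (1 - (t i : ℝ))

/-- `∑ uᵢ² + b²`, where `u = cubeVec m t` and `b = cubeBdry m t`. -/
def cubeDen (m : ℕ) (t : I^(Fin m)) : ℝ := ∑ i, cubeVec m t i ^ 2 + cubeBdry m t ^ 2

theorem cubeBdry_eq_zero_iff (m : ℕ) (t : I^(Fin m)) :
    cubeBdry m t = 0 ↔ t ∈ Cube.boundary (Fin m) := by
  simp only [cubeBdry, Finset.prod_eq_zero_iff, Finset.mem_univ, true_and, mul_eq_zero,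
    Cube.boundary, Set.mem_ofPred_eq, sub_eq_zero]
  refine exists_congr fun i => or_congr ?_ ?_
  · exact ⟨fun h => Subtype.ext h, fun h => by rw [h]; rfl⟩
  · exact ⟨fun h => Subtype.ext h.symm, fun h => by rw [h]; rfl⟩

theorem cubeDen_pos (m : ℕ) (t : I^(Fin m)) : 0 < cubeDen m t := by
  have h1 : 0 ≤ ∑ i, cubeVec m t i ^ 2 := Finset.sum_nonneg fun i _ => sq_nonneg _
  by_cases hb : cubeBdry m t = 0
  · obtain ⟨i, hi⟩ := (cubeBdry_eq_zero_iff m t).1 hb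
    have h2 : cubeVec m t i ^ 2 = 1 := by
      rcases hi with hi | hi <;> simp [cubeVec, hi]; norm_num
    have h3 : cubeVec m t i ^ 2 ≤ ∑ i, cubeVec m t i ^ 2 :=
      Finset.single_le_sum (f := fun i => cubeVec m t i ^ 2) (fun i _ => sq_nonneg _)
        (Finset.mem_univ i)
    have h4 := sq_nonneg (cubeBdry m t)
    unfold cubeDen
    linarith
  · have h4 : 0 < cubeBdry m t ^ 2 := by positivity
    unfold cubeDen
    linarith

/-- The map `I^m → S^m` which collapses the boundary of the cube to the base point and which maps
the interior homeomorphically onto the complement of the base point: the interior is mapped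
radially onto `ℝ^m` by `u / b`, where `u = cubeVec m t` and `b = cubeBdry m t`, followed by the
inverse `w ↦ (|w|² - 1, 2 w) / (|w|² + 1)` of the stereographic projection. -/
def collapse (m : ℕ) : C(I^(Fin m), USphere (m + 1)) where
  toFun t := ⟨WithLp.toLp 2 (Fin.cons
      ((∑ i, cubeVec m t i ^ 2 - cubeBdry m t ^ 2) / cubeDen m t)
      (fun i => 2 * cubeBdry m t * cubeVec m t i / cubeDen m t)), by
    have hD := cubeDen_pos m t
    rw [mem_sphere_zero_iff_norm, EuclideanSpace.norm_eq, Real.sqrt_eq_one, Fin.sum_univ_succ]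
    simp only [Fin.cons_zero, Fin.cons_succ, Real.norm_eq_abs, sq_abs, div_pow, mul_pow]
    rw [← Finset.sum_div, ← Finset.mul_sum, ← add_div, div_eq_one_iff_eq (by positivity)]
    unfold cubeDen
    ring⟩
  continuous_toFun := by
    have hu : ∀ i, Continuous fun t : I^(Fin m) => cubeVec m t i := fun i => by
      unfold cubeVec; fun_prop
    have hb : Continuous fun t : I^(Fin m) => cubeBdry m t := by
      unfold cubeBdry; fun_prop
    have hD : Continuous fun t : I^(Fin m) => cubeDen m t := by
      unfold cubeDen; fun_prop
    refine Continuous.subtype_mk ((PiLp.continuous_toLp 2 _).comp (continuous_pi fun i => ?_)) _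
    refine Fin.cases ?_ (fun i => ?_) i
    · simp only [Fin.cons_zero]
      exact Continuous.div (by fun_prop) hD fun t => (cubeDen_pos m t).ne'
    · simp only [Fin.cons_succ]
      exact Continuous.div (by fun_prop) hD fun t => (cubeDen_pos m t).ne'

theorem collapse_of_mem_boundary (m : ℕ) (t : I^(Fin m)) (ht : t ∈ Cube.boundary (Fin m)) :
    collapse m t = pole m := by
  have hb := (cubeBdry_eq_zero_iff m t).2 ht
  have hD := cubeDen_pos m t
  have hD' : ∑ i, cubeVec m t i ^ 2 = cubeDen m t := by simp [cubeDen, hb]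
  refine Subtype.ext ?_
  ext i
  refine Fin.cases ?_ (fun i => ?_) i
  · simp [collapse, pole, hb, hD', hD.ne']
  · simp [collapse, pole, hb]

/-- The class `[f] ∈ π_m(N, x₀)` of a base point preserving map `f : S^m → N`. -/
def sphereClass {N : Type*} [TopologicalSpace N] {x₀ : N} (m : ℕ) (f : C(USphere (m + 1), N))
    (hf : f (pole m) = x₀) : π_ m N x₀ :=
  Quotient.mk _ (⟨f.comp (collapse m), fun t ht =>
    (congrArg f (collapse_of_mem_boundary m t ht)).trans hf⟩ : Ω^ (Fin m) N x₀)

/-! ### The tangent sphere bundle, the boundary map, and the inclusion of a small sphere -/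

section Manifolds

variable {n : ℕ} {N : Type*} [TopologicalSpace N] [ChartedSpace (EuclideanSpace ℝ (Fin n)) N]
  [IsManifold (𝓡 n) ∞ N]

/-- Riemannian metrics on `N`. -/
abbrev RMetric (n : ℕ) (N : Type*) [TopologicalSpace N]
    [ChartedSpace (EuclideanSpace ℝ (Fin n)) N] [IsManifold (𝓡 n) ∞ N] :=
  Bundle.ContMDiffRiemannianMetric (𝓡 n) ∞ (EuclideanSpace ℝ (Fin n))
    (fun x : N => TangentSpace (𝓡 n) x)

/-- The space `STN` of unit tangent vectors of `N`. -/
abbrev UnitTangent (g : RMetric n N) : Type _ :=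
  {v : TangentBundle (𝓡 n) N // g.inner v.proj v.snd v.snd = 1}

/-- Linear isometries of `ℝ^n` onto the tangent space at `x₀`. -/
structure Frame (g : RMetric n N) (x₀ : N) where
  /-- the underlying linear isomorphism -/
  toEquiv : EuclideanSpace ℝ (Fin n) ≃L[ℝ] TangentSpace (𝓡 n) x₀
  isometry : ∀ v, g.inner x₀ (toEquiv v) (toEquiv v) = ‖v‖ ^ 2

/-- The identification of `S^{n-1}` with the fibre of `STN` over `x₀` given by a frame. -/
def Frame.fibreIncl {g : RMetric n N} {x₀ : N} (φ : Frame g x₀) (s : USphere n) :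
    UnitTangent g :=
  ⟨⟨x₀, φ.toEquiv s.1⟩, by simp [φ.isometry]⟩

/-- The graph of the boundary map `π_{k+1}(N, x₀) → π_k(S^{n-1}, s₀)` in the homotopy sequence
of the fibration `STN → N`. -/
def TangentBoundaryRel {g : RMetric n N} {x₀ : N} (φ : Frame g x₀) (s₀ : USphere n) (k : ℕ)
    (α : π_ (k + 1) N x₀) (β : π_ k (USphere n) s₀) : Prop :=
  BoundaryRel φ.fibreIncl (fun v : UnitTangent g => v.1.proj) k s₀ x₀ α β

/-- The boundary homomorphism `∂_N : π_{k+1}(N, x₀) → π_k(S^{n-1}, s₀)` in the homotopy sequence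
of the fibration `STN → N`; by convention it is trivial for `k = 0`. For `k ≥ 1` its value is the
class determined by `TangentBoundaryRel`. -/
def boundary {g : RMetric n N} {x₀ : N} (φ : Frame g x₀) (s₀ : USphere n) :
    (k : ℕ) → π_ (k + 1) N x₀ → π_ k (USphere n) s₀
  | 0, _ => zeroClass 0 s₀
  | k + 1, α => Classical.epsilon fun β => TangentBoundaryRel φ s₀ (k + 1) α β

/-- A smooth ball in `N`, given with a slightly larger open ball (parametrized by `ℝ^n`) in which
it lies: the ball itself is the image of the closed unit ball of `ℝ^n`. -/
structure SmoothBall (n : ℕ) (N : Type*) [TopologicalSpace N]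
    [ChartedSpace (EuclideanSpace ℝ (Fin n)) N] where
  /-- the parametrization -/
  toFun : EuclideanSpace ℝ (Fin n) → N
  isLocalDiffeomorph : IsLocalDiffeomorph (𝓡 n) (𝓡 n) ∞ toFun
  injective : Function.Injective toFun

/-- The centre of a smooth ball. -/
def SmoothBall.centre (b : SmoothBall n N) : N := b.toFun 0

/-- The inclusion `j_N : S^{n-1} → N - {x₀}` of the boundary sphere of a smooth ball with
centre `x₀`. -/
def SmoothBall.sphereIncl (b : SmoothBall n N) : C(USphere n, {x : N // x ≠ b.centre}) where
  toFun s := ⟨b.toFun s.1, fun h => by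
    have h0 : (s : EuclideanSpace ℝ (Fin n)) = 0 := b.injective h
    have h1 : ‖(s : EuclideanSpace ℝ (Fin n))‖ = 1 := by simp
    rw [h0, norm_zero] at h1
    exact zero_ne_one h1⟩
  continuous_toFun := Continuous.subtype_mk
    (b.isLocalDiffeomorph.contMDiff.continuous.comp continuous_subtype_val) _

/-- The frame `φ` and the smooth ball `b` identify `S^{n-1}` with the unit tangent sphere at the
centre of `b`, and with the boundary sphere of `b`, resp., in the same orientation. -/
def Frame.Compatible {g : RMetric n N} (b : SmoothBall n N) (φ : Frame g b.centre) : Prop :=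
  let D : EuclideanSpace ℝ (Fin n) →L[ℝ] TangentSpace (𝓡 n) b.centre :=
    mfderiv (𝓡 n) (𝓡 n) b.toFun 0
  0 < ((φ.toEquiv.symm : TangentSpace (𝓡 n) b.centre →L[ℝ] EuclideanSpace ℝ (Fin n)).comp D).det

end Manifolds

/-! ### Projective spaces -/

/-- The projective space `𝕂P(r)` of lines through `0` in `𝕂^{r+1}`. -/
def ProjSpace (𝕂 : Type) [DivisionRing 𝕂] (r : ℕ) : Type :=
  Projectivization 𝕂 (Fin (r + 1) → 𝕂)

/-- `𝕂P(r)` carries the quotient topology. -/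
instance (𝕂 : Type) [DivisionRing 𝕂] [TopologicalSpace 𝕂] (r : ℕ) :
    TopologicalSpace (ProjSpace 𝕂 r) :=
  inferInstanceAs (TopologicalSpace
    (Quotient (projectivizationSetoid 𝕂 (Fin (r + 1) → 𝕂))))

/-- `N` is a real, complex or quaternionic projective space `𝕂P(r)`, `r ≥ 2`. -/
def IsProjSpace (N : Type*) [TopologicalSpace N] : Prop :=
  ∃ r : ℕ, 2 ≤ r ∧ (Nonempty (N ≃ₜ ProjSpace ℝ r) ∨ Nonempty (N ≃ₜ ProjSpace ℂ r) ∨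
    Nonempty (N ≃ₜ ProjSpace (Quaternion ℝ) r))

end Coincidence

end

set_option linter.unusedSectionVars false

noncomputable section

namespace Coincidence

/-! All three looseness conditions are lifting problems. A map `f` is loose by small deformation
from itself exactly when it lifts to the unit tangent bundle `STN → N`: a nearby map without
coincidences is a nowhere zero vector field along `f`. It fails to be coincidence producing exactly
when it lifts to the first projection `DistinctPairs N → N`, whose fibre over `x₀` is `N - {x₀}`.
Both projections have local transport, hence a regular homotopy lifting property over compact
Hausdorff spaces (`LocTransport.exists_lift`). So lifting depends only on the homotopy class, and on
spheres it is governed by a boundary map: view the sphere as a cube with collapsed boundary, lift so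
that all faces but the bottom one go to one point, and ask whether the bottom face is null-homotopic
in the fibre (`LocTransport.liftsTo_iff`, for path-connected fibres).

The two boundary maps are compared by a substitute for the exponential map. Chart differences `y -
x`, averaged with a partition of unity, give `diffMap : N × N → TN`, a local homeomorphism along the
diagonal by the inverse function theorem. Its local inverse turns a lift to `STN` into a lift to
`DistinctPairs N`. It carries the fibre sphere to a small sphere around `x₀`, which is homotopic to
`j_N` in `N - {x₀}` because the linear part has positive determinant
(`exists_homotopy_exp_sphereIncl`). Hence the obstruction for `DistinctPairs N` is `j_{N*} ∂_N [f]`,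
the one for `STN` is `∂_N [f]`, and the criterion `(*)` says that the first vanishes only if the
second does.

For `n = 1` the fibre `S⁰` is disconnected. In positive degrees its homotopy groups are trivial. For
loops one needs that `STN` is a trivial double covering along every loop: signed arc length is a
local time on `STN`, and the time-reversing involution `v ↦ -v` has no fixed point, so no path joins
`v` to `-v`.

For the examples it suffices that a small spheroid around `x₀` which bounds in `N - {x₀}` already
bounds near `x₀` (`GermInjOn`). If `N` is not simply connected, a null-homotopy lifts to a connected
covering and there misses two points `a`, `b` over `x₀`. If `b` is close to `a`, a map which sends
`b` to infinity and crushes everything far away to one point carries the null-homotopy into a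
punctured vector space; the general position of `b` follows since the complement of `a` is
connected. In a projective space, projection from `x₀` to a hyperplane turns the link of `x₀` into
the total space of the tautological bundle without zero. The projected null-homotopy lifts there and
ends in a single line, which can be contracted in the complement of zero. -/

/-! ### Maps with local transport, and the lifting of homotopies -/

section Lifting

variable {E B Z : Type*} [TopologicalSpace E] [TopologicalSpace B] [TopologicalSpace Z]

/-- `T` transports the points of `E` lying over `U` to the fibres over the points of `U`. -/
structure IsTransportOn (p : E → B) (U : Set B) (T : E × B → E) : Prop where
  continuousOn : ContinuousOn T {z | p z.1 ∈ U ∧ z.2 ∈ U}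
  proj : ∀ e b, p e ∈ U → b ∈ U → p (T (e, b)) = b
  self : ∀ e, p e ∈ U → T (e, p e) = e

/-- Every point of the base has a neighbourhood over which there is a transport. -/
def LocTransport (p : E → B) : Prop :=
  ∀ b, ∃ U ∈ 𝓝 b, ∃ T, IsTransportOn p U T

/-- Apply `T` on `O` and do nothing elsewhere. The two rules agree outside the closed set `C`, where
`b z` is already `p (e z)` and `T` acts trivially, so the result is continuous. For the same reason
points that need not move stay fixed, which gives regularity of the lifts below. -/
theorem IsTransportOn.move {p : E → B} {U : Set B} {T : E × B → E}
    (hT : IsTransportOn p U T) {e : Z → E} (he : Continuous e) {b : Z → B} (hb : Continuous b)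
    {O C : Set Z} (hO : IsOpen O) (hC : IsClosed C) (hCO : C ⊆ O)
    (hU : ∀ z ∈ O, p (e z) ∈ U ∧ b z ∈ U) (hbC : ∀ z ∉ C, b z = p (e z)) :
    ∃ e' : Z → E, Continuous e' ∧ (∀ z, p (e' z) = b z) ∧ ∀ z, b z = p (e z) → e' z = e z := by
  classical
  have key : ∀ z ∈ O, b z = p (e z) → T (e z, b z) = e z := fun z hz h => by
    rw [h]; exact hT.self _ (hU z hz).1
  refine ⟨fun z => if z ∈ O then T (e z, b z) else e z, ?_, ?_, ?_⟩
  · rw [continuous_iff_continuousAt]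
    intro z
    by_cases hz : z ∈ O
    · have h1 : ContinuousOn (fun z => T (e z, b z)) O :=
        hT.continuousOn.comp (he.prodMk hb).continuousOn fun z hz => hU z hz
      refine (h1.continuousAt (hO.mem_nhds hz)).congr ?_
      filter_upwards [hO.mem_nhds hz] with w hw
      simp [hw]
    · refine he.continuousAt.congr ?_
      filter_upwards [hC.isOpen_compl.mem_nhds fun h => hz (hCO h)] with w hw
      by_cases hwO : w ∈ O
      · simp [hwO, key w hwO (hbC w hw)]
      · simp [hwO]
  · intro z
    by_cases hz : z ∈ O
    · simp only [hz, if_true]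
      exact hT.proj _ _ (hU z hz).1 (hU z hz).2
    · simp only [hz, if_false]
      exact (hbC z fun h => hz (hCO h)).symm
  · intro z h
    by_cases hz : z ∈ O
    · simp only [hz, if_true]; exact key z hz h
    · simp [hz]

/-- Different points of `Z` require different transports, so time is advanced in finitely many
stages steered by a partition of unity. After the stages in `S`, the point `z` has reached the time
`s + (∑ i ∈ S, ρ i z) * (s' - s)`. The stage of `j` moves only points in the support of `ρ j`, where
the transport `T j` is available. -/
theorem exists_lift_of_small_time [CompactSpace Z] [T2Space Z] {p : E → B}
    {K : Z × ℝ → B} (hK : Continuous K) {s s' : ℝ} (hs : s ≤ s')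
    (hloc : ∀ z, ∃ O : Set Z, IsOpen O ∧ z ∈ O ∧ ∃ U T, IsTransportOn p U T ∧
      ∀ z' ∈ O, ∀ r ∈ Set.Icc s s', K (z', r) ∈ U)
    {e : Z → E} (he : Continuous e) (hpe : ∀ z, p (e z) = K (z, s)) :
    ∃ e' : Z → E, Continuous e' ∧ (∀ z, p (e' z) = K (z, s')) ∧
      ∀ z, (∀ r ∈ Set.Icc s s', K (z, r) = K (z, s)) → e' z = e z := by
  choose O hO hzO U T hT hU using hloc
  obtain ⟨t, ht⟩ := isCompact_univ.elim_finite_subcover O hO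
    fun z _ => Set.mem_iUnion.2 ⟨z, hzO z⟩
  obtain ⟨ρ, hρ⟩ := PartitionOfUnity.exists_isSubordinate (ι := t) isClosed_univ
    (fun i => O i) (fun i => hO i) (fun z _ => by
      obtain ⟨i, hi⟩ := Set.mem_iUnion.1 (ht (Set.mem_univ z))
      obtain ⟨hi, hz⟩ := Set.mem_iUnion.1 hi
      exact Set.mem_iUnion.2 ⟨⟨i, hi⟩, hz⟩)
  have hsum : ∀ z, ∑ i, ρ i z = 1 := fun z => by
    have := ρ.sum_eq_one (Set.mem_univ z)
    rwa [finsum_eq_sum_of_fintype] at this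
  have hσ : ∀ (S : Finset t) z, s + (∑ i ∈ S, ρ i z) * (s' - s) ∈ Set.Icc s s' := by
    intro S z
    have h0 : 0 ≤ ∑ i ∈ S, ρ i z := Finset.sum_nonneg fun i _ => ρ.nonneg i z
    have h1 : ∑ i ∈ S, ρ i z ≤ 1 := by
      rw [← hsum z]
      exact Finset.sum_le_univ_sum_of_nonneg fun i => ρ.nonneg i z
    constructor <;> nlinarith
  have hmain : ∀ S : Finset t, ∃ e' : Z → E, Continuous e' ∧
      (∀ z, p (e' z) = K (z, s + (∑ i ∈ S, ρ i z) * (s' - s))) ∧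
      ∀ z, (∀ r ∈ Set.Icc s s', K (z, r) = K (z, s)) → e' z = e z := by
    intro S
    classical
    induction S using Finset.induction_on with
    | empty => exact ⟨e, he, by simpa using hpe, fun _ _ => rfl⟩
    | insert j S hj ih =>
      obtain ⟨e₁, he₁, hpe₁, hreg⟩ := ih
      have hb : Continuous fun z => K (z, s + (∑ i ∈ insert j S, ρ i z) * (s' - s)) := by
        fun_prop
      obtain ⟨e₂, he₂, hpe₂, hreg₂⟩ := (hT j).move he₁ hb (hO j) (isClosed_tsupport (ρ j)) (hρ j)
        (fun z hz => ⟨by rw [hpe₁]; exact hU j z hz _ (hσ _ _), hU j z hz _ (hσ _ _)⟩)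
        (fun z hz => by
          rw [hpe₁, Finset.sum_insert hj, image_eq_zero_of_notMem_tsupport hz, zero_add])
      refine ⟨e₂, he₂, hpe₂, fun z hz => ?_⟩
      rw [hreg₂ z, hreg z hz]
      rw [hpe₁, hz _ (hσ _ _), hz _ (hσ _ _)]
  obtain ⟨e', h1, h2, h3⟩ := hmain Finset.univ
  refine ⟨e', h1, fun z => ?_, h3⟩
  rw [h2, hsum]
  congr 2
  ring

/-- Regular lifting of homotopies, for maps with local transport: over a compact space, the end of
a homotopy lifts if its beginning does; and the lift does not change where the homotopy is
stationary. -/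
theorem LocTransport.exists_lift [CompactSpace Z] [T2Space Z] {p : E → B} (hp : LocTransport p)
    {H : Z × I → B} (hH : Continuous H) {e : Z → E} (he : Continuous e)
    (hpe : ∀ z, p (e z) = H (z, 0)) :
    ∃ e' : Z → E, Continuous e' ∧ (∀ z, p (e' z) = H (z, 1)) ∧
      ∀ z, (∀ s, H (z, s) = H (z, 0)) → e' z = e z := by
  set K : Z × ℝ → B := fun z => H (z.1, Set.projIcc 0 1 zero_le_one z.2) with hKdef
  have hK : Continuous K := by
    have : Continuous (Set.projIcc (0 : ℝ) 1 zero_le_one) := continuous_projIcc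
    fun_prop
  have hKI : ∀ z (s : I), K (z, s) = H (z, s) := fun z s => by simp [hKdef]
  -- Compactness of `Z` makes the time interval `J` independent of `z`; a subdivision of `[0, 1]`
  -- subordinate to these intervals then reduces to small times.
  have hcov : ∀ s : I, ∃ J : Set I, IsOpen J ∧ s ∈ J ∧ ∀ z : Z, ∃ O : Set Z, IsOpen O ∧ z ∈ O ∧
      ∃ U T, IsTransportOn p U T ∧ ∀ z' ∈ O, ∀ r ∈ J, H (z', r) ∈ U := by
    intro s
    have h1 : ∀ z : Z, ∃ O : Set Z, IsOpen O ∧ z ∈ O ∧ ∃ J : Set I, IsOpen J ∧ s ∈ J ∧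
        ∃ U T, IsTransportOn p U T ∧ ∀ z' ∈ O, ∀ r ∈ J, H (z', r) ∈ U := by
      intro z
      obtain ⟨U, hU, T, hT⟩ := hp (H (z, s))
      have := hH.continuousAt.preimage_mem_nhds hU
      obtain ⟨O, J, hO, hz, hJ, hs, hOJ⟩ := mem_nhds_prod_iff'.1 this
      exact ⟨O, hO, hz, J, hJ, hs, U, T, hT, fun z' hz' r hr => hOJ ⟨hz', hr⟩⟩
    choose O hO hzO J hJ hsJ U T hT hU using h1
    obtain ⟨t, ht⟩ := isCompact_univ.elim_finite_subcover O hO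
      fun z _ => Set.mem_iUnion.2 ⟨z, hzO z⟩
    refine ⟨⋂ z ∈ t, J z, isOpen_biInter_finset fun z _ => hJ z,
      Set.mem_iInter₂.2 fun z _ => hsJ z, fun z => ?_⟩
    obtain ⟨i, hi⟩ := Set.mem_iUnion.1 (ht (Set.mem_univ z))
    obtain ⟨hi, hz⟩ := Set.mem_iUnion.1 hi
    exact ⟨O i, hO i, hz, U i, T i, hT i,
      fun z' hz' r hr => hU i z' hz' r (Set.mem_iInter₂.1 hr i hi)⟩
  choose J hJ hsJ hJ' using hcov
  obtain ⟨t, ht0, htm, ⟨n, htn⟩, htJ⟩ := exists_monotone_Icc_subset_open_cover_unitInterval hJ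
    fun s _ => Set.mem_iUnion.2 ⟨s, hsJ s⟩
  have hmain : ∀ n, ∃ e' : Z → E, Continuous e' ∧ (∀ z, p (e' z) = H (z, t n)) ∧
      ∀ z, (∀ s, H (z, s) = H (z, 0)) → e' z = e z := by
    intro n
    induction n with
    | zero => exact ⟨e, he, by simpa [ht0] using hpe, fun _ _ => rfl⟩
    | succ n ih =>
      obtain ⟨e₁, he₁, hpe₁, hreg₁⟩ := ih
      obtain ⟨i, hi⟩ := htJ n
      have hle : (t n : ℝ) ≤ t (n + 1) := htm n.le_succ
      obtain ⟨e₂, he₂, hpe₂, hreg₂⟩ := exists_lift_of_small_time (p := p) hK hle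
        (fun z => by
          obtain ⟨O, hO, hz, U, T, hT, hU⟩ := hJ' i z
          refine ⟨O, hO, hz, U, T, hT, fun z' hz' r hr => ?_⟩
          have hr01 : r ∈ Set.Icc (0 : ℝ) 1 :=
            ⟨(t n).2.1.trans hr.1, hr.2.trans (t (n + 1)).2.2⟩
          have := hU z' hz' ⟨r, hr01⟩ (hi ⟨hr.1, hr.2⟩)
          simpa [hKdef, Set.projIcc_of_mem _ hr01] using this)
        he₁ (fun z => by rw [hpe₁, hKI])
      refine ⟨e₂, he₂, fun z => by rw [hpe₂, hKI], fun z hz => ?_⟩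
      rw [hreg₂ z, hreg₁ z hz]
      intro r _
      simp only [hKdef, hz]
  obtain ⟨e', h1, h2, h3⟩ := hmain n
  exact ⟨e', h1, fun z => by rw [h2, htn n le_rfl], h3⟩

end Lifting

/-! ### Homotopies of maps of cubes -/

section Cubes

variable {X Y Y' : Type*} [TopologicalSpace X] [TopologicalSpace Y] [TopologicalSpace Y']

theorem homotopicRel_of_continuous {f g : C(X, Y)} {S : Set X} (H : I × X → Y) (hH : Continuous H)
    (h0 : ∀ x, H (0, x) = f x) (h1 : ∀ x, H (1, x) = g x)
    (hS : ∀ s, ∀ x ∈ S, H (s, x) = f x) : ContinuousMap.HomotopicRel f g S :=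
  ⟨{ toFun := H, continuous_toFun := hH, map_zero_left := h0, map_one_left := h1,
     prop' := fun s x hx => hS s x hx }⟩

theorem _root_.ContinuousMap.HomotopicRel.exists_continuous {f g : C(X, Y)} {S : Set X}
    (h : ContinuousMap.HomotopicRel f g S) : ∃ H : I × X → Y, Continuous H ∧
      (∀ x, H (0, x) = f x) ∧ (∀ x, H (1, x) = g x) ∧ ∀ s, ∀ x ∈ S, H (s, x) = f x := by
  obtain ⟨H⟩ := h
  exact ⟨H, H.continuous, H.apply_zero, H.apply_one, fun s x hx => H.eq_fst s hx⟩

theorem homotopic_of_continuous {f g : C(X, Y)} (H : I × X → Y) (hH : Continuous H)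
    (h0 : ∀ x, H (0, x) = f x) (h1 : ∀ x, H (1, x) = g x) : ContinuousMap.Homotopic f g :=
  ⟨{ toFun := H, continuous_toFun := hH, map_zero_left := h0, map_one_left := h1 }⟩

theorem _root_.ContinuousMap.Homotopic.exists_continuous {f g : C(X, Y)}
    (h : ContinuousMap.Homotopic f g) : ∃ H : I × X → Y, Continuous H ∧
      (∀ x, H (0, x) = f x) ∧ ∀ x, H (1, x) = g x := by
  obtain ⟨H⟩ := h
  exact ⟨H, H.continuous, H.apply_zero, H.apply_one⟩

theorem mk_eq_mk_iff {k : ℕ} {y : Y} {c c' : Ω^ (Fin k) Y y} :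
    (Quotient.mk _ c : π_ k Y y) = Quotient.mk _ c' ↔ GenLoop.Homotopic c c' :=
  Quotient.eq

/-- The map `c` on the cube can be deformed to a constant map within `S`, in such a way that the
boundary of the cube is mapped to a point all the time. -/
def NullIn {k : ℕ} (S : Set Y) (c : (I^(Fin k)) → Y) : Prop :=
  ∃ H : I × (I^(Fin k)) → Y, Continuous H ∧ (∀ t, H (0, t) = c t) ∧ (∀ z, H z ∈ S) ∧
    (∃ τ : I → Y, ∀ s, ∀ t ∈ Cube.boundary (Fin k), H (s, t) = τ s) ∧ ∃ y, ∀ t, H (1, t) = y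

theorem NullIn.comp {k : ℕ} {S : Set Y} {S' : Set Y'} {c : (I^(Fin k)) → Y} (h : NullIn S c)
    {g : Y → Y'} (hg : ContinuousOn g S) (hS : Set.MapsTo g S S') :
    NullIn S' fun t => g (c t) := by
  obtain ⟨H, hH, h0, hHS, ⟨τ, hτ⟩, y, hy⟩ := h
  refine ⟨fun z => g (H z), hg.comp_continuous hH hHS, fun t => congrArg g (h0 t),
    fun z => hS (hHS z), ⟨fun s => g (τ s), fun s t ht => congrArg g (hτ s t ht)⟩, g y,
    fun t => congrArg g (hy t)⟩

theorem NullIn.of_homotopy {k : ℕ} {S : Set Y} {c c' : (I^(Fin k)) → Y} (h : NullIn S c')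
    (H : I × (I^(Fin k)) → Y) (hH : Continuous H) (h0 : ∀ t, H (0, t) = c t)
    (h1 : ∀ t, H (1, t) = c' t) (hS : ∀ z, H z ∈ S)
    (hτ : ∃ τ : I → Y, ∀ s, ∀ t ∈ Cube.boundary (Fin k), H (s, t) = τ s) : NullIn S c := by
  obtain ⟨H', hH', h0', hHS', ⟨τ', hτ'⟩, y, hy⟩ := h
  obtain ⟨τ, hτ⟩ := hτ
  have hp : Continuous (Set.projIcc (0 : ℝ) 1 zero_le_one) := continuous_projIcc
  have e0 : Set.projIcc (0 : ℝ) 1 zero_le_one 0 = 0 := by simp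
  have e1 : Set.projIcc (0 : ℝ) 1 zero_le_one 1 = 1 := by simp
  refine ⟨fun z => if (z.1 : ℝ) ≤ 1 / 2 then H (Set.projIcc 0 1 zero_le_one (2 * (z.1 : ℝ)), z.2)
    else H' (Set.projIcc 0 1 zero_le_one (2 * (z.1 : ℝ) - 1), z.2), ?_, ?_, ?_, ?_, ?_⟩
  · refine Continuous.if_le (by fun_prop) (by fun_prop) (by fun_prop) (by fun_prop) ?_
    rintro ⟨s, t⟩ hs
    simp only at hs
    simp only [hs]
    norm_num
    rw [h1, h0']
  · intro t; simp [h0]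
  · intro z
    dsimp only
    split_ifs
    · exact hS _
    · exact hHS' _
  · refine ⟨fun s => if (s : ℝ) ≤ 1 / 2 then τ (Set.projIcc 0 1 zero_le_one (2 * (s : ℝ)))
      else τ' (Set.projIcc 0 1 zero_le_one (2 * (s : ℝ) - 1)), fun s t ht => ?_⟩
    simp only [hτ _ t ht, hτ' _ t ht]
  · refine ⟨y, fun t => ?_⟩
    norm_num [hy]

theorem NullIn.mono {k : ℕ} {S S' : Set Y} {c : (I^(Fin k)) → Y} (h : NullIn S c) (hS : S ⊆ S') :
    NullIn S' c :=
  h.comp (g := id) continuousOn_id hS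

theorem NullIn.to_subtype {k : ℕ} {S : Set Y} {c : (I^(Fin k)) → S}
    (h : NullIn S fun t => (c t : Y)) : NullIn Set.univ c := by
  obtain ⟨H, hH, h0, hHS, ⟨τ, hτ⟩, y, hy⟩ := h
  have hy' : y ∈ S := by
    have := hHS (1, fun _ => 0)
    rwa [hy] at this
  classical
  -- For `k = 0` the boundary of the cube is empty and nothing is known about `τ`, so values outside
  -- `S` are replaced by `y`.
  refine ⟨fun z => ⟨H z, hHS z⟩, hH.subtype_mk _, fun t => Subtype.ext (h0 t),
    fun _ => trivial, ⟨fun s => if h : τ s ∈ S then ⟨τ s, h⟩ else ⟨y, hy'⟩, fun s t ht => ?_⟩,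
    ⟨y, hy'⟩, fun t => Subtype.ext (hy t)⟩
  have hs := hτ s t ht
  have : τ s ∈ S := hs ▸ hHS (s, t)
  simp [this, hs]

/-- The expansion of the cube from its centre, cut off at the boundary. -/
def cubeExpand (k : ℕ) (z : I × (I^(Fin k))) : I^(Fin k) :=
  fun i => Set.projIcc 0 1 zero_le_one ((1 + (z.1 : ℝ)) * (z.2 i : ℝ) - (z.1 : ℝ) / 2)

theorem continuous_cubeExpand (k : ℕ) : Continuous (cubeExpand k) := by
  have hp : Continuous (Set.projIcc (0 : ℝ) 1 zero_le_one) := continuous_projIcc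
  unfold cubeExpand
  fun_prop

theorem cubeExpand_zero (k : ℕ) (t : I^(Fin k)) : cubeExpand k (0, t) = t := by
  ext i; simp [cubeExpand]

theorem cubeExpand_mem_boundary (k : ℕ) (s : I) {t : I^(Fin k)}
    (ht : t ∈ Cube.boundary (Fin k)) : cubeExpand k (s, t) ∈ Cube.boundary (Fin k) := by
  obtain ⟨i, hi | hi⟩ := ht
  · refine ⟨i, Or.inl ?_⟩
    have : -((s : ℝ) / 2) ≤ 0 := by have := s.2.1; linarith
    simp [cubeExpand, hi, Set.projIcc_of_le_left _ this]
  · refine ⟨i, Or.inr ?_⟩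
    have : 1 ≤ (1 + (s : ℝ)) - (s : ℝ) / 2 := by have := s.2.1; linarith
    simp [cubeExpand, hi, Set.projIcc_of_right_le _ this]

/-- A function which vanishes on the boundary of the cube and is greater than `1` on the central
subcube of half the size. -/
def cubeHeight (k : ℕ) (t : I^(Fin k)) : ℝ := ∏ i, (16 / 3 * ((t i : ℝ) * (1 - (t i : ℝ))))

theorem continuous_cubeHeight (k : ℕ) : Continuous (cubeHeight k) := by
  unfold cubeHeight; fun_prop

theorem cubeHeight_of_mem_boundary (k : ℕ) {t : I^(Fin k)} (ht : t ∈ Cube.boundary (Fin k)) :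
    cubeHeight k t = 0 := by
  obtain ⟨i, hi⟩ := ht
  refine Finset.prod_eq_zero (Finset.mem_univ i) ?_
  rcases hi with hi | hi <;> simp [hi]

/-- At time `1` the expansion has factor `2`, so only the open central subcube `(1/4, 3/4)^(k+1)`
stays in the interior. There every `t i * (1 - t i)` exceeds `3/16`, which explains the factor
`16/3` in `cubeHeight`. In dimension `0` the height is the empty product `1` and the boundary is
empty, so positive dimension is needed. -/
theorem cubeExpand_one_mem_boundary {k : ℕ} {t : I^(Fin (k + 1))} (ht : cubeHeight (k + 1) t ≤ 1) :
    cubeExpand (k + 1) (1, t) ∈ Cube.boundary (Fin (k + 1)) := by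
  by_contra h
  have h' : ∀ i, (1 / 4 : ℝ) < t i ∧ (t i : ℝ) < 3 / 4 := by
    intro i
    by_contra hi
    apply h
    rw [not_and_or, not_lt, not_lt] at hi
    rcases hi with hi | hi
    · refine ⟨i, Or.inl ?_⟩
      have : (1 + 1) * (t i : ℝ) - 1 / 2 ≤ 0 := by linarith
      simp only [cubeExpand, Set.Icc.coe_one, Set.projIcc_of_le_left _ this]; rfl
    · refine ⟨i, Or.inr ?_⟩
      have : 1 ≤ (1 + 1) * (t i : ℝ) - 1 / 2 := by linarith
      simp only [cubeExpand, Set.Icc.coe_one, Set.projIcc_of_right_le _ this]; rfl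
  have hfac : ∀ i, 1 < (16 / 3 * ((t i : ℝ) * (1 - (t i : ℝ)))) := fun i => by
    have := h' i
    nlinarith [mul_pos (sub_pos.2 this.1) (sub_pos.2 this.2)]
  have : (1 : ℝ) < cubeHeight (k + 1) t := by
    have := Finset.prod_lt_prod_of_nonempty (s := Finset.univ) (f := fun _ : Fin (k + 1) => (1 : ℝ))
      (g := fun i => 16 / 3 * ((t i : ℝ) * (1 - (t i : ℝ)))) (fun _ _ => one_pos)
      (fun i _ => hfac i) Finset.univ_nonempty
    simpa [cubeHeight] using this
  linarith

theorem homotopicRel_expand {k : ℕ} {c : C(I^(Fin k), Y)} {y : Y}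
    (hc : ∀ t ∈ Cube.boundary (Fin k), c t = y) :
    ContinuousMap.HomotopicRel c
      (c.comp ⟨fun t => cubeExpand k (1, t), (continuous_cubeExpand k).comp (by fun_prop)⟩)
      (Cube.boundary (Fin k)) := by
  refine homotopicRel_of_continuous (fun z => c (cubeExpand k z))
    (c.continuous.comp (continuous_cubeExpand k)) (fun t => by rw [cubeExpand_zero])
    (fun t => rfl) fun s t ht => ?_
  rw [hc _ (cubeExpand_mem_boundary k s ht), hc _ ht]

theorem zero_mem_boundary (k : ℕ) : (fun _ => 0) ∈ Cube.boundary (Fin (k + 1)) :=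
  ⟨0, Or.inl rfl⟩

/-- The point is that a free null-homotopy suffices. Expand `c` so that a collar of the boundary
goes to the base point, and run the homotopy at `t` only up to the time `κ t`, which vanishes on the
boundary. This ends at `τ ∘ κ`, where `τ` is the track of the base point; that map factors through
an interval and contracts to `τ 0 = y` with the boundary fixed. -/
theorem mk_eq_zeroClass_iff {k : ℕ} {y : Y} (c : Ω^ (Fin (k + 1)) Y y) :
    (Quotient.mk _ c : π_ (k + 1) Y y) = zeroClass (k + 1) y ↔ NullIn Set.univ c := by
  rw [zeroClass, mk_eq_mk_iff]
  constructor
  · intro h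
    obtain ⟨H, hH, h0, h1, hS⟩ := ContinuousMap.HomotopicRel.exists_continuous h
    exact ⟨H, hH, h0, fun _ => trivial, ⟨fun _ => y, fun s t ht => (hS s t ht).trans (c.2 t ht)⟩,
      y, h1⟩
  · rintro ⟨H, hH, h0, -, ⟨τ, hτ⟩, y₁, hy₁⟩
    have hp : Continuous (Set.projIcc (0 : ℝ) 1 zero_le_one) := continuous_projIcc
    have hht := continuous_cubeHeight (k + 1)
    have hex := continuous_cubeExpand (k + 1)
    set κ : (I^(Fin (k + 1))) → I := fun t => Set.projIcc 0 1 zero_le_one (cubeHeight (k + 1) t)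
      with hκ
    have hκc : Continuous κ := by fun_prop
    have hκ0 : ∀ t ∈ Cube.boundary (Fin (k + 1)), κ t = 0 := fun t ht => by
      simp [hκ, cubeHeight_of_mem_boundary _ ht]
    have hτc : Continuous τ := by
      have : τ = fun s => H (s, fun _ => 0) := funext fun s => (hτ s _ (zero_mem_boundary k)).symm
      rw [this]; fun_prop
    have hτ0 : τ 0 = y := by
      rw [← hτ 0 _ (zero_mem_boundary k), h0]; exact c.2 _ (zero_mem_boundary k)
    have hτ1 : τ 1 = y₁ := by rw [← hτ 1 _ (zero_mem_boundary k), hy₁]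
    have hcb : ∀ t ∈ Cube.boundary (Fin (k + 1)), c t = y := c.2
    refine (homotopicRel_expand c.2).trans (ContinuousMap.HomotopicRel.trans
      (g := ⟨fun t => τ (κ t), hτc.comp hκc⟩)
      (homotopicRel_of_continuous (fun z => H (min z.1 (κ z.2), cubeExpand (k + 1) (1, z.2)))
        (by fun_prop) ?_ ?_ ?_)
      (homotopicRel_of_continuous (fun z => τ (unitInterval.symm z.1 * κ z.2))
        (by fun_prop) ?_ ?_ ?_))
    · intro t
      have : min 0 (κ t) = 0 := min_eq_left (κ t).2.1
      simp only [this, h0]; rfl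
    · intro t
      have : min 1 (κ t) = κ t := min_eq_right (κ t).2.2
      simp only [this, ContinuousMap.coe_mk]
      rcases le_total (cubeHeight (k + 1) t) 1 with h | h
      · exact hτ _ _ (cubeExpand_one_mem_boundary h)
      · have : κ t = 1 := Set.projIcc_of_right_le _ h
        rw [this, hy₁, hτ1]
    · intro s t ht
      have hm := cubeExpand_mem_boundary (k + 1) 1 ht
      have : min s (κ t) = 0 := by rw [hκ0 t ht]; exact min_eq_right s.2.1
      simp only [this, h0]; rfl
    · intro t; simp
    · intro t; simp [hτ0]
    · intro s t ht
      simp [hκ0 t ht]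

end Cubes

/-! ### The collapse of the cube to the sphere -/

section Collapse

theorem collapse_zero_coord (m : ℕ) (t : I^(Fin m)) : (collapse m t).1 0 =
    (∑ i, cubeVec m t i ^ 2 - cubeBdry m t ^ 2) / cubeDen m t := rfl

theorem collapse_succ_coord (m : ℕ) (t : I^(Fin m)) (i : Fin m) : (collapse m t).1 i.succ =
    2 * cubeBdry m t * cubeVec m t i / cubeDen m t := rfl

theorem cubeBdry_nonneg (m : ℕ) (t : I^(Fin m)) : 0 ≤ cubeBdry m t :=
  Finset.prod_nonneg fun i _ => mul_nonneg (t i).2.1 (sub_nonneg.2 (t i).2.2)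

theorem cubeBdry_eq (m : ℕ) (t : I^(Fin m)) :
    cubeBdry m t = ∏ i, ((1 - cubeVec m t i ^ 2) / 4) :=
  Finset.prod_congr rfl fun i _ => by unfold cubeVec; ring

/-- Along rays from the centre `cubeBdry` decreases; this is what makes the radial map `u / b`
injective on each ray. -/
theorem cubeBdry_le_of_scale {m : ℕ} {t t' : I^(Fin m)} {l : ℝ} (hl : 1 ≤ l)
    (h : ∀ i, cubeVec m t i = l * cubeVec m t' i) : cubeBdry m t ≤ cubeBdry m t' := by
  refine Finset.prod_le_prod (fun i _ => mul_nonneg (t i).2.1 (sub_nonneg.2 (t i).2.2))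
    fun i _ => ?_
  have h1 : cubeVec m t' i ^ 2 ≤ cubeVec m t i ^ 2 := by
    rw [h i, mul_pow]
    have := sq_nonneg (cubeVec m t' i)
    nlinarith [one_le_pow₀ hl (n := 2)]
  unfold cubeVec at h1
  nlinarith

/-- The value of `collapse` determines whether `b` vanishes, and otherwise the stereographic
coordinate `u / b`. If `u / b = u' / b'` and, say, `b > b'`, then `t` lies farther out on the same
ray, so `b ≤ b'` by `cubeBdry_le_of_scale`, a contradiction. Hence `b = b'` and `u = u'`. -/
theorem collapse_eq_iff (m : ℕ) (t t' : I^(Fin m)) : collapse m t = collapse m t' ↔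
    t = t' ∨ (t ∈ Cube.boundary (Fin m) ∧ t' ∈ Cube.boundary (Fin m)) := by
  constructor
  swap
  · rintro (rfl | ⟨h, h'⟩)
    · rfl
    · rw [collapse_of_mem_boundary m t h, collapse_of_mem_boundary m t' h']
  intro h
  have hD := cubeDen_pos m t
  have hD' := cubeDen_pos m t'
  -- One minus the first coordinate of `collapse m t` is `2 b² / (|u|² + b²)`.
  have e0 : cubeBdry m t ^ 2 / cubeDen m t = cubeBdry m t' ^ 2 / cubeDen m t' := by
    have h0 : (collapse m t).1 0 = (collapse m t').1 0 := by rw [h]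
    rw [collapse_zero_coord, collapse_zero_coord] at h0
    have a : (∑ i, cubeVec m t i ^ 2 - cubeBdry m t ^ 2) / cubeDen m t =
        1 - 2 * (cubeBdry m t ^ 2 / cubeDen m t) := by
      field_simp; unfold cubeDen; ring
    have a' : (∑ i, cubeVec m t' i ^ 2 - cubeBdry m t' ^ 2) / cubeDen m t' =
        1 - 2 * (cubeBdry m t' ^ 2 / cubeDen m t') := by
      field_simp; unfold cubeDen; ring
    linarith
  have e1 : ∀ i, cubeBdry m t * cubeVec m t i / cubeDen m t =
      cubeBdry m t' * cubeVec m t' i / cubeDen m t' := fun i => by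
    have h0 : (collapse m t).1 i.succ = (collapse m t').1 i.succ := by rw [h]
    rw [collapse_succ_coord, collapse_succ_coord, mul_assoc, mul_assoc, mul_div_assoc,
      mul_div_assoc 2] at h0
    linarith
  by_cases hb : cubeBdry m t = 0
  · right
    have hb' : cubeBdry m t' = 0 := by
      rw [hb] at e0
      have : cubeBdry m t' ^ 2 / cubeDen m t' = 0 := by rw [← e0]; simp
      rcases div_eq_zero_iff.1 this with h | h
      · exact pow_eq_zero_iff (two_ne_zero) |>.1 h
      · exact absurd h hD'.ne'
    exact ⟨(cubeBdry_eq_zero_iff m t).1 hb, (cubeBdry_eq_zero_iff m t').1 hb'⟩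
  · left
    have hb' : cubeBdry m t' ≠ 0 := by
      intro hb'
      rw [hb'] at e0
      have : cubeBdry m t ^ 2 / cubeDen m t = 0 := by rw [e0]; simp
      rcases div_eq_zero_iff.1 this with h | h
      · exact hb (pow_eq_zero_iff (two_ne_zero) |>.1 h)
      · exact absurd h hD.ne'
    have p := (cubeBdry_nonneg m t).lt_of_ne' hb
    have p' := (cubeBdry_nonneg m t').lt_of_ne' hb'
    have hr : ∀ i, cubeVec m t i * cubeBdry m t' = cubeVec m t' i * cubeBdry m t := by
      intro i
      have h1 := e1 i
      field_simp at e0 h1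
      have h3 : cubeVec m t i * cubeBdry m t' * (cubeBdry m t * cubeDen m t' * cubeBdry m t') =
          cubeVec m t' i * cubeBdry m t * (cubeBdry m t * cubeDen m t' * cubeBdry m t') := by
        linear_combination (cubeBdry m t' ^ 2) * h1 - cubeBdry m t' * cubeVec m t' i * e0
      exact mul_right_cancel₀ (by positivity) h3
    have hle : ∀ {t t' : I^(Fin m)}, 0 < cubeBdry m t → 0 < cubeBdry m t' →
        (∀ i, cubeVec m t i * cubeBdry m t' = cubeVec m t' i * cubeBdry m t) →
        cubeBdry m t ≤ cubeBdry m t' := by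
      intro t t' p p' hr
      by_contra hlt
      push Not at hlt
      have := cubeBdry_le_of_scale (l := cubeBdry m t / cubeBdry m t')
        ((one_le_div p').2 hlt.le) (t := t) (t' := t') fun i => by
          field_simp; linarith [hr i]
      linarith
    have heq : cubeBdry m t = cubeBdry m t' :=
      le_antisymm (hle p p' hr) (hle p' p fun i => (hr i).symm)
    ext i
    have := hr i
    rw [heq] at this
    have := mul_right_cancel₀ hb' this
    unfold cubeVec at this
    linarith

/-- Let `w` be the stereographic coordinate of `y`, a point other than the pole. A preimage has `u =
μ w` with `b = μ`, that is, `μ` solves the fixed point equation `μ = ∏ (1 - (μ wᵢ)²) / 4`, and the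
intermediate value theorem on `[0, 1]` gives a solution. -/
theorem collapse_surjective (k : ℕ) : Function.Surjective (collapse (k + 1)) := by
  intro y
  have hy : y.1 0 ^ 2 + ∑ i : Fin (k + 1), y.1 i.succ ^ 2 = 1 := by
    have h := y.2
    rw [mem_sphere_zero_iff_norm, EuclideanSpace.norm_eq, Real.sqrt_eq_one, Fin.sum_univ_succ] at h
    simpa only [Real.norm_eq_abs, sq_abs] using h
  have hs : 0 ≤ ∑ i : Fin (k + 1), y.1 i.succ ^ 2 := Finset.sum_nonneg fun i _ => sq_nonneg _
  by_cases h1 : y.1 0 = 1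
  · refine ⟨fun _ => 0, (collapse_of_mem_boundary _ _ (zero_mem_boundary k)).trans ?_⟩
    have hz : ∑ i : Fin (k + 1), y.1 i.succ ^ 2 = 0 := by rw [h1] at hy; linarith
    rw [Finset.sum_eq_zero_iff_of_nonneg fun i _ => sq_nonneg _] at hz
    refine Subtype.ext ?_
    ext i
    refine Fin.cases ?_ (fun i => ?_) i
    · simp [pole, h1]
    · have := hz i (Finset.mem_univ i)
      simp [pole, pow_eq_zero_iff two_ne_zero |>.1 this]
  have hy0 : y.1 0 < 1 := by
    refine lt_of_le_of_ne ?_ h1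
    nlinarith
  set w : Fin (k + 1) → ℝ := fun i => y.1 i.succ / (1 - y.1 0) with hw
  have hd : 0 < 1 - y.1 0 := by linarith
  have hwsum : (∑ i, w i ^ 2) * (1 - y.1 0) = 1 + y.1 0 := by
    simp only [hw, div_pow, ← Finset.sum_div]
    field_simp
    nlinarith
  -- The truncation by `max 0` gives `β 1 ≤ 1` for arbitrary `w`. At the solution `β μ = μ > 0`, so
  -- no factor is truncated and `μ w` lies in the open cube.
  set β : ℝ → ℝ := fun μ => ∏ i, (max 0 (1 - (μ * w i) ^ 2) / 4) with hβ
  have hβc : Continuous β := by fun_prop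
  have hβ1 : β 1 ≤ 1 := by
    refine Finset.prod_le_one (fun i _ => by positivity) fun i _ => ?_
    have : max 0 (1 - (1 * w i) ^ 2) ≤ 1 := max_le zero_le_one (by nlinarith [sq_nonneg (1 * w i)])
    linarith
  have hβ0 : 0 < β 0 := by
    refine Finset.prod_pos fun i _ => ?_
    norm_num
  obtain ⟨μ, hμ, hμe⟩ : ∃ μ ∈ Set.Icc (0 : ℝ) 1, μ - β μ = 0 := by
    have := intermediate_value_Icc (zero_le_one' ℝ)
      (f := fun μ => μ - β μ) (by fun_prop)
    exact this ⟨by linarith, by linarith⟩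
  have hμβ : β μ = μ := by linarith
  have hμ0 : 0 < μ := hμ.1.lt_of_ne fun h => by rw [← h] at hμβ; linarith
  have hfac : ∀ i, 0 < 1 - (μ * w i) ^ 2 := by
    intro i
    by_contra h
    have : β μ = 0 := Finset.prod_eq_zero (Finset.mem_univ i) (by simp [max_eq_left (not_lt.1 h)])
    linarith
  have habs : ∀ i, |μ * w i| < 1 := fun i => by
    rw [← sq_lt_one_iff_abs_lt_one]; linarith [hfac i]
  let t : I^(Fin (k + 1)) := fun i => ⟨(1 + μ * w i) / 2, by
    have := abs_lt.1 (habs i); constructor <;> linarith⟩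
  have hu : ∀ i, cubeVec (k + 1) t i = μ * w i := fun i => by simp only [cubeVec, t]; ring
  have hb : cubeBdry (k + 1) t = μ := by
    rw [cubeBdry_eq]
    refine Eq.trans (Finset.prod_congr rfl fun i _ => ?_) hμβ
    rw [hu, max_eq_right (hfac i).le]
  have hus : ∑ i, cubeVec (k + 1) t i ^ 2 = μ ^ 2 * ∑ i, w i ^ 2 := by
    simp only [hu, mul_pow, ← Finset.mul_sum]
  have hD : cubeDen (k + 1) t * (1 - y.1 0) = 2 * μ ^ 2 := by
    unfold cubeDen
    rw [hus, hb]
    linear_combination μ ^ 2 * hwsum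
  have hDp := cubeDen_pos (k + 1) t
  refine ⟨t, Subtype.ext ?_⟩
  ext i
  refine Fin.cases ?_ (fun i => ?_) i
  · rw [collapse_zero_coord, div_eq_iff hDp.ne', hus, hb]
    have h2 : (μ ^ 2 * ∑ i, w i ^ 2 - μ ^ 2) * (1 - y.1 0) =
        y.1 0 * cubeDen (k + 1) t * (1 - y.1 0) := by
      linear_combination μ ^ 2 * hwsum - y.1 0 * hD
    exact mul_right_cancel₀ hd.ne' h2
  · rw [collapse_succ_coord, div_eq_iff hDp.ne', hu, hb]
    have h3 : w i * (1 - y.1 0) = y.1 i.succ := by simp only [hw]; field_simp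
    have h2 : 2 * μ * (μ * w i) * (1 - y.1 0) =
        y.1 i.succ * cubeDen (k + 1) t * (1 - y.1 0) := by
      linear_combination 2 * μ ^ 2 * h3 - y.1 i.succ * hD
    exact mul_right_cancel₀ hd.ne' h2

variable {Y : Type*} [TopologicalSpace Y]

/-- Homotopies of maps of the cube which map the boundary to a point all the time come from
homotopies of maps of the sphere. -/
theorem exists_homotopy_of_cube {k : ℕ} (F : I × (I^(Fin (k + 1))) → Y) (hF : Continuous F)
    (hτ : ∃ τ : I → Y, ∀ s, ∀ t ∈ Cube.boundary (Fin (k + 1)), F (s, t) = τ s) :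
    ∃ F' : I × USphere (k + 2) → Y, Continuous F' ∧
      ∀ s t, F' (s, collapse (k + 1) t) = F (s, t) := by
  obtain ⟨τ, hτ⟩ := hτ
  let q : I × (I^(Fin (k + 1))) → I × USphere (k + 2) := Prod.map id (collapse (k + 1))
  have hqc : Continuous q := continuous_id.prodMap (collapse (k + 1)).continuous
  have hqs : Function.Surjective q := Function.surjective_id.prodMap (collapse_surjective k)
  have hq : Topology.IsQuotientMap q := hqc.isClosedMap.isQuotientMap hqc hqs
  have hfac : ∀ z z', q z = q z' → F z = F z' := by
    rintro ⟨s, t⟩ ⟨s', t'⟩ h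
    obtain ⟨h1, h2⟩ := Prod.mk.inj h
    simp only [id] at h1
    subst h1
    rcases (collapse_eq_iff _ t t').1 h2 with rfl | ⟨h, h'⟩
    · rfl
    · rw [hτ s t h, hτ s t' h']
  refine ⟨fun x => F (Function.surjInv hqs x), ?_, fun s t => ?_⟩
  · rw [hq.continuous_iff]
    refine hF.congr fun z => hfac _ _ ?_
    exact (Function.surjInv_eq hqs (q z)).symm
  · exact hfac _ _ (Function.surjInv_eq hqs (q (s, t)))

theorem exists_sphere_map {k : ℕ} (g : C(I^(Fin (k + 1)), Y)) {y : Y}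
    (hg : ∀ t ∈ Cube.boundary (Fin (k + 1)), g t = y) :
    ∃ f : C(USphere (k + 2), Y), ∀ t, f (collapse (k + 1) t) = g t := by
  obtain ⟨F, hF, h⟩ := exists_homotopy_of_cube (fun z : I × (I^(Fin (k + 1))) => g z.2)
    (by fun_prop) ⟨fun _ => y, fun s t ht => hg t ht⟩
  exact ⟨⟨fun x => F (0, x), by fun_prop⟩, fun t => h 0 t⟩

theorem homotopic_of_cube {k : ℕ} {f f' : C(USphere (k + 2), Y)}
    (F : I × (I^(Fin (k + 1))) → Y) (hF : Continuous F)
    (hτ : ∃ τ : I → Y, ∀ s, ∀ t ∈ Cube.boundary (Fin (k + 1)), F (s, t) = τ s)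
    (h0 : ∀ t, F (0, t) = f (collapse (k + 1) t)) (h1 : ∀ t, F (1, t) = f' (collapse (k + 1) t)) :
    ContinuousMap.Homotopic f f' := by
  obtain ⟨F', hF', h⟩ := exists_homotopy_of_cube F hF hτ
  refine homotopic_of_continuous F' hF' (fun x => ?_) fun x => ?_
  · obtain ⟨t, rfl⟩ := collapse_surjective k x; rw [h, h0]
  · obtain ⟨t, rfl⟩ := collapse_surjective k x; rw [h, h1]

theorem homotopic_of_cube_homotopicRel {k : ℕ} {f f' : C(USphere (k + 2), Y)}
    (h : ContinuousMap.HomotopicRel (f.comp (collapse (k + 1))) (f'.comp (collapse (k + 1)))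
      (Cube.boundary (Fin (k + 1)))) : ContinuousMap.Homotopic f f' := by
  obtain ⟨H, hH, h0, h1, hS⟩ := h.exists_continuous
  refine homotopic_of_cube H hH ⟨fun _ => f (pole (k + 1)), fun s t ht => ?_⟩ h0 h1
  rw [hS s t ht]
  exact congrArg f (collapse_of_mem_boundary _ t ht)

/-- A map of a sphere can be deformed so that the base point moves along a given path. -/
theorem exists_homotopic_pointed {k : ℕ} [PathConnectedSpace Y] (f : C(USphere (k + 2), Y))
    (y : Y) : ∃ f' : C(USphere (k + 2), Y), ContinuousMap.Homotopic f f' ∧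
      f' (pole (k + 1)) = y := by
  obtain ⟨γ⟩ := PathConnectedSpace.joined (f (pole (k + 1))) y
  have hp : Continuous (Set.projIcc (0 : ℝ) 1 zero_le_one) := continuous_projIcc
  have hht := continuous_cubeHeight (k + 1)
  have hex := continuous_cubeExpand (k + 1)
  have hfe : ∀ t, cubeHeight (k + 1) t ≤ 1 →
      f (collapse (k + 1) (cubeExpand (k + 1) (1, t))) = f (pole (k + 1)) := fun t ht => by
    rw [collapse_of_mem_boundary _ _ (cubeExpand_one_mem_boundary ht)]
  -- The expanded map is constant where the height is at most `1`. There it is replaced at time `s`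
  -- by the path `γ`, run from `γ s` on the boundary back to `γ 0` where the height is `1`.
  set M : I × (I^(Fin (k + 1))) → Y := fun z => if cubeHeight (k + 1) z.2 ≤ 1 then
      γ (z.1 * Set.projIcc 0 1 zero_le_one (1 - cubeHeight (k + 1) z.2))
    else f (collapse (k + 1) (cubeExpand (k + 1) (1, z.2))) with hM
  have hMc : Continuous M := by
    refine Continuous.if_le (by fun_prop) (by fun_prop) (by fun_prop) (by fun_prop) ?_
    rintro ⟨s, t⟩ ht
    rw [hfe t ht.le]
    simp only at ht
    simp [ht]
  have hMb : ∀ s, ∀ t ∈ Cube.boundary (Fin (k + 1)), M (s, t) = γ s := fun s t ht => by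
    simp [hM, cubeHeight_of_mem_boundary _ ht]
  obtain ⟨f', hf'⟩ := exists_sphere_map ⟨fun t => M (1, t), by fun_prop⟩ (y := γ 1)
    fun t ht => hMb 1 t ht
  obtain ⟨f'', hf''⟩ := exists_sphere_map ⟨fun t => M (0, t), by fun_prop⟩ (y := γ 0)
    fun t ht => hMb 0 t ht
  refine ⟨f', ContinuousMap.Homotopic.trans (g := f'') ?_ ?_, ?_⟩
  · refine homotopic_of_cube_homotopicRel ?_
    have := homotopicRel_expand (c := f.comp (collapse (k + 1))) (y := f (pole (k + 1)))
      fun t ht => congrArg f (collapse_of_mem_boundary _ t ht)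
    convert this using 1
    ext t
    simp only [ContinuousMap.comp_apply, hf'', ContinuousMap.coe_mk, hM]
    split_ifs with h
    · simp [hfe t h]
    · rfl
  · exact homotopic_of_cube M hMc ⟨γ, hMb⟩ (fun t => (hf'' t).symm) fun t => (hf' t).symm
  · rw [← collapse_of_mem_boundary _ _ (zero_mem_boundary k), hf']
    exact (hMb 1 _ (zero_mem_boundary k)).trans γ.target

end Collapse

/-! ### The boundary map of a fibration -/

section Boundary

variable {F E B X : Type*} [TopologicalSpace F] [TopologicalSpace E] [TopologicalSpace X] {k : ℕ}

theorem continuous_cubeCons :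
    Continuous fun z : I × (I^(Fin k)) => (Fin.cons z.1 z.2 : I^(Fin (k + 1))) := by
  refine continuous_pi fun i => ?_
  refine Fin.cases ?_ (fun i => ?_) i
  · simpa using continuous_fst
  · simp only [Fin.cons_succ]; fun_prop

theorem continuous_cubeTail : Continuous fun z : I^(Fin (k + 1)) => (Fin.tail z : I^(Fin k)) := by
  refine continuous_pi fun i => ?_
  unfold Fin.tail
  fun_prop

/-- The faces of the cube on which the lifts in the definition of the boundary map are constant. -/
def IsOpenBox (t : I^(Fin (k + 1))) : Prop := t 0 = 1 ∨ ∃ i : Fin k, t i.succ = 0 ∨ t i.succ = 1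

theorem IsOpenBox.mem_boundary {t : I^(Fin (k + 1))} (h : IsOpenBox t) :
    t ∈ Cube.boundary (Fin (k + 1)) := by
  rcases h with h | ⟨i, h⟩
  · exact ⟨0, Or.inr h⟩
  · exact ⟨i.succ, h⟩

theorem cons_mem_boundary_of_mem {s : I} {t : I^(Fin k)} (ht : t ∈ Cube.boundary (Fin k)) :
    IsOpenBox (Fin.cons s t : I^(Fin (k + 1))) := by
  obtain ⟨i, h⟩ := ht
  exact Or.inr ⟨i, by simpa using h⟩

theorem cons_one_isOpenBox (t : I^(Fin k)) : IsOpenBox (Fin.cons 1 t : I^(Fin (k + 1))) :=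
  Or.inl (by simp)

theorem cons_zero_mem_boundary (t : I^(Fin k)) :
    (Fin.cons 0 t : I^(Fin (k + 1))) ∈ Cube.boundary (Fin (k + 1)) :=
  ⟨0, Or.inl (by simp)⟩

theorem eq_zero_or_isOpenBox_of_mem_boundary {t : I^(Fin (k + 1))}
    (ht : t ∈ Cube.boundary (Fin (k + 1))) : t 0 = 0 ∨ IsOpenBox t := by
  obtain ⟨i, h⟩ := ht
  induction i using Fin.cases with
  | zero => exact h.imp id Or.inl
  | succ i => exact Or.inr (Or.inr ⟨i, h⟩)

/-- The fibre of `p` over `b` is identified with `F` through `ι`. -/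
structure IsFibreIncl (p : E → B) (ι : F → E) (b : B) : Prop where
  isEmbedding : Topology.IsEmbedding ι
  proj : ∀ x, p (ι x) = b
  exists_eq : ∀ e, p e = b → ∃ x, ι x = e

variable {p : E → B} {ι : F → E} {b₀ : B}

theorem IsFibreIncl.exists_lift (hι : IsFibreIncl p ι b₀) {e : X → E} (he : Continuous e)
    (hp : ∀ x, p (e x) = b₀) : ∃ c : X → F, Continuous c ∧ ∀ x, ι (c x) = e x := by
  choose c hc using fun x => hι.exists_eq (e x) (hp x)
  refine ⟨c, ?_, hc⟩
  rw [hι.isEmbedding.isInducing.continuous_iff]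
  exact he.congr fun x => (hc x).symm

variable [TopologicalSpace B]

/-- Families of maps of the cube which map the boundary to the base point lift to families which
are constant on all faces but one. -/
theorem LocTransport.exists_box_lift [CompactSpace X] [T2Space X] (hp : LocTransport p)
    (hι : IsFibreIncl p ι b₀) (f₀ : F) {g : X × (I^(Fin (k + 1))) → B} (hg : Continuous g)
    (hgb : ∀ x, ∀ t ∈ Cube.boundary (Fin (k + 1)), g (x, t) = b₀) :
    ∃ (G : X × (I^(Fin (k + 1))) → E) (c : X × (I^(Fin k)) → F), Continuous G ∧ Continuous c ∧
      (∀ z, p (G z) = g z) ∧ (∀ x t, IsOpenBox t → G (x, t) = ι f₀) ∧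
      (∀ x s, G (x, Fin.cons 0 s) = ι (c (x, s))) ∧
      ∀ x, ∀ s ∈ Cube.boundary (Fin k), c (x, s) = f₀ := by
  have hcons := continuous_cubeCons (k := k)
  have htail := continuous_cubeTail (k := k)
  -- The homotopy sweeps the cube down from its top face, where `g` is constant and has the lift `ι
  -- f₀`. On the open box it is stationary, so regularity keeps the lift equal to `ι f₀` there.
  obtain ⟨G, hG, hpG, hreg⟩ := hp.exists_lift (Z := X × (I^(Fin (k + 1))))
    (H := fun z => g (z.1.1, Fin.cons (max (z.1.2 0) (unitInterval.symm z.2)) (Fin.tail z.1.2)))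
    (by
      refine hg.comp (Continuous.prodMk (by fun_prop) ?_)
      exact hcons.comp (Continuous.prodMk (by fun_prop) (by fun_prop)))
    (e := fun _ => ι f₀) continuous_const (fun z => by
      rw [hι.proj, hgb]
      have : max (z.2 0) (unitInterval.symm 0) = 1 := by
        rw [unitInterval.symm_zero]; exact max_eq_right (z.2 0).2.2
      rw [this]
      exact (cons_one_isOpenBox _).mem_boundary)
  have hbox : ∀ x t, IsOpenBox t → G (x, t) = ι f₀ := by
    intro x t ht
    refine hreg (x, t) fun s => ?_
    have h1 : ∀ r : I, IsOpenBox (Fin.cons (max (t 0) r) (Fin.tail t) : I^(Fin (k + 1))) := by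
      intro r
      rcases ht with h | ⟨i, h⟩
      · left
        rw [Fin.cons_zero, h]
        exact max_eq_left r.2.2
      · exact Or.inr ⟨i, by simpa [Fin.tail] using h⟩
    dsimp only
    rw [hgb _ _ (h1 _).mem_boundary, hgb _ _ (h1 _).mem_boundary]
  have hpG' : ∀ z, p (G z) = g z := by
    rintro ⟨x, t⟩
    rw [hpG]
    have : max (t 0) (unitInterval.symm 1) = t 0 := by
      rw [unitInterval.symm_one]; exact max_eq_left (t 0).2.1
    dsimp only
    rw [this, Fin.cons_self_tail]
  obtain ⟨c, hc, hιc⟩ := hι.exists_lift (e := fun z : X × (I^(Fin k)) => G (z.1, Fin.cons 0 z.2))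
    (hG.comp (Continuous.prodMk (by fun_prop)
      (hcons.comp (Continuous.prodMk continuous_const (by fun_prop)))))
    (fun z => by rw [hpG', hgb _ _ (cons_zero_mem_boundary _)])
  refine ⟨G, c, hG, hc, hpG', hbox, fun x s => (hιc (x, s)).symm, fun x s hs => ?_⟩
  refine hι.isEmbedding.injective ?_
  rw [hιc]
  exact hbox _ _ (cons_mem_boundary_of_mem hs)

/-- Comparison of the bottom faces of two lifts of the same map. -/
theorem LocTransport.exists_bottom_homotopy (hp : LocTransport p) (hι : IsFibreIncl p ι b₀)
    {g : (I^(Fin (k + 1))) → B} (hg : Continuous g)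
    (hgb : ∀ t ∈ Cube.boundary (Fin (k + 1)), g t = b₀)
    {G G' : (I^(Fin (k + 1))) → E} (hG : Continuous G) (hG' : Continuous G')
    (hpG : ∀ t, p (G t) = g t) (hpG' : ∀ t, p (G' t) = g t) {f₀ f₁ : F} (γ : Path f₀ f₁)
    (hGb : ∀ t, IsOpenBox t → G t = ι f₀) (hGb' : ∀ t, IsOpenBox t → G' t = ι f₁)
    {c c' : (I^(Fin k)) → F} (hc : ∀ s, G (Fin.cons 0 s) = ι (c s))
    (hc' : ∀ s, G' (Fin.cons 0 s) = ι (c' s)) :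
    ∃ L : I × (I^(Fin k)) → F, Continuous L ∧ (∀ s, L (0, s) = c s) ∧ (∀ s, L (1, s) = c' s) ∧
      ∀ q, ∀ s ∈ Cube.boundary (Fin k),
        L (q, s) = γ (Set.projIcc 0 1 zero_le_one (3 * (q : ℝ) - 1)) := by
  have hcons := continuous_cubeCons (k := k)
  have hproj : Continuous (Set.projIcc (0 : ℝ) 1 zero_le_one) := continuous_projIcc
  set π : ℝ → I := Set.projIcc (0 : ℝ) 1 zero_le_one with hπ
  have hπ0 : ∀ r ≤ 0, π r = 0 := fun r hr => Set.projIcc_of_le_left _ hr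
  have hπ1 : ∀ r, 1 ≤ r → π r = 1 := fun r hr => Set.projIcc_of_right_le _ hr
  have hιc : Continuous ι := hι.isEmbedding.continuous
  -- Go up the cube along `G`, cross at the top along `γ` inside the fibre, and come down along
  -- `G'`. This family lies over `g` with first coordinate the tent function `a`. Flattening the
  -- tent to `0` moves the family into the fibre; the movement is trivial at both ends and over the
  -- boundary of the cube.
  set e₀ : I × (I^(Fin k)) → E := fun z => if (z.1 : ℝ) ≤ 1 / 3 then
      G (Fin.cons (π (3 * (z.1 : ℝ))) z.2)
    else if (z.1 : ℝ) ≤ 2 / 3 then ι (γ (π (3 * (z.1 : ℝ) - 1)))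
    else G' (Fin.cons (π (3 - 3 * (z.1 : ℝ))) z.2) with he₀
  have he₀c : Continuous e₀ := by
    refine Continuous.if_le (hG.comp (hcons.comp (Continuous.prodMk (by fun_prop) (by fun_prop))))
      (Continuous.if_le (by fun_prop)
        (hG'.comp (hcons.comp (Continuous.prodMk (by fun_prop) (by fun_prop))))
        (by fun_prop) (by fun_prop) ?_) (by fun_prop) (by fun_prop) ?_
    · rintro ⟨q, s⟩ h
      simp only at h
      simp only [h]
      rw [hπ1 _ (by norm_num), hπ1 _ (by norm_num), hGb' _ (cons_one_isOpenBox s), γ.target]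
    · rintro ⟨q, s⟩ h
      simp only at h
      simp only [h]
      rw [if_pos (by norm_num), hπ1 _ (by norm_num), hGb _ (cons_one_isOpenBox s),
        hπ0 _ (by norm_num), γ.source]
  set a : I → I := fun q => π (min (3 * (q : ℝ)) (3 - 3 * (q : ℝ))) with ha
  have hpe : ∀ q s, p (e₀ (q, s)) = g (Fin.cons (a q) s) := by
    intro q s
    simp only [he₀, ha]
    split_ifs with h1 h2
    · rw [hpG, min_eq_left (by linarith)]
    · rw [hι.proj, hπ1 (min _ _) (le_min (by linarith) (by linarith)),
        hgb _ (cons_one_isOpenBox s).mem_boundary]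
    · rw [hpG', min_eq_right (by linarith)]
  obtain ⟨e, he, hpe', hreg⟩ := hp.exists_lift (Z := I × (I^(Fin k)))
    (H := fun z => g (Fin.cons (min (a z.1.1) (unitInterval.symm z.2)) z.1.2))
    (hg.comp (hcons.comp (Continuous.prodMk (by fun_prop) (by fun_prop))))
    he₀c (by
      rintro ⟨q, s⟩
      rw [hpe]
      have : min (a q) (unitInterval.symm 0) = a q := by
        rw [unitInterval.symm_zero]; exact min_eq_left (a q).2.2
      simp only [this])
  obtain ⟨L, hL, hιL⟩ := hι.exists_lift he (fun z => by
    rw [hpe']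
    have : min (a z.1) (unitInterval.symm 1) = 0 := by
      rw [unitInterval.symm_one]; exact min_eq_right (a z.1).2.1
    simp only [this]
    exact hgb _ (cons_zero_mem_boundary _))
  have ha0 : ∀ q, a q = 0 → ∀ s, e (q, s) = e₀ (q, s) := by
    intro q hq s
    refine hreg (q, s) fun r => ?_
    simp only [hq]
    have h0 : ∀ r : I, min 0 r = 0 := fun r => min_eq_left r.2.1
    rw [h0, h0]
  refine ⟨L, hL, fun s => hι.isEmbedding.injective ?_, fun s => hι.isEmbedding.injective ?_,
    fun q s hs => hι.isEmbedding.injective ?_⟩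
  · rw [hιL, ha0 0 (by simp only [ha]; exact hπ0 _ (by simp)) s, ← hc]
    simp [he₀, hπ0]
  · rw [hιL, ha0 1 (by simp only [ha]; exact hπ0 _ (by simp)) s, ← hc']
    simp only [he₀, Set.Icc.coe_one]
    rw [if_neg (by norm_num), if_neg (by norm_num), hπ0 _ (by norm_num)]
  · rw [hιL, hreg (q, s) fun r => by
      dsimp only
      rw [hgb _ (cons_mem_boundary_of_mem hs).mem_boundary,
        hgb _ (cons_mem_boundary_of_mem hs).mem_boundary]]
    simp only [he₀]
    split_ifs with h1 h2
    · rw [hGb _ (cons_mem_boundary_of_mem hs), hπ0 _ (by linarith), γ.source]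
    · rfl
    · rw [hGb' _ (cons_mem_boundary_of_mem hs), hπ1 (3 * (q : ℝ) - 1) (by linarith), γ.target]

theorem LocTransport.exists_boundaryRel (hp : LocTransport p) (hι : IsFibreIncl p ι b₀) (f₀ : F)
    (g : Ω^ (Fin (k + 1)) B b₀) : ∃ (G : C(I^(Fin (k + 1)), E)) (c : Ω^ (Fin k) F f₀),
      (∀ t, p (G t) = g t) ∧ (∀ t, IsOpenBox t → G t = ι f₀) ∧
      ∀ s, G (Fin.cons 0 s) = ι (c s) := by
  obtain ⟨G, c, hG, hc, h1, h2, h3, h4⟩ := hp.exists_box_lift (X := Unit) hι f₀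
    (g := fun z => g z.2) (g.1.continuous.comp continuous_snd) fun _ t ht => g.2 t ht
  exact ⟨⟨fun t => G ((), t), by fun_prop⟩,
    ⟨⟨fun t => c ((), t), by fun_prop⟩, fun s hs => h4 _ s hs⟩,
    fun t => h1 _, fun t ht => h2 _ t ht, fun s => h3 _ s⟩

theorem LocTransport.homotopic_of_lifts (hp : LocTransport p) (hι : IsFibreIncl p ι b₀) {f₀ : F}
    {g : (I^(Fin (k + 1))) → B} (hg : Continuous g)
    (hgb : ∀ t ∈ Cube.boundary (Fin (k + 1)), g t = b₀)
    {G G' : (I^(Fin (k + 1))) → E} (hG : Continuous G) (hG' : Continuous G')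
    (hpG : ∀ t, p (G t) = g t) (hpG' : ∀ t, p (G' t) = g t)
    (hGb : ∀ t, IsOpenBox t → G t = ι f₀) (hGb' : ∀ t, IsOpenBox t → G' t = ι f₀)
    {c c' : Ω^ (Fin k) F f₀} (hc : ∀ s, G (Fin.cons 0 s) = ι (c s))
    (hc' : ∀ s, G' (Fin.cons 0 s) = ι (c' s)) : GenLoop.Homotopic c c' := by
  obtain ⟨L, hL, h0, h1, hb⟩ := hp.exists_bottom_homotopy hι hg hgb hG hG' hpG hpG' (Path.refl f₀)
    hGb hGb' hc hc'
  exact homotopicRel_of_continuous L hL h0 h1 fun q s hs =>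
    ((hb q s hs).trans rfl).trans (c.2 s hs).symm

/-- A homotopy between two representatives is itself lifted as a family over `I`; the bottom faces
of this family form a homotopy. Its ends are compared with the given lifts by
`LocTransport.homotopic_of_lifts`. -/
theorem LocTransport.boundaryRel_unique (hp : LocTransport p) (hι : IsFibreIncl p ι b₀) {f₀ : F}
    {α : π_ (k + 1) B b₀} {β β' : π_ k F f₀} (h : BoundaryRel ι p k f₀ b₀ α β)
    (h' : BoundaryRel ι p k f₀ b₀ α β') : β = β' := by
  obtain ⟨g, c, G, rfl, rfl, hpG, hGb, hGc⟩ := h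
  obtain ⟨g', c', G', hα, rfl, hpG', hGb', hGc'⟩ := h'
  obtain ⟨H, hH, h0, h1, hS⟩ := ContinuousMap.HomotopicRel.exists_continuous (mk_eq_mk_iff.1 hα)
  obtain ⟨K, d, hK, hd, hpK, hKb, hKd, hdb⟩ := hp.exists_box_lift (X := I) hι f₀ hH
    fun x t ht => (hS x t ht).trans (g'.2 t ht)
  have hcd : ∀ x : I, ∃ d' : Ω^ (Fin k) F f₀, ∀ s, d' s = d (x, s) := fun x =>
    ⟨⟨⟨fun s => d (x, s), by fun_prop⟩, fun s hs => hdb x s hs⟩, fun s => rfl⟩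
  obtain ⟨d0, hd0⟩ := hcd 0
  obtain ⟨d1, hd1⟩ := hcd 1
  refine mk_eq_mk_iff.2 ?_
  have e1 : GenLoop.Homotopic c' d0 := hp.homotopic_of_lifts hι g'.1.continuous g'.2
    G'.continuous (G' := fun t => K (0, t)) (by fun_prop) hpG' (fun t => (hpK _).trans (h0 t))
    hGb' (fun t ht => hKb _ t ht) hGc' fun s => (hKd 0 s).trans (by rw [hd0])
  have e2 : GenLoop.Homotopic d0 d1 := homotopicRel_of_continuous d hd (fun s => (hd0 s).symm)
    (fun s => (hd1 s).symm) fun x s hs => (hdb x s hs).trans (d0.2 s hs).symm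
  have e3 : GenLoop.Homotopic c d1 := hp.homotopic_of_lifts hι g.1.continuous g.2
    G.continuous (G' := fun t => K (1, t)) (by fun_prop) hpG (fun t => (hpK _).trans (h1 t))
    hGb (fun t ht => hKb _ t ht) hGc fun s => (hKd 1 s).trans (by rw [hd1])
  exact e3.trans (e2.symm.trans e1.symm)

theorem LocTransport.existsUnique_boundaryRel (hp : LocTransport p) (hι : IsFibreIncl p ι b₀)
    (f₀ : F) (α : π_ (k + 1) B b₀) : ∃! β : π_ k F f₀, BoundaryRel ι p k f₀ b₀ α β := by
  induction α using Quotient.inductionOn with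
  | h g =>
    obtain ⟨G, c, h1, h2, h3⟩ := hp.exists_boundaryRel hι f₀ g
    exact ⟨Quotient.mk _ c, ⟨g, c, G, rfl, rfl, h1, h2, h3⟩,
      fun β' h' => hp.boundaryRel_unique hι h' ⟨g, c, G, rfl, rfl, h1, h2, h3⟩⟩

/-- If a map of the cube has a lift which is constant on the boundary, then the bottom face of any
other lift (which is constant on the other faces) is null-homotopic. -/
theorem LocTransport.nullIn_bottom (hp : LocTransport p) (hι : IsFibreIncl p ι b₀)
    {g : (I^(Fin (k + 1))) → B} (hg : Continuous g)
    (hgb : ∀ t ∈ Cube.boundary (Fin (k + 1)), g t = b₀)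
    {G G' : (I^(Fin (k + 1))) → E} (hG : Continuous G) (hG' : Continuous G')
    (hpG : ∀ t, p (G t) = g t) (hpG' : ∀ t, p (G' t) = g t) {f₀ f₁ : F} (γ : Joined f₀ f₁)
    (hGb : ∀ t, IsOpenBox t → G t = ι f₀)
    (hGb' : ∀ t ∈ Cube.boundary (Fin (k + 1)), G' t = ι f₁)
    {c : (I^(Fin k)) → F} (hc : ∀ s, G (Fin.cons 0 s) = ι (c s)) : NullIn Set.univ c := by
  obtain ⟨γ⟩ := γ
  obtain ⟨L, hL, h0, h1, hb⟩ := hp.exists_bottom_homotopy hι hg hgb hG hG' hpG hpG' γ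
    hGb (fun t ht => hGb' t ht.mem_boundary) hc (c' := fun _ => f₁)
    fun s => hGb' _ (cons_zero_mem_boundary s)
  exact ⟨L, hL, h0, fun _ => trivial, ⟨_, hb⟩, f₁, h1⟩

/-- If the bottom face of a lift is null-homotopic, then, up to homotopy, there is a lift which is
constant on the boundary. -/
theorem exists_lift_const_boundary (hp : Continuous p) (hι : Continuous ι)
    (hpι : ∀ x, p (ι x) = b₀) {f₀ : F} {g : Ω^ (Fin (k + 1)) B b₀} {G : C(I^(Fin (k + 1)), E)}
    (hpG : ∀ t, p (G t) = g t) (hGb : ∀ t, IsOpenBox t → G t = ι f₀)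
    {c : Ω^ (Fin k) F f₀} (hGc : ∀ s, G (Fin.cons 0 s) = ι (c s))
    (hnull : GenLoop.Homotopic c GenLoop.const) :
    ∃ G' : C(I^(Fin (k + 1)), E), (∀ t ∈ Cube.boundary (Fin (k + 1)), G' t = ι f₀) ∧
      ContinuousMap.HomotopicRel g.1 ⟨fun t => p (G' t), by fun_prop⟩
        (Cube.boundary (Fin (k + 1))) := by
  have hcons := continuous_cubeCons (k := k)
  have htail := continuous_cubeTail (k := k)
  have hproj : Continuous (Set.projIcc (0 : ℝ) 1 zero_le_one) := continuous_projIcc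
  obtain ⟨N, hN, hN0, hN1, hNb⟩ := ContinuousMap.HomotopicRel.exists_continuous hnull
  replace hNb : ∀ s, ∀ x ∈ Cube.boundary (Fin k), N (s, x) = f₀ := fun s x hx =>
    (hNb s x hx).trans (c.2 x hx)
  set π : ℝ → I := Set.projIcc (0 : ℝ) 1 zero_le_one with hπ
  have hπ0 : ∀ r ≤ 0, π r = 0 := fun r hr => Set.projIcc_of_le_left _ hr
  have hπ1 : ∀ r, 1 ≤ r → π r = 1 := fun r hr => Set.projIcc_of_right_le _ hr
  -- The lower half of the cube runs backwards through the null-homotopy of `c` inside the fibre,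
  -- and `G` is squeezed into the upper half. The projection is therefore `g` stretched in the first
  -- coordinate, and undoing the stretch is the required homotopy.
  set G' : (I^(Fin (k + 1))) → E := fun t => if (t 0 : ℝ) ≤ 1 / 2 then
      ι (N (π (1 - 2 * (t 0 : ℝ)), Fin.tail t))
    else G (Fin.cons (π (2 * (t 0 : ℝ) - 1)) (Fin.tail t)) with hG'
  have hG'c : Continuous G' := by
    refine Continuous.if_le (hι.comp (hN.comp (Continuous.prodMk (by fun_prop) (by fun_prop))))
      (G.continuous.comp (hcons.comp (Continuous.prodMk (by fun_prop) (by fun_prop))))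
      (by fun_prop) (by fun_prop) ?_
    intro t h
    simp only [h]
    rw [hπ0 _ (by norm_num), hπ0 _ (by norm_num), hGc, hN0]
    rfl
  have hbox : ∀ (r : I) (t : I^(Fin (k + 1))) (s : I), IsOpenBox t → (t 0 = 1 → s = 1) →
      IsOpenBox (Fin.cons s (Fin.tail t) : I^(Fin (k + 1))) := by
    intro r t s ht hs
    rcases ht with h | ⟨i, h⟩
    · exact Or.inl (by simpa using hs h)
    · exact Or.inr ⟨i, by simpa [Fin.tail] using h⟩
  have htb : ∀ t : I^(Fin (k + 1)), IsOpenBox t → t 0 ≠ 1 →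
      Fin.tail t ∈ Cube.boundary (Fin k) := by
    intro t ht h1
    rcases ht with h | ⟨i, h⟩
    · exact absurd h h1
    · exact ⟨i, h⟩
  refine ⟨⟨G', hG'c⟩, fun t ht => ?_, homotopicRel_of_continuous
    (fun z => g (Fin.cons (π ((1 + (z.1 : ℝ)) * (z.2 0 : ℝ) - z.1)) (Fin.tail z.2)))
    (g.1.continuous.comp (hcons.comp (Continuous.prodMk (by fun_prop) (by fun_prop)))) ?_ ?_ ?_⟩
  · simp only [ContinuousMap.coe_mk, hG']
    rcases eq_zero_or_isOpenBox_of_mem_boundary ht with h0 | hb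
    · rw [if_pos (by simp [h0]), hπ1 _ (by simp [h0]), hN1]
      rfl
    · split_ifs with h
      · rw [hNb _ _ (htb t hb fun h1 => by rw [h1] at h; norm_num at h)]
      · exact hGb _ (hbox 0 t _ hb fun h1 => hπ1 _ (by rw [h1]; norm_num))
  · intro t
    have : π ((1 + ((0 : I) : ℝ)) * (t 0 : ℝ) - ((0 : I) : ℝ)) = t 0 := by simp [hπ]
    simp only [this, Fin.cons_self_tail]
    rfl
  · intro t
    simp only [ContinuousMap.coe_mk, hG']
    split_ifs with h
    · rw [hpι, hπ0 _ (by simp; linarith)]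
      exact g.2 _ (cons_zero_mem_boundary _)
    · rw [hpG]
      norm_num
  · intro s t ht
    have h1 : (Fin.cons (π ((1 + (s : ℝ)) * (t 0 : ℝ) - s)) (Fin.tail t) : I^(Fin (k + 1))) ∈
        Cube.boundary (Fin (k + 1)) := by
      rcases eq_zero_or_isOpenBox_of_mem_boundary ht with h0 | hb
      · rw [hπ0 _ (by rw [h0]; simpa using s.2.1)]
        exact cons_zero_mem_boundary _
      · exact (hbox 0 t _ hb fun h1 => hπ1 _ (by rw [h1]; simp)).mem_boundary
    exact (g.2 _ h1).trans (g.2 _ ht).symm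

end Boundary

open Bundle in
theorem continuous_inner_self {n : ℕ} {N : Type*} [TopologicalSpace N]
    [ChartedSpace (EuclideanSpace ℝ (Fin n)) N] [IsManifold (𝓡 n) ∞ N] (g : RMetric n N) :
    Continuous fun v : TangentBundle (𝓡 n) N => g.inner v.proj v.snd v.snd := by
  let : RiemannianBundle (fun x : N => TangentSpace (𝓡 n) x) :=
    ⟨g.toContinuousRiemannianMetric.toRiemannianMetric⟩
  have h := Continuous.inner_bundle (F := EuclideanSpace ℝ (Fin n))
    (E := (fun x : N => TangentSpace (𝓡 n) x)) (M := TangentBundle (𝓡 n) N)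
    (b := fun v => v.proj) (v := fun v => v.snd) (w := fun v => v.snd) continuous_id continuous_id
  exact h

/-! ### Pushing a point within a Euclidean neighbourhood -/

section Push

variable {V N : Type*} [NormedAddCommGroup V] [NormedSpace ℝ V] [TopologicalSpace N]

/-- A cut-off function: `1` on the unit ball, and `0` outside the ball of radius `2`. -/
def cutoff (u : V) : ℝ := max 0 (min 1 (2 - ‖u‖))

theorem continuous_cutoff : Continuous (cutoff : V → ℝ) := by
  unfold cutoff; fun_prop

theorem cutoff_of_le {u : V} (h : ‖u‖ ≤ 1) : cutoff u = 1 := by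
  unfold cutoff
  rw [min_eq_left (by linarith), max_eq_right zero_le_one]

theorem cutoff_of_ge {u : V} (h : 2 ≤ ‖u‖) : cutoff u = 0 := by
  unfold cutoff
  exact max_eq_left ((min_le_right _ _).trans (by linarith))

theorem abs_cutoff_sub_le (u v : V) : |cutoff u - cutoff v| ≤ ‖u - v‖ := by
  unfold cutoff
  refine (abs_max_sub_max_le_max 0 _ 0 _).trans (max_le (by simp) ?_)
  refine (abs_min_sub_min_le_max 1 _ 1 _).trans (max_le (by simp) ?_)
  have : 2 - ‖u‖ - (2 - ‖v‖) = ‖v‖ - ‖u‖ := by ring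
  rw [this, norm_sub_rev]
  exact abs_norm_sub_norm_le v u

/-- Push the point `e a` to `e a'` within the image of `e`. -/
def push (e : V → N) (z : N × V × V) : N :=
  Function.extend e (fun u => e (u + cutoff u • (z.2.2 - z.2.1))) id z.1

variable {e : V → N}

theorem push_apply (he : Function.Injective e) (u a a' : V) :
    push e (e u, a, a') = e (u + cutoff u • (a' - a)) :=
  he.extend_apply _ _ _

theorem push_of_notMem {y : N} (hy : y ∉ Set.range e) (a a' : V) : push e (y, a, a') = y :=
  Function.extend_apply' _ _ _ hy

theorem push_of_notMem_ball (he : Function.Injective e) {y : N}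
    (hy : y ∉ e '' Metric.closedBall 0 2) (a a' : V) : push e (y, a, a') = y := by
  by_cases h : y ∈ Set.range e
  · obtain ⟨u, rfl⟩ := h
    have : 2 ≤ ‖u‖ := by
      by_contra h
      exact hy ⟨u, by simpa using (not_le.1 h).le, rfl⟩
    rw [push_apply he, cutoff_of_ge this, zero_smul, add_zero]
  · exact push_of_notMem h a a'

theorem push_self (he : Function.Injective e) (y : N) (a : V) : push e (y, a, a) = y := by
  by_cases h : y ∈ Set.range e
  · obtain ⟨u, rfl⟩ := h
    rw [push_apply he, sub_self, smul_zero, add_zero]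
  · exact push_of_notMem h a a

theorem push_center (he : Function.Injective e) {a : V} (ha : ‖a‖ ≤ 1) (a' : V) :
    push e (e a, a, a') = e a' := by
  rw [push_apply he, cutoff_of_le ha]
  congr 1
  simp

/-- The displacement `u ↦ cutoff u • (a' - a)` is Lipschitz with constant `‖a' - a‖ < 1`, so `u` and
`a` can have the same image only if they coincide. -/
theorem push_eq_iff (he : Function.Injective e) {a a' : V} (ha : ‖a‖ ≤ 1) (haa' : ‖a' - a‖ < 1)
    (y : N) : push e (y, a, a') = e a' ↔ y = e a := by
  constructor
  · intro h
    by_cases hy : y ∈ Set.range e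
    · obtain ⟨u, rfl⟩ := hy
      rw [push_apply he] at h
      have h1 : u + cutoff u • (a' - a) = a' := he h
      have h2 : u - a = (cutoff a - cutoff u) • (a' - a) := by
        rw [sub_smul, cutoff_of_le ha, one_smul]
        generalize cutoff u • (a' - a) = w at h1
        rw [← h1]
        abel
      have h3 : ‖u - a‖ ≤ ‖u - a‖ * ‖a' - a‖ := by
        nth_rewrite 1 [h2]
        rw [norm_smul, Real.norm_eq_abs]
        refine mul_le_mul_of_nonneg_right ?_ (norm_nonneg _)
        rw [norm_sub_rev]
        exact abs_cutoff_sub_le a u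
      have h4 : ‖u - a‖ = 0 := by nlinarith [norm_nonneg (u - a)]
      rw [sub_eq_zero.1 (norm_eq_zero.1 h4)]
    · rw [push_of_notMem hy] at h
      exact absurd ⟨a', h.symm⟩ hy
  · rintro rfl
    exact push_center he ha a'

/-- The image of the ball of radius `2` is compact, hence closed in `N`, and outside it nothing is
pushed. This gives continuity at points that do not lie in the image of `e`. -/
theorem continuous_push [FiniteDimensional ℝ V] [T2Space N] (he : Topology.IsOpenEmbedding e) :
    Continuous (push e) := by
  rw [continuous_iff_continuousAt]
  rintro ⟨y, a, a'⟩
  by_cases hy : y ∈ Set.range e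
  · obtain ⟨u, rfl⟩ := hy
    have h1 : Topology.IsOpenEmbedding (Prod.map e (id : V × V → V × V)) :=
      he.prodMap .id
    refine (h1.continuousAt_iff (g := push e) (x := (u, a, a'))).1 ?_
    have h2 : push e ∘ Prod.map e id =
        fun z : V × V × V => e (z.1 + cutoff z.1 • (z.2.2 - z.2.1)) :=
      funext fun z => push_apply he.injective _ _ _
    rw [h2]
    have := continuous_cutoff (V := V)
    have := he.continuous
    exact Continuous.continuousAt (by fun_prop)
  · have : ProperSpace V := FiniteDimensional.proper_real V
    have hc : IsClosed (e '' Metric.closedBall 0 2) :=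
      ((isCompact_closedBall _ _).image he.continuous).isClosed
    refine continuousAt_fst.congr ?_
    have : (e '' Metric.closedBall 0 2)ᶜ ∈ 𝓝 y :=
      hc.isOpen_compl.mem_nhds fun h => hy (Set.image_subset_range _ _ h)
    filter_upwards [continuousAt_fst.preimage_mem_nhds this] with z hz
    exact (push_of_notMem_ball he.injective hz _ _).symm

/-- The space `N` is locally homeomorphic to the vector space `V`. -/
def LocEuclidean (V N : Type*) [NormedAddCommGroup V] [NormedSpace ℝ V] [TopologicalSpace N] :
    Prop :=
  ∀ x : N, ∃ e : V → N, Topology.IsOpenEmbedding e ∧ e 0 = x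

theorem locEuclidean_of_chartedSpace (V N : Type*) [NormedAddCommGroup V] [NormedSpace ℝ V]
    [TopologicalSpace N] [ChartedSpace V N] : LocEuclidean V N := by
  intro x
  obtain ⟨r, hr, hb⟩ := Metric.isOpen_iff.1 (chartAt V x).open_target (chartAt V x x)
    (mem_chart_target V x)
  set E := (OpenPartialHomeomorph.univBall (chartAt V x x) r).trans (chartAt V x).symm with hE
  refine ⟨E, E.isOpenEmbedding ?_, ?_⟩
  · rw [hE, OpenPartialHomeomorph.trans_source, OpenPartialHomeomorph.univBall_source,
      Set.univ_inter, Set.eq_univ_iff_forall]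
    intro u
    refine hb ?_
    rw [← OpenPartialHomeomorph.univBall_target _ hr]
    exact (OpenPartialHomeomorph.univBall (chartAt V x x) r).map_source
      (by rw [OpenPartialHomeomorph.univBall_source]; trivial)
  · rw [hE, OpenPartialHomeomorph.coe_trans, Function.comp_apply,
      OpenPartialHomeomorph.univBall_apply_zero]
    exact (chartAt V x).left_inv (mem_chart_source V x)

/-- Ordered pairs of distinct points. -/
abbrev DistinctPairs (N : Type*) : Type _ := {z : N × N // z.1 ≠ z.2}

/-- To move the first point `y` of a pair to `x'`, push it there inside a chart and carry the second
point along. By `push_eq_iff` only `y` is pushed to `x'`, so the points remain distinct; the radius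
`1/4` keeps the displacement below `1`. -/
theorem locTransport_distinctPairs [FiniteDimensional ℝ V] [T2Space N] (hN : LocEuclidean V N) :
    LocTransport (fun z : DistinctPairs N => z.1.1) := by
  classical
  intro x
  obtain ⟨e, he, rfl⟩ := hN x
  set h := he.toOpenPartialHomeomorph with hh
  have hsymm : ∀ u, h.symm (e u) = u := fun u => h.left_inv (by simp [hh])
  have hball : ∀ y ∈ e '' Metric.ball 0 (1 / 4), ∃ a, ‖a‖ < 1 / 4 ∧ y = e a ∧ h.symm y = a := by
    rintro _ ⟨a, ha, rfl⟩
    exact ⟨a, by simpa using ha, rfl, hsymm a⟩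
  have hne : ∀ z : DistinctPairs N × N, (z.1.1.1 ∈ e '' Metric.ball 0 (1 / 4) ∧
      z.2 ∈ e '' Metric.ball 0 (1 / 4)) →
      z.2 ≠ push e (z.1.1.2, h.symm z.1.1.1, h.symm z.2) := by
    rintro ⟨⟨⟨y, y'⟩, hyy⟩, x'⟩ ⟨h1, h2⟩ heq
    obtain ⟨a, ha, rfl, hsa⟩ := hball _ h1
    obtain ⟨a', ha', rfl, hsa'⟩ := hball _ h2
    simp only [hsymm] at heq
    refine hyy ((push_eq_iff he.injective (by linarith) ?_ _).1 heq.symm).symm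
    have := norm_sub_le a' a
    linarith
  refine ⟨e '' Metric.ball 0 (1 / 4),
    (he.isOpenMap _ Metric.isOpen_ball).mem_nhds ⟨0, by simp, rfl⟩,
    fun z => if hz : z.1.1.1 ∈ e '' Metric.ball 0 (1 / 4) ∧ z.2 ∈ e '' Metric.ball 0 (1 / 4) then
      ⟨(z.2, push e (z.1.1.2, h.symm z.1.1.1, h.symm z.2)), hne z hz⟩ else z.1, ?_, ?_, ?_⟩
  · refine (Topology.IsInducing.continuousOn_iff (g := Subtype.val) ⟨rfl⟩).2 ?_
    have hs : ContinuousOn h.symm (e '' Metric.ball 0 (1 / 4)) :=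
      h.symm.continuousOn.mono (by
        rintro _ ⟨a, -, rfl⟩
        simp [hh])
    have : ContinuousOn (fun z : DistinctPairs N × N =>
        (z.2, push e (z.1.1.2, h.symm z.1.1.1, h.symm z.2)))
        {z | z.1.1.1 ∈ e '' Metric.ball 0 (1 / 4) ∧ z.2 ∈ e '' Metric.ball 0 (1 / 4)} := by
      refine continuousOn_snd.prodMk ((continuous_push he).comp_continuousOn ?_)
      refine ContinuousOn.prodMk (by fun_prop) (ContinuousOn.prodMk ?_ ?_)
      · exact hs.comp (by fun_prop) fun z hz => hz.1
      · exact hs.comp (by fun_prop) fun z hz => hz.2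
    refine this.congr fun z hz => ?_
    simp only [Set.mem_ofPred_eq] at hz
    simp only [Function.comp_apply, dif_pos hz]
  · intro z b hz hb
    rw [dif_pos ⟨hz, hb⟩]
  · rintro ⟨⟨y, y'⟩, hyy⟩ hz
    rw [dif_pos ⟨hz, hz⟩]
    refine Subtype.ext (Prod.ext rfl ?_)
    exact push_self he.injective _ _

theorem isFibreIncl_distinctPairs (x₀ : N) :
    IsFibreIncl (fun z : DistinctPairs N => z.1.1)
      (fun y : {y : N // y ≠ x₀} => ⟨(x₀, y.1), y.2.symm⟩) x₀ := by
  refine ⟨⟨?_, ?_⟩, fun _ => rfl, ?_⟩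
  · have h : Topology.IsInducing (fun y : {y : N // y ≠ x₀} => (x₀, y.1)) :=
      (Topology.IsEmbedding.isInducing
        (isEmbedding_prodMkRight x₀)).comp Topology.IsInducing.subtypeVal
    exact Topology.IsInducing.of_comp (by fun_prop) continuous_subtype_val h
  · intro y y' h
    exact Subtype.ext (congrArg (fun z : DistinctPairs N => z.1.2) h)
  · rintro ⟨⟨y, y'⟩, hyy⟩ h
    simp only at h
    subst h
    exact ⟨⟨y', hyy.symm⟩, rfl⟩

/-- A punctured chart is connected in dimension at least two, so it lies on one side of any
separation of the complement. Adding the point to that side would then separate `N`. -/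
theorem isPreconnected_compl_singleton [T1Space N] [PreconnectedSpace N] (hN : LocEuclidean V N)
    (hV : 1 < Module.rank ℝ V) (x : N) : IsPreconnected ({x}ᶜ : Set N) := by
  obtain ⟨e, he, rfl⟩ := hN x
  have hc : IsPreconnected (e '' {0}ᶜ) :=
    (isConnected_compl_singleton_of_one_lt_rank hV 0).isPreconnected.image e he.continuous.continuousOn
  have hsub : e '' {0}ᶜ ⊆ {e 0}ᶜ := by
    rintro _ ⟨u, hu, rfl⟩ h
    exact hu (he.injective h)
  have key : ∀ u v : Set N, IsOpen u → IsOpen v → {e 0}ᶜ ⊆ u ∪ v → {e 0}ᶜ ∩ (u ∩ v) = ∅ →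
      e '' {0}ᶜ ⊆ u → {e 0}ᶜ ⊆ u := by
    intro u v hu hv huv hd heu
    have h1 : IsOpen ({e 0}ᶜ ∩ v) := isClosed_singleton.isOpen_compl.inter hv
    have h2 : IsOpen (({e 0}ᶜ ∩ u) ∪ Set.range e) :=
      (isClosed_singleton.isOpen_compl.inter hu).union he.isOpen_range
    have h3 := isPreconnected_iff_subset_of_disjoint.1 (isPreconnected_univ (α := N)) _ _ h2 h1
      (fun y _ => by
        by_cases hy : y = e 0
        · exact Or.inl (Or.inr ⟨0, hy.symm⟩)
        · exact (huv hy).imp (fun h => Or.inl ⟨hy, h⟩) fun h => ⟨hy, h⟩) (by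
        rw [Set.eq_empty_iff_forall_notMem]
        rintro y ⟨-, h | ⟨w, rfl⟩, hy, hyv⟩
        · exact Set.eq_empty_iff_forall_notMem.1 hd y ⟨hy, h.2, hyv⟩
        · have hw : w ≠ 0 := fun h => hy (by rw [h]; rfl)
          exact Set.eq_empty_iff_forall_notMem.1 hd (e w) ⟨hy, heu ⟨w, hw, rfl⟩, hyv⟩)
    rcases h3 with h | h
    · intro y hy
      rcases h (Set.mem_univ y) with h | ⟨w, rfl⟩
      · exact h.2
      · exact heu ⟨w, fun h => hy (by rw [Set.mem_singleton_iff.1 h]; rfl), rfl⟩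
    · exact absurd rfl (h (Set.mem_univ (e 0))).1
  rw [isPreconnected_iff_subset_of_disjoint] at hc ⊢
  intro u v hu hv huv hd
  rcases hc u v hu hv (hsub.trans huv) (by
    rw [Set.eq_empty_iff_forall_notMem] at hd ⊢
    exact fun y hy => hd y ⟨hsub hy.1, hy.2⟩) with h | h
  · exact Or.inl (key u v hu hv huv hd h)
  · exact Or.inr (key v u hv hu (by rwa [Set.union_comm]) (by rwa [Set.inter_comm v u]) h)

end Push

/-! ### The unit tangent bundle -/

section UnitTangent

variable {n : ℕ} {N : Type*} [TopologicalSpace N] [ChartedSpace (EuclideanSpace ℝ (Fin n)) N]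
  [IsManifold (𝓡 n) ∞ N] (g : RMetric n N)

theorem inner_self_pos {v : TangentBundle (𝓡 n) N} (hv : v.snd ≠ 0) :
    0 < g.inner v.proj v.snd v.snd := g.pos v.proj v.snd hv

-- Keep the fibre coordinate in a trivialization constant and normalize the resulting vector; it is
-- nonzero because the trivialization is linear on fibres.
open Bundle in
theorem locTransport_unitTangent : LocTransport (fun v : UnitTangent g => v.1.proj) := by
  classical
  intro x
  set e := trivializationAt (EuclideanSpace ℝ (Fin n)) (TangentSpace (𝓡 n) : N → Type _) x with he
  have hlin : e.IsLinear ℝ := inferInstance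
  set q : TangentBundle (𝓡 n) N → ℝ := fun v => g.inner v.proj v.snd v.snd with hq
  have hqc : Continuous q := continuous_inner_self g
  -- transport in the trivialization, without normalization
  set S : UnitTangent g × N → TangentBundle (𝓡 n) N := fun z => ⟨z.2, e.symm z.2 (e z.1.1).2⟩ with hS
  set R : UnitTangent g × N → ℝ := fun z => (√(q (S z)))⁻¹ with hR
  set T : UnitTangent g × N → TangentBundle (𝓡 n) N :=
    fun z => ⟨z.2, e.symm z.2 (R z • (e z.1.1).2)⟩ with hT
  have hTS : ∀ z : UnitTangent g × N, z.2 ∈ e.baseSet → (T z).snd = R z • (S z).snd := fun z hz => by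
    have h := (e.symmL ℝ z.2).map_smul (R z) (e z.1.1).2
    rw [Trivialization.symmL_apply e hz, Trivialization.symmL_apply e hz] at h
    exact h
  have hSne : ∀ z : UnitTangent g × N, z.1.1.proj ∈ e.baseSet → z.2 ∈ e.baseSet →
      (S z).snd ≠ 0 := by
    intro z h1 h2 h0
    have h3 : (e z.1.1).2 = 0 := by
      have := (e.continuousLinearEquivAt ℝ z.2 h2).symm.map_eq_zero_iff.1 h0
      exact this
    have h4 : z.1.1.snd = 0 := by
      have : e.continuousLinearEquivAt ℝ z.1.1.proj h1 z.1.1.snd = 0 := h3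
      exact (e.continuousLinearEquivAt ℝ z.1.1.proj h1).map_eq_zero_iff.1 this
    have h5 := z.1.2
    rw [h4] at h5
    simp at h5
  have hT1 : ∀ z : UnitTangent g × N, z.1.1.proj ∈ e.baseSet ∧ z.2 ∈ e.baseSet →
      g.inner (T z).proj (T z).snd (T z).snd = 1 := by
    rintro z ⟨h1, h2⟩
    have hpos : 0 < q (S z) := inner_self_pos g (hSne z h1 h2)
    have : g.inner (T z).proj (T z).snd (T z).snd = R z * (R z * q (S z)) := by
      rw [hTS z h2]
      change g.inner z.2 (R z • (S z).snd) (R z • (S z).snd) = _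
      rw [map_smul, map_smul]
      rfl
    rw [this, hR]
    have h6 := Real.mul_self_sqrt hpos.le
    have h7 := (Real.sqrt_pos.2 hpos).ne'
    simp only
    field_simp
    nlinarith
  have hself : ∀ v : UnitTangent g, v.1.proj ∈ e.baseSet → T (v, v.1.proj) = v.1 := by
    intro v hv
    have h1 : S (v, v.1.proj) = v.1 := by
      rw [hS]
      refine Bundle.TotalSpace.ext rfl (heq_of_eq ?_)
      exact (e.continuousLinearEquivAt ℝ v.1.proj hv).symm_apply_apply v.1.snd
    have h2 : R (v, v.1.proj) = 1 := by
      rw [hR]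
      simp only [h1, hq, v.2]
      simp
    refine Bundle.TotalSpace.ext rfl (heq_of_eq ?_)
    have := hTS (v, v.1.proj) hv
    rw [h2, one_smul] at this
    rw [this]
    exact (e.continuousLinearEquivAt ℝ v.1.proj hv).symm_apply_apply v.1.snd
  have hsc : ∀ f : UnitTangent g × N → EuclideanSpace ℝ (Fin n), ContinuousOn f
      {z | z.1.1.proj ∈ e.baseSet ∧ z.2 ∈ e.baseSet} →
      ContinuousOn (fun z => (⟨z.2, e.symm z.2 (f z)⟩ : TangentBundle (𝓡 n) N))
        {z | z.1.1.proj ∈ e.baseSet ∧ z.2 ∈ e.baseSet} := fun f hf =>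
    e.continuousOn_symm.comp (continuousOn_snd.prodMk hf) fun z hz => ⟨hz.2, trivial⟩
  have hec : ContinuousOn (fun z : UnitTangent g × N => (e z.1.1).2)
      {z | z.1.1.proj ∈ e.baseSet ∧ z.2 ∈ e.baseSet} :=
    continuous_snd.comp_continuousOn (e.continuousOn.comp (by fun_prop)
      fun z hz => e.mem_source.2 hz.1)
  refine ⟨e.baseSet, e.open_baseSet.mem_nhds (mem_baseSet_trivializationAt _ _ x),
    fun z => if hz : z.1.1.proj ∈ e.baseSet ∧ z.2 ∈ e.baseSet then ⟨T z, hT1 z hz⟩ else z.1,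
    ?_, ?_, ?_⟩
  · refine (Topology.IsInducing.continuousOn_iff (g := Subtype.val) ⟨rfl⟩).2 ?_
    have hSc := hsc _ hec
    have hRc : ContinuousOn R {z | z.1.1.proj ∈ e.baseSet ∧ z.2 ∈ e.baseSet} := by
      refine ContinuousOn.inv₀ (Real.continuous_sqrt.comp_continuousOn
        (hqc.comp_continuousOn hSc)) fun z hz => ?_
      exact (Real.sqrt_pos.2 (inner_self_pos g (hSne z hz.1 hz.2))).ne'
    refine (hsc _ (hRc.smul hec)).congr fun z hz => ?_
    simp only [Set.mem_ofPred_eq] at hz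
    simp only [Function.comp_apply, dif_pos hz]
    rfl
  · intro v b hv hb
    rw [dif_pos ⟨hv, hb⟩]
  · intro v hv
    rw [dif_pos ⟨hv, hv⟩]
    exact Subtype.ext (hself v hv)

variable {g}

open Bundle in
theorem Frame.isFibreIncl {x₀ : N} (φ : Frame g x₀) :
    IsFibreIncl (fun v : UnitTangent g => v.1.proj) φ.fibreIncl x₀ := by
  refine ⟨?_, fun _ => rfl, ?_⟩
  · have h1 : Topology.IsEmbedding fun s : USphere n => (⟨x₀, φ.toEquiv s.1⟩ : TangentBundle (𝓡 n) N) :=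
      (FiberBundle.totalSpaceMk_isEmbedding (EuclideanSpace ℝ (Fin n))
        (TangentSpace (𝓡 n) : N → Type _) x₀).comp
        (φ.toEquiv.toHomeomorph.isEmbedding.comp Topology.IsEmbedding.subtypeVal)
    exact Topology.IsEmbedding.of_comp (Continuous.subtype_mk h1.continuous _)
      continuous_subtype_val h1
  · rintro ⟨⟨x, v⟩, hv⟩ hx
    simp only at hx
    subst hx
    have h1 : ‖φ.toEquiv.symm v‖ = 1 := by
      have h2 := φ.isometry (φ.toEquiv.symm v)
      rw [φ.toEquiv.apply_symm_apply] at h2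
      have h3 : ‖φ.toEquiv.symm v‖ ^ 2 = 1 := h2.symm.trans hv
      exact (pow_eq_one_iff_of_nonneg (norm_nonneg _) two_ne_zero).1 h3
    refine ⟨⟨φ.toEquiv.symm v, by simpa using h1⟩, ?_⟩
    refine Subtype.ext (Bundle.TotalSpace.ext rfl (heq_of_eq ?_))
    exact φ.toEquiv.apply_symm_apply v

theorem continuous_unitTangent_proj : Continuous (fun v : UnitTangent g => v.1.proj) :=
  (FiberBundle.continuous_proj (EuclideanSpace ℝ (Fin n))
    (TangentSpace (𝓡 n) : N → Type _)).comp continuous_subtype_val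

end UnitTangent

/-! ### Difference vectors: an inverse exponential map -/

section DiffVec

variable {n : ℕ} {N : Type*} [TopologicalSpace N] [ChartedSpace (EuclideanSpace ℝ (Fin n)) N]
  [IsManifold (𝓡 n) ∞ N]

/-- The tangent vector at `x` obtained by averaging the differences of `y` and `x` in charts. -/
def diffVec (ρ : SmoothPartitionOfUnity N (𝓡 n) N) (x y : N) : EuclideanSpace ℝ (Fin n) :=
  ∑ᶠ i, ρ i x • tangentCoordChange (𝓡 n) i x x (extChartAt (𝓡 n) i y - extChartAt (𝓡 n) i x)

/-- The difference vector, in the chart around `p`. -/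
def diffVecAt (ρ : SmoothPartitionOfUnity N (𝓡 n) N) (p x y : N) : EuclideanSpace ℝ (Fin n) :=
  ∑ i ∈ ρ.fintsupport p,
    ρ i x • tangentCoordChange (𝓡 n) i p x (extChartAt (𝓡 n) i y - extChartAt (𝓡 n) i x)

/-- The map `(x, y) ↦ diffVec x y` to the tangent bundle. -/
def diffMap (ρ : SmoothPartitionOfUnity N (𝓡 n) N) (z : N × N) : TangentBundle (𝓡 n) N :=
  ⟨z.1, diffVec ρ z.1 z.2⟩

@[simp] theorem diffVec_self (ρ : SmoothPartitionOfUnity N (𝓡 n) N) (x : N) :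
    diffVec ρ x x = 0 := by
  simp [diffVec]

variable {ρ : SmoothPartitionOfUnity N (𝓡 n) N}

theorem mem_chart_of_mem_fintsupport (hρ : ρ.IsSubordinate fun i => (chartAt (EuclideanSpace ℝ (Fin n)) i).source)
    {i p : N} (hi : i ∈ ρ.fintsupport p) : p ∈ (extChartAt (𝓡 n) i).source := by
  rw [extChartAt_source]
  exact hρ i ((ρ.mem_fintsupport_iff p i).1 hi)

/-- Near `p` only the finitely many indices in `ρ.fintsupport p` contribute, and the coordinate
changes from `i` to `x` and from `x` to `p` compose. This replaces the locally finite sum, read in a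
chart depending on `x`, by a fixed finite sum in the chart at `p`. -/
theorem eventually_diffVecAt (hρ : ρ.IsSubordinate fun i => (chartAt (EuclideanSpace ℝ (Fin n)) i).source) (p : N) :
    ∀ᶠ x in 𝓝 p, ∀ y, tangentCoordChange (𝓡 n) x p x (diffVec ρ x y) = diffVecAt ρ p x y := by
  filter_upwards [ρ.eventually_finsupport_subset p, (extChartAt_source_mem_nhds p : (extChartAt (𝓡 n) p).source ∈ 𝓝 p)]
    with x hx hxp y
  have h1 : diffVec ρ x y = ∑ i ∈ ρ.finsupport x, ρ i x •
      tangentCoordChange (𝓡 n) i x x (extChartAt (𝓡 n) i y - extChartAt (𝓡 n) i x) :=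
    (ρ.sum_finsupport_smul_eq_finsum x (fun i x' => tangentCoordChange (𝓡 n) i x' x'
      (extChartAt (𝓡 n) i y - extChartAt (𝓡 n) i x'))).symm
  have h2 : diffVecAt ρ p x y = ∑ i ∈ ρ.finsupport x, ρ i x •
      tangentCoordChange (𝓡 n) i p x (extChartAt (𝓡 n) i y - extChartAt (𝓡 n) i x) := by
    refine (Finset.sum_subset hx fun i _ hi => ?_).symm
    have : ρ i x = 0 := by simpa using (ρ.mem_finsupport x).not.1 hi
    rw [this, zero_smul]
  rw [h1, h2, map_sum]
  refine Finset.sum_congr rfl fun i hi => ?_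
  rw [map_smul]
  congr 1
  refine tangentCoordChange_comp ⟨⟨?_, mem_extChartAt_source x⟩, hxp⟩
  exact mem_chart_of_mem_fintsupport hρ (ρ.finsupport_subset_fintsupport x hi)

/-- The chart differences vanish on the diagonal, so the derivatives of the weights and of the
coordinate changes drop out at `(p, p)`. What remains of the `i`-th summand is `ρ i p` times the
derivative of the transition map followed by its inverse, and the weights add up to `1`. -/
theorem hasStrictFDerivAt_diffVecAt (hρ : ρ.IsSubordinate fun i => (chartAt (EuclideanSpace ℝ (Fin n)) i).source) (p : N) :
    HasStrictFDerivAt (fun z : EuclideanSpace ℝ (Fin n) × EuclideanSpace ℝ (Fin n) =>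
      diffVecAt ρ p ((extChartAt (𝓡 n) p).symm z.1) ((extChartAt (𝓡 n) p).symm z.2))
      (ContinuousLinearMap.snd ℝ _ _ - ContinuousLinearMap.fst ℝ _ _)
      (extChartAt (𝓡 n) p p, extChartAt (𝓡 n) p p) := by
  set V := EuclideanSpace ℝ (Fin n)
  set ψ := extChartAt (𝓡 n) p with hψ
  have hsymm : ψ.symm (ψ p) = p := ψ.left_inv (mem_extChartAt_source p)
  have hrange : Set.range (𝓡 n) = Set.univ := by simp
  -- the constituents
  have key : ∀ i ∈ ρ.fintsupport p,
      HasStrictFDerivAt (fun z : V × V => ρ i (ψ.symm z.1) • tangentCoordChange (𝓡 n) i p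
        (ψ.symm z.1) (extChartAt (𝓡 n) i (ψ.symm z.2) - extChartAt (𝓡 n) i (ψ.symm z.1)))
        (ρ i p • (ContinuousLinearMap.snd ℝ V V - ContinuousLinearMap.fst ℝ V V)) (ψ p, ψ p) := by
    intro i hi
    have hip := mem_chart_of_mem_fintsupport hρ hi
    have hθ : ContDiffAt ℝ ∞ (extChartAt (𝓡 n) i ∘ ψ.symm) (ψ p) := by
      have h : ContDiffWithinAt ℝ ∞ (extChartAt (𝓡 n) i ∘ ψ.symm) (Set.range (𝓡 n)) (ψ p) :=
        contDiffWithinAt_ext_coord_change i p (by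
        rw [PartialEquiv.trans_source'', PartialEquiv.symm_symm, PartialEquiv.symm_target]
        exact Set.mem_image_of_mem _ ⟨mem_extChartAt_source p, hip⟩)
      rwa [hrange, contDiffWithinAt_univ] at h
    have hθ' : ContDiffAt ℝ ∞ (ψ ∘ (extChartAt (𝓡 n) i).symm) (extChartAt (𝓡 n) i p) := by
      have h : ContDiffWithinAt ℝ ∞ (ψ ∘ (extChartAt (𝓡 n) i).symm) (Set.range (𝓡 n))
        (extChartAt (𝓡 n) i p) := contDiffWithinAt_ext_coord_change p i (by
        rw [PartialEquiv.trans_source'', PartialEquiv.symm_symm, PartialEquiv.symm_target]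
        exact Set.mem_image_of_mem _ ⟨hip, mem_extChartAt_source p⟩)
      rwa [hrange, contDiffWithinAt_univ] at h
    have hA : ContDiffAt ℝ 1 (fun u : V => tangentCoordChange (𝓡 n) i p (ψ.symm u)) (ψ p) := by
      have h1 : (fun u : V => tangentCoordChange (𝓡 n) i p (ψ.symm u)) =
          fderiv ℝ (ψ ∘ (extChartAt (𝓡 n) i).symm) ∘ (extChartAt (𝓡 n) i ∘ ψ.symm) := by
        funext u
        rw [tangentCoordChange_def, hrange, fderivWithin_univ]
        rfl
      rw [h1]
      refine ContDiffAt.comp _ ?_ (hθ.of_le (by exact_mod_cast le_top))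
      rw [Function.comp_apply, hsymm]
      exact (hθ'.fderiv_right (m := ∞) le_rfl).of_le (by exact_mod_cast le_top)
    have hρi : ContDiffAt ℝ 1 (fun u : V => ρ i (ψ.symm u)) (ψ p) := by
      have h1 : ContMDiffAt (𝓡 n) 𝓘(ℝ) ∞ (ρ i) (ψ.symm (ψ p)) := (ρ i).contMDiff.contMDiffAt
      have h2 : ContMDiffAt 𝓘(ℝ, V) (𝓡 n) ∞ ψ.symm (ψ p) :=
        (contMDiffOn_extChartAt_symm p).contMDiffAt (extChartAt_target_mem_nhds p)
      exact ((h1.comp _ h2).contDiffAt).of_le (by exact_mod_cast le_top)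
    have hθs := hθ.hasStrictFDerivAt' (f' := tangentCoordChange (𝓡 n) p i p) (by
      have h : HasFDerivWithinAt (extChartAt (𝓡 n) i ∘ ψ.symm) (tangentCoordChange (𝓡 n) p i p)
        (Set.range (𝓡 n)) (ψ p) := hasFDerivWithinAt_tangentCoordChange ⟨mem_extChartAt_source p, hip⟩
      rwa [hrange, hasFDerivWithinAt_univ] at h) (by simp)
    have hfst := (ContinuousLinearMap.fst ℝ V V).hasStrictFDerivAt (x := (ψ p, ψ p))
    have hsnd := (ContinuousLinearMap.snd ℝ V V).hasStrictFDerivAt (x := (ψ p, ψ p))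
    have h1 := HasStrictFDerivAt.comp (ψ p, ψ p) (g := extChartAt (𝓡 n) i ∘ ψ.symm)
      (f := Prod.fst) hθs hfst
    have h2 := HasStrictFDerivAt.comp (ψ p, ψ p) (g := extChartAt (𝓡 n) i ∘ ψ.symm)
      (f := Prod.snd) hθs hsnd
    have h3 := HasStrictFDerivAt.comp (ψ p, ψ p) (f := Prod.fst)
      (hA.hasStrictFDerivAt one_ne_zero) hfst
    have h4 := HasStrictFDerivAt.comp (ψ p, ψ p) (f := Prod.fst)
      (hρi.hasStrictFDerivAt one_ne_zero) hfst
    refine (h4.smul (h3.clm_apply (h2.sub h1))).congr_fderiv ?_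
    have hcomp : ∀ v, tangentCoordChange (𝓡 n) i p p (tangentCoordChange (𝓡 n) p i p v) = v :=
      fun v => by
        rw [tangentCoordChange_comp ⟨⟨mem_extChartAt_source p, hip⟩, mem_extChartAt_source p⟩,
          tangentCoordChange_self (mem_extChartAt_source p)]
    refine ContinuousLinearMap.ext fun v => ?_
    simp [hsymm, hcomp, -tangentBundleCore_coordChange]
  have h := HasStrictFDerivAt.fun_sum key
  refine h.congr_fderiv ?_
  rw [← Finset.sum_smul, ρ.sum_finsupport' p (Set.mem_univ p) (ρ.finsupport_subset_fintsupport p),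
    one_smul]

/-- In charts the map is `(x, y) ↦ (x, diffVecAt ρ p x y)`, with derivative `(u, v) ↦ (u, v - u)` at
`(p, p)`. This is invertible, so the inverse function theorem applies. -/
theorem isLocalHomeomorphOn_diffMap
    (hρ : ρ.IsSubordinate fun i => (chartAt (EuclideanSpace ℝ (Fin n)) i).source) :
    IsLocalHomeomorphOn (diffMap ρ) (Set.range fun x : N => (x, x)) := by
  refine IsLocalHomeomorphOn.mk _ _ ?_
  rintro _ ⟨p, rfl⟩
  set V := EuclideanSpace ℝ (Fin n)
  obtain ⟨U, hU, hUo, hpU⟩ := mem_nhds_iff.1 (eventually_diffVecAt hρ p)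
  set D : (V × V) ≃L[ℝ] (V × V) := ContinuousLinearEquiv.equivOfInverse
    ((ContinuousLinearMap.fst ℝ V V).prod
      (ContinuousLinearMap.snd ℝ V V - ContinuousLinearMap.fst ℝ V V))
    ((ContinuousLinearMap.fst ℝ V V).prod
      (ContinuousLinearMap.snd ℝ V V + ContinuousLinearMap.fst ℝ V V))
    (fun z => by simp) (fun z => by simp) with hD
  have hF : HasStrictFDerivAt (fun z : V × V => (z.1,
      diffVecAt ρ p ((extChartAt (𝓡 n) p).symm z.1) ((extChartAt (𝓡 n) p).symm z.2)))
      (D : (V × V) →L[ℝ] (V × V)) (chartAt V p p, chartAt V p p) :=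
    HasStrictFDerivAt.prodMk (ContinuousLinearMap.fst ℝ V V).hasStrictFDerivAt
      (hasStrictFDerivAt_diffVecAt hρ p)
  set H := hF.toOpenPartialHomeomorph _
  set c : OpenPartialHomeomorph (TangentBundle (𝓡 n) N) (V × V) :=
    chartAt (ModelProd V V) (⟨p, 0⟩ : TangentBundle (𝓡 n) N) with hc
  have hcL : ∀ x ∈ U ∩ (chartAt V p).source, ∀ y ∈ (chartAt V p).source,
      diffMap ρ (x, y) ∈ c.source ∧ c (diffMap ρ (x, y)) = H (chartAt V p x, chartAt V p y) := by
    rintro x ⟨hxU, hx⟩ y hy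
    refine ⟨(TangentBundle.mem_chart_source_iff (H := V) _ _).2 hx, ?_⟩
    refine Prod.ext rfl ?_
    refine (hU hxU y).trans ?_
    change diffVecAt ρ p x y = diffVecAt ρ p ((chartAt V p).symm (chartAt V p x))
      ((chartAt V p).symm (chartAt V p y))
    rw [(chartAt V p).left_inv hx, (chartAt V p).left_inv hy]
  have hps := mem_chart_source V p
  set e := ((((chartAt V p).prod (chartAt V p)).trans H).trans c.symm).restr
    ((U ∩ (chartAt V p).source) ×ˢ (chartAt V p).source) with he
  have hopen : IsOpen ((U ∩ (chartAt V p).source) ×ˢ (chartAt V p).source) :=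
    (hUo.inter (chartAt V p).open_source).prod (chartAt V p).open_source
  refine ⟨e, ?_, ?_⟩
  · rw [he, OpenPartialHomeomorph.restr_source, hopen.interior_eq]
    refine ⟨⟨⟨⟨hps, hps⟩, hF.mem_toOpenPartialHomeomorph_source⟩, ?_⟩, ⟨hpU, hps⟩, hps⟩
    have h := hcL p ⟨hpU, hps⟩ p hps
    change H (chartAt V p p, chartAt V p p) ∈ c.target
    rw [← h.2]
    exact c.map_source h.1
  · rintro ⟨x, y⟩ hz
    rw [he, OpenPartialHomeomorph.restr_source, hopen.interior_eq] at hz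
    have h := hcL x hz.2.1 y hz.2.2
    change _ = c.symm (H (chartAt V p x, chartAt V p y))
    rw [← h.2, c.left_inv h.1]

end DiffVec

/-! ### The exponential map near a compact set, and lifts to the unit tangent bundle -/

section ExpMap

variable {n : ℕ} {N : Type*} [TopologicalSpace N] [ChartedSpace (EuclideanSpace ℝ (Fin n)) N]
  [IsManifold (𝓡 n) ∞ N]

/-- Scalar multiplication on the tangent bundle. -/
def scale (s : ℝ) (v : TangentBundle (𝓡 n) N) : TangentBundle (𝓡 n) N := ⟨v.proj, s • v.snd⟩

open Bundle in
theorem continuous_scale :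
    Continuous fun z : ℝ × TangentBundle (𝓡 n) N => scale z.1 z.2 := by
  rw [continuous_iff_continuousAt]
  rintro ⟨s, v⟩
  have hproj : Continuous (TotalSpace.proj : TangentBundle (𝓡 n) N → N) :=
    FiberBundle.continuous_proj (EuclideanSpace ℝ (Fin n)) (TangentSpace (𝓡 n) : N → Type _)
  rw [FiberBundle.continuousAt_totalSpace (EuclideanSpace ℝ (Fin n))]
  refine ⟨(hproj.comp continuous_snd).continuousAt, ?_⟩
  set e := trivializationAt (EuclideanSpace ℝ (Fin n)) (TangentSpace (𝓡 n) : N → Type _) v.proj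
  have hlin : e.IsLinear ℝ := inferInstance
  have hv : v.proj ∈ e.baseSet := mem_baseSet_trivializationAt _ _ _
  have h1 : ContinuousAt (fun z : ℝ × TangentBundle (𝓡 n) N => z.1 • (e z.2).2) (s, v) :=
    continuousAt_fst.smul (continuousAt_snd.comp
      ((e.continuousAt (e.mem_source.2 hv)).comp (x := (s, v)) continuousAt_snd))
  refine h1.congr ?_
  filter_upwards [(hproj.comp continuous_snd).continuousAt (x := (s, v)) |>.preimage_mem_nhds
    (e.open_baseSet.mem_nhds hv)] with z hz
  exact ((e.linear ℝ hz).map_smul z.1 z.2.snd).symm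

theorem scale_one (v : TangentBundle (𝓡 n) N) : scale 1 v = v :=
  Bundle.TotalSpace.ext rfl (heq_of_eq (one_smul ℝ v.snd))

theorem scale_scale (s t : ℝ) (v : TangentBundle (𝓡 n) N) :
    scale s (scale t v) = scale (s * t) v :=
  Bundle.TotalSpace.ext rfl (heq_of_eq (smul_smul s t v.snd))

theorem inner_scale (g : RMetric n N) (s : ℝ) (v : TangentBundle (𝓡 n) N) :
    g.inner (scale s v).proj (scale s v).snd (scale s v).snd =
      s * (s * g.inner v.proj v.snd v.snd) := by
  change g.inner v.proj (s • v.snd) (s • v.snd) = _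
  rw [map_smul, map_smul]
  rfl

theorem UnitTangent.snd_ne_zero {g : RMetric n N} (v : UnitTangent g) : v.1.snd ≠ 0 := fun h => by
  have h5 := v.2
  rw [h] at h5
  simp at h5

/-- Normalize a nonzero tangent vector. -/
def unitize (g : RMetric n N) (v : {v : TangentBundle (𝓡 n) N // v.snd ≠ 0}) : UnitTangent g :=
  ⟨scale (√(g.inner v.1.proj v.1.snd v.1.snd))⁻¹ v.1, by
    have hpos : 0 < g.inner v.1.proj v.1.snd v.1.snd := inner_self_pos g v.2
    rw [inner_scale]
    have h6 := Real.mul_self_sqrt hpos.le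
    have h7 := (Real.sqrt_pos.2 hpos).ne'
    field_simp
    nlinarith⟩

theorem continuous_unitize (g : RMetric n N) : Continuous (unitize g) := by
  refine Continuous.subtype_mk (continuous_scale.comp (Continuous.prodMk ?_
    continuous_subtype_val)) _
  refine Continuous.inv₀ (Real.continuous_sqrt.comp
    ((continuous_inner_self g).comp continuous_subtype_val)) fun v => ?_
  exact (Real.sqrt_pos.2 (inner_self_pos g v.2)).ne'

theorem t2Space_tangentBundle [T2Space N] : T2Space (TangentBundle (𝓡 n) N) := by
  refine ⟨fun v w hvw => ?_⟩
  have hproj : Continuous (Bundle.TotalSpace.proj : TangentBundle (𝓡 n) N → N) :=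
    FiberBundle.continuous_proj (EuclideanSpace ℝ (Fin n)) (TangentSpace (𝓡 n) : N → Type _)
  by_cases h : v.proj = w.proj
  · set c := trivializationAt (EuclideanSpace ℝ (Fin n)) (TangentSpace (𝓡 n) : N → Type _) v.proj
    have hv : v ∈ c.source := c.mem_source.2 (FiberBundle.mem_baseSet_trivializationAt' _)
    have hw : w ∈ c.source := c.mem_source.2 (h ▸ FiberBundle.mem_baseSet_trivializationAt' _)
    obtain ⟨a, b, ha, hb, hva, hwb, hab⟩ := t2_separation (c.injOn.ne hv hw hvw)
    refine ⟨c.source ∩ c ⁻¹' a, c.source ∩ c ⁻¹' b, ?_, ?_, ⟨hv, hva⟩, ⟨hw, hwb⟩, ?_⟩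
    · exact c.continuousOn.isOpen_inter_preimage c.open_source ha
    · exact c.continuousOn.isOpen_inter_preimage c.open_source hb
    · exact (hab.preimage c).mono Set.inter_subset_right Set.inter_subset_right
  · exact separated_by_continuous hproj h

variable {ρ : SmoothPartitionOfUnity N (𝓡 n) N}

/-- On the diagonal `diffMap` is injective, since the base point recovers `x`, and near the diagonal
it is locally injective. Over a compact set the two properties combine to injectivity on a
neighbourhood. -/
theorem exists_injOn_diffMap [T2Space N]
    (hρ : ρ.IsSubordinate fun i => (chartAt (EuclideanSpace ℝ (Fin n)) i).source)
    {K : Set N} (hK : IsCompact K) : ∃ W : Set (N × N), IsOpen W ∧ (∀ x ∈ K, (x, x) ∈ W) ∧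
      Set.InjOn (diffMap ρ) W ∧ IsLocalHomeomorphOn (diffMap ρ) W := by
  have hT := t2Space_tangentBundle (n := n) (N := N)
  have hloc := isLocalHomeomorphOn_diffMap hρ
  set Δ : Set (N × N) := (fun x => (x, x)) '' K with hΔ
  have hΔc : IsCompact Δ := hK.image (by fun_prop)
  have hΔr : ∀ z ∈ Δ, z ∈ Set.range fun x : N => (x, x) := by
    rintro _ ⟨x, -, rfl⟩
    exact ⟨x, rfl⟩
  obtain ⟨t, ht, hinj⟩ := Set.InjOn.exists_mem_nhdsSet (f := diffMap ρ) (s := Δ)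
    (by
      rintro _ ⟨x, -, rfl⟩ _ ⟨y, -, rfl⟩ h
      have : x = y := congrArg Bundle.TotalSpace.proj h
      rw [this]) hΔc
    (fun z hz => hloc.continuousAt (hΔr z hz))
    (fun z hz => by
      obtain ⟨e, he, hfe⟩ := hloc z (hΔr z hz)
      exact ⟨e.source, e.open_source.mem_nhds he, hfe ▸ e.injOn⟩)
  set S : Set (N × N) := ⋃₀ {s | ∃ e : OpenPartialHomeomorph (N × N) (TangentBundle (𝓡 n) N),
    diffMap ρ = e ∧ s = e.source} with hS
  have hSo : IsOpen S := isOpen_sUnion (by rintro _ ⟨e, -, rfl⟩; exact e.open_source)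
  refine ⟨interior t ∩ S, isOpen_interior.inter hSo, fun x hx => ⟨?_, ?_⟩,
    hinj.mono (Set.inter_subset_left.trans interior_subset), ?_⟩
  · exact subset_interior_iff_mem_nhdsSet.2 ht ⟨x, hx, rfl⟩
  · obtain ⟨e, he, hfe⟩ := hloc (x, x) ⟨x, rfl⟩
    exact ⟨e.source, ⟨e, hfe, rfl⟩, he⟩
  · rintro z ⟨-, _, ⟨e, hfe, rfl⟩, he⟩
    exact ⟨e, he, hfe⟩

/-- An inverse of `diffMap` near the zero section over a compact set, together with a bound for the
length of the vectors for which it is used. -/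
theorem exists_expMap [T2Space N]
    (hρ : ρ.IsSubordinate fun i => (chartAt (EuclideanSpace ℝ (Fin n)) i).source)
    {C : Set (TangentBundle (𝓡 n) N)} (hC : IsCompact C) :
    ∃ (E : TangentBundle (𝓡 n) N → N) (s₀ : ℝ), 0 < s₀ ∧
      ContinuousOn (fun z : ℝ × TangentBundle (𝓡 n) N => E (scale z.1 z.2)) (Set.Icc 0 s₀ ×ˢ C) ∧
      (∀ v ∈ C, E (scale 0 v) = v.proj) ∧
      ∀ s ∈ Set.Icc 0 s₀, ∀ v ∈ C, diffMap ρ (v.proj, E (scale s v)) = scale s v := by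
  classical
  have hproj : Continuous (Bundle.TotalSpace.proj : TangentBundle (𝓡 n) N → N) :=
    FiberBundle.continuous_proj (EuclideanSpace ℝ (Fin n)) (TangentSpace (𝓡 n) : N → Type _)
  obtain ⟨W, hWo, hKW, hinj, hloc⟩ := exists_injOn_diffMap hρ (hC.image hproj)
  set E : TangentBundle (𝓡 n) N → N :=
    fun v => if h : v ∈ diffMap ρ '' W then (Classical.choose h).2 else v.proj with hE
  have hEW : ∀ z ∈ W, E (diffMap ρ z) = z.2 := by
    intro z hz
    have h : diffMap ρ z ∈ diffMap ρ '' W := ⟨z, hz, rfl⟩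
    have h1 := Classical.choose_spec h
    simp only [hE, dif_pos h]
    rw [hinj h1.1 hz h1.2]
  have hO : IsOpen (diffMap ρ '' W) := by
    rw [isOpen_iff_mem_nhds]
    rintro _ ⟨z, hz, rfl⟩
    rw [← hloc.map_nhds_eq hz]
    exact Filter.image_mem_map (hWo.mem_nhds hz)
  have hEc : ContinuousOn E (diffMap ρ '' W) := by
    rintro _ ⟨z, hz, rfl⟩
    refine ContinuousAt.continuousWithinAt ?_
    rw [ContinuousAt, ← hloc.map_nhds_eq hz, Filter.tendsto_map'_iff, hEW z hz]
    refine (continuousAt_snd (p := z)).tendsto.congr' ?_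
    filter_upwards [hWo.mem_nhds hz] with z' hz'
    exact (hEW z' hz').symm
  have hzero : ∀ v ∈ C, scale 0 v = diffMap ρ (v.proj, v.proj) := fun v _ =>
    Bundle.TotalSpace.ext rfl (heq_of_eq ((zero_smul ℝ v.snd).trans (diffVec_self ρ _).symm))
  have hzO : ∀ v ∈ C, scale 0 v ∈ diffMap ρ '' W := fun v hv =>
    ⟨_, hKW _ ⟨v, hv, rfl⟩, (hzero v hv).symm⟩
  -- The zero vectors lie in the open set on which `E` inverts `diffMap`; compactness of `C` gives
  -- one scale that works for all vectors in `C`.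
  obtain ⟨u, v, hu, hv, h0u, hCv, huv⟩ := generalized_tube_lemma (isCompact_singleton (x := (0 : ℝ)))
    hC (hO.preimage continuous_scale) (by
      rintro ⟨s, v⟩ ⟨hs, hv⟩
      rw [Set.mem_singleton_iff] at hs
      rw [Set.mem_preimage, hs]
      exact hzO v hv)
  obtain ⟨s, hs, hsu⟩ := Metric.isOpen_iff.1 hu 0 (h0u rfl)
  have hmem : ∀ t ∈ Set.Icc 0 (s / 2), ∀ w ∈ C, scale t w ∈ diffMap ρ '' W := by
    intro t ht w hw
    refine huv (a := (t, w)) ⟨hsu ?_, hCv hw⟩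
    rw [Metric.mem_ball, Real.dist_eq, sub_zero, abs_of_nonneg ht.1]
    linarith [ht.2]
  refine ⟨E, s / 2, by positivity, ?_, ?_, ?_⟩
  · exact hEc.comp continuous_scale.continuousOn fun z hz => hmem z.1 hz.1 z.2 hz.2
  · intro w hw
    rw [hzero w hw, hEW _ (hKW _ ⟨w, hw, rfl⟩)]
  · intro t ht w hw
    obtain ⟨z, hz, hzw⟩ := hmem t ht w hw
    have h1 : z.1 = w.proj := congrArg Bundle.TotalSpace.proj hzw
    rw [← hzw, hEW z hz, ← h1]

end ExpMap

/-! ### Lifting maps of compact spaces and of spheres -/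

section Lifting

variable {X E B F : Type*} [TopologicalSpace X] [TopologicalSpace E] [TopologicalSpace B]
  [TopologicalSpace F] {p : E → B}

/-- The map `f` can be lifted along `p`. -/
def LiftsTo (p : E → B) (f : C(X, B)) : Prop := ∃ G : C(X, E), ∀ x, p (G x) = f x

theorem LocTransport.liftsTo_of_homotopic [CompactSpace X] [T2Space X] (hp : LocTransport p)
    {f f' : C(X, B)} (h : ContinuousMap.Homotopic f f') (hf : LiftsTo p f) : LiftsTo p f' := by
  obtain ⟨H, hH, h0, h1⟩ := h.exists_continuous
  obtain ⟨G, hG⟩ := hf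
  obtain ⟨e, he, hpe, -⟩ := hp.exists_lift (H := fun z : X × I => H (z.2, z.1)) (by fun_prop)
    G.continuous (fun x => (hG x).trans (h0 x).symm)
  exact ⟨⟨e, he⟩, fun x => (hpe x).trans (h1 x)⟩

theorem LocTransport.liftsTo_iff_of_homotopic [CompactSpace X] [T2Space X] (hp : LocTransport p)
    {f f' : C(X, B)} (h : ContinuousMap.Homotopic f f') : LiftsTo p f ↔ LiftsTo p f' :=
  ⟨hp.liftsTo_of_homotopic h, hp.liftsTo_of_homotopic h.symm⟩

variable {ι : F → E} {b₀ : B} {k : ℕ}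

/-- With a null-homotopic bottom face the lift on the cube can be made constant on the whole
boundary, so it descends to the sphere. It then covers a map that is only homotopic to `f`, and
homotopy lifting does the rest. -/
theorem LocTransport.liftsTo_of_boundaryRel_zero (hp : LocTransport p) (hpc : Continuous p)
    (hι : IsFibreIncl p ι b₀) {f₀ : F} {f : C(USphere (k + 2), B)} (hf : f (pole (k + 1)) = b₀)
    (h : BoundaryRel ι p k f₀ b₀ (sphereClass (k + 1) f hf) (zeroClass k f₀)) : LiftsTo p f := by
  obtain ⟨g, c, G, hg, hc, hpG, hGb, hGc⟩ := h
  obtain ⟨G', hG', hG'g⟩ := exists_lift_const_boundary hpc hι.isEmbedding.continuous hι.proj hpG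
    hGb hGc (mk_eq_mk_iff.1 hc)
  obtain ⟨Φ, hΦ⟩ := exists_sphere_map G' hG'
  refine hp.liftsTo_of_homotopic (f := ⟨fun x => p (Φ x), by fun_prop⟩) ?_ ⟨Φ, fun x => rfl⟩
  refine homotopic_of_cube_homotopicRel ?_
  have h1 : ContinuousMap.HomotopicRel g.1 (f.comp (collapse (k + 1)))
    (Cube.boundary (Fin (k + 1))) := mk_eq_mk_iff.1 hg
  have h2 : (⟨fun x => p (Φ x), by fun_prop⟩ : C(USphere (k + 2), B)).comp (collapse (k + 1)) =
      ⟨fun t => p (G' t), by fun_prop⟩ := ContinuousMap.ext fun t => congrArg p (hΦ t)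
  rw [h2]
  exact hG'g.symm.trans h1

/-- A lift on the sphere need not take the pole to `ι f₀`. A path in the fibre corrects this, at the
price of a null-homotopy in which the base point moves. -/
theorem LocTransport.nullIn_bottom_of_liftsTo (hp : LocTransport p) (hι : IsFibreIncl p ι b₀)
    [PathConnectedSpace F] {f₀ : F} {f : C(USphere (k + 2), B)} (hf : f (pole (k + 1)) = b₀)
    (h : LiftsTo p f) {G : C(I^(Fin (k + 1)), E)} (hpG : ∀ t, p (G t) = f (collapse (k + 1) t))
    (hGb : ∀ t, IsOpenBox t → G t = ι f₀) {c : (I^(Fin k)) → F}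
    (hc : ∀ s, G (Fin.cons 0 s) = ι (c s)) : NullIn Set.univ c := by
  obtain ⟨Φ, hΦ⟩ := h
  obtain ⟨f₁, hf₁⟩ := hι.exists_eq (Φ (pole (k + 1))) ((hΦ _).trans hf)
  refine hp.nullIn_bottom hι (g := fun t => f (collapse (k + 1) t)) (by fun_prop) (fun t ht => ?_)
    G.continuous (Φ.comp (collapse (k + 1))).continuous hpG (fun t => hΦ _)
    (PathConnectedSpace.joined f₀ f₁) hGb (fun t ht => ?_) hc
  · rw [collapse_of_mem_boundary _ _ ht, hf]
  · rw [ContinuousMap.comp_apply, collapse_of_mem_boundary _ _ ht, hf₁]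

theorem LocTransport.exists_boundaryRel_sphere (hp : LocTransport p) (hι : IsFibreIncl p ι b₀)
    (f₀ : F) {f : C(USphere (k + 2), B)} (hf : f (pole (k + 1)) = b₀) :
    ∃ (G : C(I^(Fin (k + 1)), E)) (c : Ω^ (Fin k) F f₀),
      (∀ t, p (G t) = f (collapse (k + 1) t)) ∧ (∀ t, IsOpenBox t → G t = ι f₀) ∧
      (∀ s, G (Fin.cons 0 s) = ι (c s)) ∧
      BoundaryRel ι p k f₀ b₀ (sphereClass (k + 1) f hf) (Quotient.mk _ c) := by
  obtain ⟨G, c, h1, h2, h3⟩ := hp.exists_boundaryRel hι f₀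
    (⟨f.comp (collapse (k + 1)), fun t ht =>
      (congrArg f (collapse_of_mem_boundary _ t ht)).trans hf⟩ : Ω^ (Fin (k + 1)) B b₀)
  exact ⟨G, c, h1, h2, h3, ⟨_, c, G, rfl, rfl, h1, h2, h3⟩⟩

theorem subsingleton_homotopyGroup_zero [PathConnectedSpace F] (f₀ : F) :
    Subsingleton (π_ 0 F f₀) := by
  have : Subsingleton (ZerothHomotopy F) := ⟨fun a b => by
    induction a using Quotient.inductionOn
    induction b using Quotient.inductionOn
    exact Quotient.sound (PathConnectedSpace.joined _ _)⟩
  exact (HomotopyGroup.pi0EquivZerothHomotopy (X := F) (x := f₀)).subsingleton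

theorem mk_eq_zeroClass_of_nullIn [PathConnectedSpace F] {f₀ : F} {c : Ω^ (Fin k) F f₀}
    (hc : NullIn Set.univ c) : (Quotient.mk _ c : π_ k F f₀) = zeroClass k f₀ := by
  cases k with
  | zero => exact (subsingleton_homotopyGroup_zero f₀).elim _ _
  | succ k => exact (mk_eq_zeroClass_iff c).2 hc

theorem nullIn_of_mk_eq_zeroClass {f₀ : F} {c : Ω^ (Fin k) F f₀}
    (hc : (Quotient.mk _ c : π_ k F f₀) = zeroClass k f₀) : NullIn Set.univ c := by
  obtain ⟨H, hH, h0, h1, hS⟩ := ContinuousMap.HomotopicRel.exists_continuous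
    (mk_eq_mk_iff.1 hc : GenLoop.Homotopic c GenLoop.const)
  exact ⟨H, hH, h0, fun _ => trivial, ⟨fun _ => f₀, fun s t ht => (hS s t ht).trans (c.2 t ht)⟩,
    f₀, h1⟩

/-- A map of a sphere can be lifted if and only if the boundary of its class is trivial. -/
theorem LocTransport.liftsTo_iff (hp : LocTransport p) (hpc : Continuous p)
    (hι : IsFibreIncl p ι b₀) [PathConnectedSpace F] {f₀ : F} {f : C(USphere (k + 2), B)}
    (hf : f (pole (k + 1)) = b₀) {β : π_ k F f₀}
    (h : BoundaryRel ι p k f₀ b₀ (sphereClass (k + 1) f hf) β) :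
    LiftsTo p f ↔ β = zeroClass k f₀ := by
  constructor
  · intro hl
    obtain ⟨G, c, h1, h2, h3, h4⟩ := hp.exists_boundaryRel_sphere hι f₀ hf
    rw [(hp.existsUnique_boundaryRel hι f₀ _).unique h h4]
    exact mk_eq_zeroClass_of_nullIn (hp.nullIn_bottom_of_liftsTo hι hf hl h1 h2 h3)
  · rintro rfl
    exact hp.liftsTo_of_boundaryRel_zero hpc hι hf h

/-- A map of a sphere can be lifted if and only if the bottom face of a lift to the cube is
null-homotopic. -/
theorem LocTransport.liftsTo_iff_nullIn (hp : LocTransport p) (hpc : Continuous p)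
    (hι : IsFibreIncl p ι b₀) [PathConnectedSpace F] {f₀ : F} {f : C(USphere (k + 2), B)}
    (hf : f (pole (k + 1)) = b₀) {G : C(I^(Fin (k + 1)), E)} {c : Ω^ (Fin k) F f₀}
    (hpG : ∀ t, p (G t) = f (collapse (k + 1) t))
    (hGb : ∀ t, IsOpenBox t → G t = ι f₀) (hc : ∀ s, G (Fin.cons 0 s) = ι (c s)) :
    LiftsTo p f ↔ NullIn Set.univ c := by
  have h : BoundaryRel ι p k f₀ b₀ (sphereClass (k + 1) f hf) (Quotient.mk _ c) :=
    ⟨⟨f.comp (collapse (k + 1)), fun t ht =>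
      (congrArg f (collapse_of_mem_boundary _ t ht)).trans hf⟩, c, G, rfl, rfl, hpG, hGb, hc⟩
  rw [hp.liftsTo_iff hpc hι hf h]
  exact ⟨nullIn_of_mk_eq_zeroClass, mk_eq_zeroClass_of_nullIn⟩

end Lifting

/-! ### Looseness and lifts -/

section LooseLifts

variable {V N X : Type*} [NormedAddCommGroup V] [NormedSpace ℝ V] [FiniteDimensional ℝ V]
  [TopologicalSpace N] [T2Space N] [TopologicalSpace X] [CompactSpace X] [T2Space X]

/-- A coincidence free pair `(f₁, f₂)` is a lift of `f₁`, and homotopy lifting turns it into a lift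
of any map homotopic to `f₁`. Conversely, the second component of a lift of `f` is a map without
coincidences with `f`. -/
theorem not_coincidenceProducing_iff_liftsTo (hN : LocEuclidean V N) (f : C(X, N)) :
    ¬ CoincidenceProducing f ↔ LiftsTo (fun z : DistinctPairs N => z.1.1) f := by
  unfold CoincidenceProducing Loose
  push Not
  constructor
  · rintro ⟨f', f₁, f₂, h1, -, h12⟩
    refine (locTransport_distinctPairs hN).liftsTo_of_homotopic h1.symm ?_
    exact ⟨⟨fun x => ⟨(f₁ x, f₂ x), h12 x⟩, by fun_prop⟩, fun x => rfl⟩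
  · rintro ⟨G, hG⟩
    refine ⟨⟨fun x => (G x).1.2, by fun_prop⟩, f, _, .refl _, .refl _, fun x => ?_⟩
    have := (G x).2
    exact fun h => this ((hG x).trans h)

end LooseLifts

section SmallDeformation

variable {n : ℕ} {N X : Type*} [TopologicalSpace N] [ChartedSpace (EuclideanSpace ℝ (Fin n)) N]
  [IsManifold (𝓡 n) ∞ N] [T2Space N] {ρ : SmoothPartitionOfUnity N (𝓡 n) N}
  [TopologicalSpace X] [CompactSpace X] {g : RMetric n N}

/-- Move the base points of unit vectors a little in the direction of the vectors. -/
theorem exists_exp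
    (hρ : ρ.IsSubordinate fun i => (chartAt (EuclideanSpace ℝ (Fin n)) i).source)
    (G : C(X, UnitTangent g)) : ∃ (Ψ : I × X → N) (s₀ : ℝ), 0 < s₀ ∧ Continuous Ψ ∧
      (∀ x, Ψ (0, x) = (G x).1.proj) ∧
      (∀ s x, diffMap ρ ((G x).1.proj, Ψ (s, x)) = scale (s * s₀) (G x).1) ∧
      (∀ s x x', G x = G x' → Ψ (s, x) = Ψ (s, x')) ∧
      ∀ s x, s ≠ 0 → Ψ (s, x) ≠ (G x).1.proj := by
  obtain ⟨E, s₀, hs₀, hEc, hE0, hE⟩ := exists_expMap hρ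
    (isCompact_range (continuous_subtype_val.comp G.continuous))
  have hmem : ∀ s : I, (s * s₀ : ℝ) ∈ Set.Icc 0 s₀ := fun s =>
    ⟨mul_nonneg s.2.1 hs₀.le, mul_le_of_le_one_left hs₀.le s.2.2⟩
  have hE' : ∀ (s : I) x, diffMap ρ ((G x).1.proj, E (scale (s * s₀) (G x).1)) =
      scale (s * s₀) (G x).1 := fun s x => hE _ (hmem s) _ ⟨x, rfl⟩
  refine ⟨fun z => E (scale (z.1 * s₀) (G z.2).1), s₀, hs₀, ?_, fun x => ?_, hE', ?_, ?_⟩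
  · exact hEc.comp_continuous (f := fun z : I × X => ((z.1 * s₀ : ℝ), (G z.2).1)) (by fun_prop)
      fun z => ⟨hmem z.1, z.2, rfl⟩
  · have := hE0 _ ⟨x, rfl⟩
    simpa using this
  · intro s x x' h
    simp only [h]
  · intro s x hs h
    have h1 := hE' s x
    dsimp only at h
    rw [h] at h1
    have h2 : (scale (s * s₀) (G x).1).snd = 0 := by
      rw [← h1]
      exact diffVec_self ρ _
    have h3 : (s * s₀ : ℝ) ≠ 0 := mul_ne_zero (fun h => hs (Subtype.ext h)) hs₀.ne'
    exact (smul_eq_zero.1 (h2 : (s * s₀ : ℝ) • (G x).1.snd = 0)).elim h3 (G x).snd_ne_zero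

omit [ChartedSpace (EuclideanSpace ℝ (Fin n)) N] [IsManifold (𝓡 n) ∞ N] [T2Space N]
  [CompactSpace X] in
theorem continuous_dist_of_eq {t : TopologicalSpace N} (d : MetricSpace N)
    (hd : d.toPseudoMetricSpace.toUniformSpace.toTopologicalSpace = t) :
    Continuous fun z : N × N => d.dist z.1 z.2 := by
  subst hd
  exact continuous_dist

/-- Move `f x` for a short time in the direction of the unit vector over it. Compactness of `X`
yields one positive time for which the displacement stays below `ε` everywhere. -/
theorem looseBySmallDeformation_of_liftsTo
    (hρ : ρ.IsSubordinate fun i => (chartAt (EuclideanSpace ℝ (Fin n)) i).source) {f : C(X, N)}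
    (h : LiftsTo (fun v : UnitTangent g => v.1.proj) f) : LooseBySmallDeformation f := by
  obtain ⟨G, hG⟩ := h
  obtain ⟨Ψ, -, -, hΨ, h0, -, -, hne⟩ := exists_exp hρ G
  intro d hd ε hε
  have hc : Continuous fun z : I × X => d.dist (Ψ z) (f z.2) :=
    (continuous_dist_of_eq d hd).comp (hΨ.prodMk (f.continuous.comp continuous_snd))
  obtain ⟨u, v, hu, hv, h0u, hXv, huv⟩ := generalized_tube_lemma
    (isCompact_singleton (x := (0 : I))) (isCompact_univ (X := X))
    (hc.isOpen_preimage _ isOpen_Iio : IsOpen ((fun z : I × X => d.dist (Ψ z) (f z.2)) ⁻¹' Set.Iio ε)) (by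
      rintro ⟨s, x⟩ ⟨hs, -⟩
      obtain rfl : s = 0 := hs
      have h1 : Ψ (0, x) = f x := (h0 x).trans (hG x)
      rw [Set.mem_preimage, h1]
      simpa using hε)
  obtain ⟨δ, hδ, hδu⟩ := Metric.isOpen_iff.1 hu 0 (h0u rfl)
  set s : I := ⟨min 1 (δ / 2), by positivity, min_le_left _ _⟩ with hs
  have hs0 : s ≠ 0 := fun h => by
    have h1 := congrArg Subtype.val h
    have h2 : (0 : ℝ) < min 1 (δ / 2) := by positivity
    exact h2.ne' h1
  have hsu : s ∈ u := hδu (by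
    rw [Metric.mem_ball, Subtype.dist_eq, Real.dist_eq]
    have h2 : (0 : ℝ) < min 1 (δ / 2) := by positivity
    have : |min 1 (δ / 2) - 0| < δ := by
      rw [sub_zero, abs_of_pos h2]
      linarith [min_le_right 1 (δ / 2)]
    exact this)
  refine ⟨fun x => Ψ (s, x), by fun_prop, fun x => ⟨?_, ?_⟩⟩
  · exact huv (a := (s, x)) ⟨hsu, hXv trivial⟩
  · rw [← hG]
    exact hne s x hs0

theorem loose_of_liftsTo
    (hρ : ρ.IsSubordinate fun i => (chartAt (EuclideanSpace ℝ (Fin n)) i).source) {f : C(X, N)}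
    (h : LiftsTo (fun v : UnitTangent g => v.1.proj) f) : Loose f f := by
  obtain ⟨G, hG⟩ := h
  obtain ⟨Ψ, -, -, hΨ, h0, -, -, hne⟩ := exists_exp hρ G
  refine ⟨f, ⟨fun x => Ψ (1, x), by fun_prop⟩, .refl _,
    homotopic_of_continuous Ψ hΨ (fun x => (h0 x).trans (hG x)) fun x => rfl, fun x => ?_⟩
  rw [← hG]
  exact (hne 1 x one_ne_zero).symm

/-- A single metric is enough. If `f'` is close to `f`, the pairs `(f x, f' x)` lie where `diffMap`
is injective, so the difference vector vanishes only at coincidences. Normalizing it gives the lift.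
-/
theorem liftsTo_of_looseBySmallDeformation [SecondCountableTopology N]
    (hρ : ρ.IsSubordinate fun i => (chartAt (EuclideanSpace ℝ (Fin n)) i).source) {f : C(X, N)}
    (h : LooseBySmallDeformation f) : LiftsTo (fun v : UnitTangent g => v.1.proj) f := by
  have : LocallyCompactSpace N := ChartedSpace.locallyCompactSpace (EuclideanSpace ℝ (Fin n)) N
  obtain ⟨W, hWo, hKW, hinj, hloc⟩ := exists_injOn_diffMap hρ (isCompact_range f.continuous)
  let d : MetricSpace N := TopologicalSpace.metrizableSpaceMetric N
  obtain ⟨δ, hδ, hδW⟩ := ((isCompact_range f.continuous).image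
    (by fun_prop : Continuous fun x : N => (x, x))).exists_thickening_subset_open hWo (by
      rintro _ ⟨x, hx, rfl⟩
      exact hKW x hx)
  obtain ⟨f', hf', hff'⟩ := h d rfl δ hδ
  have hW : ∀ x, (f x, f' x) ∈ W := fun x => hδW (by
    rw [Metric.mem_thickening_iff]
    refine ⟨(f x, f x), ⟨f x, ⟨x, rfl⟩, rfl⟩, ?_⟩
    rw [Prod.dist_eq, dist_self, max_eq_right dist_nonneg]
    exact (hff' x).1)
  have hne : ∀ x, (diffMap ρ (f x, f' x)).snd ≠ 0 := fun x h0 => by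
    refine (hff' x).2 ?_
    have h1 : diffMap ρ (f x, f' x) = diffMap ρ (f x, f x) :=
      Bundle.TotalSpace.ext rfl (heq_of_eq (h0.trans (diffVec_self ρ (f x)).symm))
    exact congrArg Prod.snd (hinj (hW x) (hKW _ ⟨x, rfl⟩) h1)
  refine ⟨⟨fun x => unitize g ⟨diffMap ρ (f x, f' x), hne x⟩, (continuous_unitize g).comp
    (Continuous.subtype_mk ?_ _)⟩, fun x => rfl⟩
  exact hloc.continuousOn.comp_continuous (by fun_prop) hW

theorem exists_isSubordinate_chartAt [SecondCountableTopology N] :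
    ∃ ρ : SmoothPartitionOfUnity N (𝓡 n) N,
      ρ.IsSubordinate fun i => (chartAt (EuclideanSpace ℝ (Fin n)) i).source := by
  have : LocallyCompactSpace N := ChartedSpace.locallyCompactSpace (EuclideanSpace ℝ (Fin n)) N
  exact SmoothPartitionOfUnity.exists_isSubordinate_chartAt_source (𝓡 n) N

end SmallDeformation

/-! ### Matrices with positive determinant can be joined to the identity -/

section PositiveDet

variable {ι : Type*} [Fintype ι] [DecidableEq ι]

/-- The set of invertible real matrices. -/
def invMat (ι : Type*) [Fintype ι] [DecidableEq ι] : Set (Matrix ι ι ℝ) := {M | M.det ≠ 0}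

theorem _root_.JoinedIn.matrix_mul {A A' B B' : Matrix ι ι ℝ} (h : JoinedIn (invMat ι) A A')
    (h' : JoinedIn (invMat ι) B B') : JoinedIn (invMat ι) (A * B) (A' * B') := by
  obtain ⟨γ, hγ⟩ := h
  obtain ⟨γ', hγ'⟩ := h'
  refine ⟨⟨⟨fun s => γ s * γ' s, by fun_prop⟩, by simp, by simp⟩, fun s => ?_⟩
  change (γ s * γ' s).det ≠ 0
  rw [Matrix.det_mul]
  exact mul_ne_zero (hγ s) (hγ' s)

/-- The diagonal matrix with entries `-1` at `T`, and `1` elsewhere. -/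
def signMat (T : Finset ι) : Matrix ι ι ℝ := Matrix.diagonal fun i => if i ∈ T then -1 else 1

theorem signMat_insert {T : Finset ι} {i : ι} (hi : i ∉ T) :
    signMat (insert i T) = signMat {i} * signMat T := by
  unfold signMat
  rw [Matrix.diagonal_mul_diagonal]
  congr 1
  funext j
  by_cases hj : j = i
  · subst hj; simp [hi]
  · simp [hj]

theorem signMat_det (T : Finset ι) : (signMat T).det = (-1) ^ T.card := by
  simp [signMat, Matrix.det_diagonal]

theorem signMat_mem (T : Finset ι) : signMat T ∈ invMat ι := by
  change (signMat T).det ≠ 0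
  rw [signMat_det]
  exact pow_ne_zero _ (by norm_num)

/-- Rotate the vector `v` from `e_i` to `e_j` along the segment and take the reflections `1 - 2 v vᵀ
/ |v|²`, which all have determinant `-1`. -/
theorem joinedIn_signMat_singleton (i j : ι) :
    JoinedIn (invMat ι) (signMat {i}) (signMat {j}) := by
  by_cases hij : i = j
  · subst hij
    exact JoinedIn.refl (signMat_mem _)
  set v : ℝ → ι → ℝ := fun s => (1 - s) • Pi.single i 1 + s • Pi.single j 1 with hv
  have hvc : Continuous v := by fun_prop
  set q : ℝ → ℝ := fun s => (1 - s) ^ 2 + s ^ 2 with hq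
  have hqpos : ∀ s, 0 < q s := fun s => by simp only [hq]; nlinarith [sq_nonneg (2 * s - 1)]
  have hvv : ∀ s, v s ⬝ᵥ v s = q s := by
    intro s
    simp only [hv, hq, dotProduct_add, dotProduct_smul, dotProduct_single, Pi.add_apply,
      Pi.smul_apply, Pi.single_eq_same, Pi.single_eq_of_ne hij, Pi.single_eq_of_ne (Ne.symm hij),
      smul_eq_mul]
    ring
  set M : ℝ → Matrix ι ι ℝ := fun s => 1 + Matrix.replicateCol Unit ((-2 / q s) • v s) *
    Matrix.replicateRow Unit (v s) with hM
  have hentry : ∀ s a b, M s a b = (1 : Matrix ι ι ℝ) a b + -2 / q s * v s a * v s b := by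
    intro s a b
    simp [hM, Matrix.mul_apply, mul_assoc]
  have hMc : Continuous M := by
    refine continuous_matrix fun a b => ?_
    simp only [hentry]
    have : Continuous q := by fun_prop
    have h2 : Continuous fun s => -2 / q s := continuous_const.div this fun s => (hqpos s).ne'
    fun_prop
  refine JoinedIn.ofLine (f := M) hMc.continuousOn ?_ ?_ ?_
  · ext a b
    rw [hentry]
    simp only [signMat, hv, hq]
    by_cases ha : a = i <;> by_cases hb : b = i <;> by_cases hab : a = b <;>
      simp_all [Matrix.diagonal, Matrix.one_apply, Pi.single_apply] <;> norm_num
  · ext a b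
    rw [hentry]
    simp only [signMat, hv, hq]
    by_cases ha : a = j <;> by_cases hb : b = j <;> by_cases hab : a = b <;>
      simp_all [Matrix.diagonal, Matrix.one_apply, Pi.single_apply] <;> norm_num
  · rintro _ ⟨s, -, rfl⟩
    change (M s).det ≠ 0
    simp only [hM]
    rw [Matrix.det_one_add_replicateCol_mul_replicateRow, dotProduct_smul, hvv, smul_eq_mul,
      div_mul_cancel₀ _ (hqpos s).ne']
    norm_num

/-- An invertible matrix is a product of transvections and a diagonal matrix. A transvection shrinks
to `1` with determinant `1`; a diagonal matrix is deformed to its signs, which are products of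
reflections, each joined to the one at `i`. -/
theorem exists_joinedIn_signMat {M : Matrix ι ι ℝ} (hM : M ∈ invMat ι) (i : ι) :
    ∃ m : ℕ, JoinedIn (invMat ι) M (signMat {i} ^ m) := by
  refine Matrix.diagonal_transvection_induction_of_det_ne_zero
    (fun M => ∃ m : ℕ, JoinedIn (invMat ι) M (signMat {i} ^ m)) M hM ?_ ?_ ?_
  · intro D hD
    rw [Matrix.det_diagonal, Finset.prod_ne_zero_iff] at hD
    set T : Finset ι := Finset.univ.filter fun j => D j < 0 with hT
    have h1 : JoinedIn (invMat ι) (Matrix.diagonal D) (signMat T) := by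
      refine JoinedIn.ofLine (f := fun s => Matrix.diagonal fun j =>
        (1 - s) * D j + s * if j ∈ T then -1 else 1) ?_ ?_ ?_ ?_
      · exact Continuous.continuousOn (by fun_prop)
      · simp
      · simp [signMat]
      · rintro _ ⟨s, ⟨hs0, hs1⟩, rfl⟩
        change Matrix.det _ ≠ 0
        rw [Matrix.det_diagonal, Finset.prod_ne_zero_iff]
        intro j _
        rcases lt_or_gt_of_ne (hD j (Finset.mem_univ j)) with h | h
        · have hj : j ∈ T := by simp [hT, h]
          rw [if_pos hj]
          by_cases hs : s = 0
          · subst hs; simpa using h.ne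
          · have : 0 < s := lt_of_le_of_ne hs0 (Ne.symm hs)
            nlinarith
        · have hj : j ∉ T := by simp [hT, h.le]
          rw [if_neg hj]
          by_cases hs : s = 0
          · subst hs; simpa using h.ne'
          · have : 0 < s := lt_of_le_of_ne hs0 (Ne.symm hs)
            nlinarith
    have h2 : ∀ S : Finset ι, JoinedIn (invMat ι) (signMat S) (signMat {i} ^ S.card) := by
      intro S
      induction S using Finset.induction_on with
      | empty =>
        have : signMat (∅ : Finset ι) = 1 := by simp [signMat]
        rw [Finset.card_empty, pow_zero, this]
        exact JoinedIn.refl (by simp [invMat])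
      | insert j S hj ih =>
        rw [Finset.card_insert_of_notMem hj, signMat_insert hj, pow_succ']
        exact (joinedIn_signMat_singleton j i).matrix_mul ih
    exact ⟨_, h1.trans (h2 T)⟩
  · intro t
    refine ⟨0, ?_⟩
    rw [pow_zero]
    refine JoinedIn.ofLine (f := fun s => Matrix.transvection t.i t.j ((1 - s) * t.c)) ?_ ?_ ?_ ?_
    · refine Continuous.continuousOn (continuous_matrix fun a b => ?_)
      simp only [Matrix.transvection, Matrix.add_apply, Matrix.single_apply]
      split_ifs <;> fun_prop
    · simp [Matrix.TransvectionStruct.toMatrix]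
    · simp [Matrix.transvection]
    · rintro _ ⟨s, -, rfl⟩
      change Matrix.det _ ≠ 0
      rw [Matrix.det_transvection_of_ne _ _ t.hij]
      exact one_ne_zero
  · rintro A B - - ⟨m, hm⟩ ⟨m', hm'⟩
    exact ⟨m + m', by rw [pow_add]; exact hm.matrix_mul hm'⟩

/-- An even power of the reflection is `1`. An odd power has determinant `-1`, and a path to it from
`M` would contain a matrix of determinant `0`. -/
theorem joinedIn_one_of_det_pos {M : Matrix ι ι ℝ} (hM : 0 < M.det) :
    JoinedIn (invMat ι) M 1 := by
  rcases isEmpty_or_nonempty ι with hι | ⟨⟨i⟩⟩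
  · rw [Subsingleton.elim M 1]
    exact JoinedIn.refl (by simp [invMat])
  obtain ⟨m, hm⟩ := exists_joinedIn_signMat (show M ∈ invMat ι from hM.ne') i
  have hsq : signMat {i} * signMat {i} = (1 : Matrix ι ι ℝ) := by
    rw [signMat, Matrix.diagonal_mul_diagonal, ← Matrix.diagonal_one]
    congr 1
    funext j
    split_ifs <;> simp
  rcases Nat.even_or_odd' m with ⟨r, rfl | rfl⟩
  · rwa [pow_mul, pow_two, hsq, one_pow] at hm
  · exfalso
    obtain ⟨γ, hγ⟩ := hm
    have hc : Continuous fun s => (γ s).det := by fun_prop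
    have := mem_range_of_exists_le_of_exists_ge (c := 0) hc ⟨1, by
      rw [γ.target, Matrix.det_pow, signMat_det]
      simp [pow_succ, pow_mul]⟩ ⟨0, by rw [γ.source]; exact hM.le⟩
    obtain ⟨s, hs⟩ := this
    exact hγ s hs

open Matrix in
/-- An automorphism of positive determinant can be joined to the identity. -/
theorem exists_path_of_det_pos {n : ℕ}
    (A : EuclideanSpace ℝ (Fin n) →L[ℝ] EuclideanSpace ℝ (Fin n)) (hA : 0 < A.det) :
    ∃ γ : I × EuclideanSpace ℝ (Fin n) → EuclideanSpace ℝ (Fin n), Continuous γ ∧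
      (∀ v, γ (0, v) = A v) ∧ (∀ v, γ (1, v) = v) ∧ ∀ s v, v ≠ 0 → γ (s, v) ≠ 0 := by
  set b := (EuclideanSpace.basisFun (Fin n) ℝ).toBasis
  obtain ⟨γ, hγ⟩ := joinedIn_one_of_det_pos
    (M := LinearMap.toMatrix b b (A : EuclideanSpace ℝ (Fin n) →ₗ[ℝ] EuclideanSpace ℝ (Fin n)))
    (by rw [LinearMap.det_toMatrix]; exact hA)
  refine ⟨fun z => WithLp.toLp 2 (γ z.1 *ᵥ WithLp.ofLp z.2), ?_, fun v => ?_, fun v => ?_,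
    fun s v hv h => hv ?_⟩
  · refine (PiLp.continuous_toLp 2 _).comp (Continuous.matrix_mulVec (by fun_prop) ?_)
    exact (PiLp.continuous_ofLp 2 _).comp continuous_snd
  · simp only [γ.source]
    have := LinearMap.toMatrix_mulVec_repr b b
      (A : EuclideanSpace ℝ (Fin n) →ₗ[ℝ] EuclideanSpace ℝ (Fin n)) v
    ext i
    exact congrFun this i
  · simp
  · have h1 : γ s *ᵥ WithLp.ofLp v = 0 := congrArg WithLp.ofLp h
    have h2 := Matrix.eq_zero_of_mulVec_eq_zero (hγ s) h1
    ext i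
    exact congrFun h2 i

end PositiveDet

/-! ### Comparison of the exponential map with the inclusion of a small sphere -/

section SmallSphere

variable {n : ℕ} {N : Type*} [TopologicalSpace N] [ChartedSpace (EuclideanSpace ℝ (Fin n)) N]
  [IsManifold (𝓡 n) ∞ N] {ρ : SmoothPartitionOfUnity N (𝓡 n) N}

theorem SmoothBall.isOpenEmbedding (b : SmoothBall n N) : Topology.IsOpenEmbedding b.toFun :=
  b.isLocalDiffeomorph.isLocalHomeomorph.isOpenEmbedding_of_injective b.injective

/-- In the chart at the centre, `y ↦ diffVec ρ b.centre y` has the identity as derivative, so the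
composite with the parametrization has the same derivative as the parametrization. -/
theorem hasFDerivAt_diffVec_smoothBall
    (hρ : ρ.IsSubordinate fun i => (chartAt (EuclideanSpace ℝ (Fin n)) i).source)
    (b : SmoothBall n N) :
    HasFDerivAt (fun w => diffVec ρ b.centre (b.toFun w))
      (mfderiv (𝓡 n) (𝓡 n) b.toFun 0 : EuclideanSpace ℝ (Fin n) →L[ℝ] EuclideanSpace ℝ (Fin n))
      0 := by
  set V := EuclideanSpace ℝ (Fin n)
  set x₀ := b.centre with hx₀
  set ψ := extChartAt (𝓡 n) x₀ with hψ
  have h1 : ∀ y, diffVec ρ x₀ y = diffVecAt ρ x₀ (ψ.symm (ψ x₀)) y := fun y => by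
    have := (eventually_diffVecAt hρ x₀).self_of_nhds y
    rw [tangentCoordChange_self (mem_extChartAt_source x₀)] at this
    rw [this, ψ.left_inv (mem_extChartAt_source x₀)]
  have h2 : HasFDerivAt (fun u : V => diffVecAt ρ x₀ (ψ.symm (ψ x₀)) (ψ.symm u))
      (ContinuousLinearMap.id ℝ V) (ψ x₀) := by
    have h := HasFDerivAt.comp (ψ x₀) (f := fun u : V => (ψ x₀, u))
      (hasStrictFDerivAt_diffVecAt hρ x₀).hasFDerivAt
      (HasFDerivAt.prodMk (hasFDerivAt_const (ψ x₀) (ψ x₀)) (hasFDerivAt_id (ψ x₀)))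
    refine h.congr_fderiv (ContinuousLinearMap.ext fun v => ?_)
    exact sub_zero v
  have h3 : HasFDerivAt (fun w => ψ (b.toFun w)) (mfderiv (𝓡 n) (𝓡 n) b.toFun 0 : V →L[ℝ] V) 0 := by
    have h := ((b.isLocalDiffeomorph 0).mdifferentiableAt (by simp)).hasMFDerivAt.2
    rw [ModelWithCorners.range_eq_univ] at h
    exact hasFDerivWithinAt_univ.1 h
  have h4 := HasFDerivAt.comp (0 : V) (f := fun w => ψ (b.toFun w)) h2 h3
  refine (h4.congr_fderiv (ContinuousLinearMap.id_comp _)).congr_of_eventuallyEq ?_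
  filter_upwards [b.isOpenEmbedding.continuous.continuousAt.preimage_mem_nhds
    (extChartAt_source_mem_nhds b.centre : (extChartAt (𝓡 n) b.centre).source ∈ 𝓝 b.centre)]
    with w hw
  rw [h1, Function.comp_apply, ψ.left_inv hw]

/-- The sphere of vectors of a small length is carried by the exponential map to a sphere which can
be deformed, in the complement of the centre, into the boundary of a smooth ball. -/
theorem exists_homotopy_exp_sphereIncl
    (hρ : ρ.IsSubordinate fun i => (chartAt (EuclideanSpace ℝ (Fin n)) i).source)
    {g : RMetric n N} {b : SmoothBall n N} {φ : Frame g b.centre} (hφ : φ.Compatible)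
    {Ψ : I × USphere n → N} {s₀ : ℝ} (hs₀ : 0 < s₀) (hΨ : Continuous Ψ)
    (h0 : ∀ v, Ψ (0, v) = b.centre)
    (hd : ∀ s v, diffMap ρ (b.centre, Ψ (s, v)) = scale (s * s₀) (φ.fibreIncl v).1)
    (hne : ∀ s v, s ≠ 0 → Ψ (s, v) ≠ b.centre) :
    ∃ H : I × USphere n → N, Continuous H ∧ (∀ v, H (0, v) = Ψ (1, v)) ∧
      (∀ v, H (1, v) = b.sphereIncl v) ∧ ∀ z, H z ≠ b.centre := by
  set V := EuclideanSpace ℝ (Fin n)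
  have hb := b.isOpenEmbedding
  set P : V →L[ℝ] V := (φ.toEquiv.symm : TangentSpace (𝓡 n) b.centre →L[ℝ] V) with hP
  set A : V →L[ℝ] V := P.comp (mfderiv (𝓡 n) (𝓡 n) b.toFun 0) with hA
  have hAdet : 0 < A.det := hφ
  set A' : V ≃L[ℝ] V := A.toContinuousLinearEquivOfDetNeZero hAdet.ne' with hA'
  have hAA : ∀ w, A' w = A w := fun w => rfl
  have hder : HasFDerivAt (fun w => P (diffVec ρ b.centre (b.toFun w))) A 0 :=
    P.hasFDerivAt.comp (0 : V) (hasFDerivAt_diffVec_smoothBall hρ b)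
  -- Small enough that `A` expands every nonzero vector by more than the factor `c`; the
  -- linearization error `c * ‖w‖` is then smaller than `‖A w‖`.
  set c : ℝ := (2 * (‖(A'.symm : V →L[ℝ] V)‖ + 1))⁻¹ with hc
  have hcpos : 0 < c := by positivity
  have hAbound : ∀ w, w ≠ 0 → c * ‖w‖ < ‖A w‖ := by
    intro w hw
    have h1 : ‖w‖ ≤ ‖(A'.symm : V →L[ℝ] V)‖ * ‖A w‖ := by
      have := (A'.symm : V →L[ℝ] V).le_opNorm (A' w)
      rwa [ContinuousLinearEquiv.coe_coe, A'.symm_apply_apply] at this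
    have h2 : 0 < ‖w‖ := norm_pos_iff.2 hw
    have h3 : 0 < ‖A w‖ := norm_pos_iff.2 fun h => hw (by
      have : A' w = 0 := h
      simpa using this)
    rw [hc, inv_mul_lt_iff₀ (by positivity)]
    nlinarith [norm_nonneg (A'.symm : V →L[ℝ] V)]
  have hsmall : ∀ᶠ w in 𝓝 (0 : V), ‖P (diffVec ρ b.centre (b.toFun w)) - A w‖ ≤ c * ‖w‖ := by
    have h := hder.isLittleO.def hcpos
    have h0 : diffVec ρ b.centre (b.toFun 0) = 0 := diffVec_self ρ _
    simpa [h0] using h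
  obtain ⟨U, hU, hUo, h0U⟩ := mem_nhds_iff.1 hsmall
  -- stop in a small ball
  obtain ⟨u, v, hu, hv, h0u, hXv, huv⟩ := generalized_tube_lemma
    (isCompact_singleton (x := (0 : I))) (isCompact_univ (X := USphere n))
    ((hb.isOpenMap _ hUo).preimage hΨ) (by
      rintro ⟨s, v⟩ ⟨hs, -⟩
      obtain rfl : s = 0 := hs
      rw [Set.mem_preimage, h0]
      exact ⟨0, h0U, rfl⟩)
  obtain ⟨δ, hδ, hδu⟩ := Metric.isOpen_iff.1 hu 0 (h0u rfl)
  have hm : (0 : ℝ) < min 1 (δ / 2) := by positivity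
  set s₁ : I := ⟨min 1 (δ / 2), hm.le, min_le_left _ _⟩ with hs₁
  have hs10 : s₁ ≠ 0 := fun h => hm.ne' (congrArg Subtype.val h)
  have hs1u : s₁ ∈ u := hδu (by
    rw [Metric.mem_ball, Subtype.dist_eq, Real.dist_eq]
    have : |min 1 (δ / 2) - 0| < δ := by
      rw [sub_zero, abs_of_pos hm]
      linarith [min_le_right 1 (δ / 2)]
    exact this)
  have hUv : ∀ v, Ψ (s₁, v) ∈ b.toFun '' U := fun v => huv (a := (s₁, v)) ⟨hs1u, hXv trivial⟩
  -- coordinates of the small sphere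
  choose w hwU hw using hUv
  have hwc : Continuous w := by
    rw [hb.isEmbedding.continuous_iff]
    refine (by fun_prop : Continuous fun v => Ψ (s₁, v)).congr fun v => (hw v).symm
  have hw0 : ∀ v, w v ≠ 0 := fun v h => hne s₁ v hs10 (by rw [← hw, h]; rfl)
  set r : ℝ := s₁ * s₀ with hr
  have hrpos : 0 < r := mul_pos hm hs₀
  have hPw : ∀ v, P (diffVec ρ b.centre (b.toFun (w v))) = r • v.1 := by
    intro v
    have h1 : diffVec ρ b.centre (Ψ (s₁, v)) = r • (φ.toEquiv v.1 : V) :=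
      congrArg (fun v : TangentBundle (𝓡 n) N => (v.snd : EuclideanSpace ℝ (Fin n))) (hd s₁ v)
    rw [hw, h1]
    refine (P.map_smul r (φ.toEquiv v.1 : V)).trans ?_
    congr 1
    exact φ.toEquiv.symm_apply_apply v.1
  -- Consequently the segment from `A (w v)` to `r • v` avoids zero.
  have hest : ∀ v, ‖r • v.1 - A (w v)‖ < ‖A (w v)‖ := fun v => by
    refine lt_of_le_of_lt ?_ (hAbound _ (hw0 v))
    rw [← hPw]
    exact hU (hwU v)
  -- the homotopies
  have hbne : ∀ u : V, u ≠ 0 → b.toFun u ≠ b.centre := fun u hu h => hu (b.injective h)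
  have hsub : ∀ (v : USphere n), v.1 ≠ 0 := fun v h => by
    have h1 : ‖v.1‖ = 1 := by simp
    rw [h, norm_zero] at h1
    exact zero_ne_one h1
  let J : ∀ h : C(USphere n, V), (∀ v, h v ≠ 0) → C(USphere n, {x : N // x ≠ b.centre}) :=
    fun h hh => ⟨fun v => ⟨b.toFun (h v), hbne _ (hh v)⟩,
      Continuous.subtype_mk (hb.continuous.comp h.continuous) _⟩
  have hJ : ∀ (h h' : C(USphere n, V)) (hh : ∀ v, h v ≠ 0) (hh' : ∀ v, h' v ≠ 0)
      (L : I × USphere n → V), Continuous L → (∀ v, L (0, v) = h v) → (∀ v, L (1, v) = h' v) →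
      (∀ z, L z ≠ 0) → ContinuousMap.Homotopic (J h hh) (J h' hh') := by
    intro h h' hh hh' L hL hL0 hL1 hLne
    refine homotopic_of_continuous (fun z => ⟨b.toFun (L z), hbne _ (hLne z)⟩)
      (Continuous.subtype_mk (hb.continuous.comp hL) _) (fun v => Subtype.ext ?_)
      (fun v => Subtype.ext ?_)
    · exact congrArg b.toFun (hL0 v)
    · exact congrArg b.toFun (hL1 v)
  have hinv : ∀ x, x ≠ 0 → A'.symm x ≠ 0 := fun x hx h => hx (by simpa using h)
  have hr0 : ∀ v : USphere n, r • v.1 ≠ 0 := fun v => smul_ne_zero hrpos.ne' (hsub v)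
  let q₂ : C(USphere n, V) := ⟨fun v => A'.symm (r • v.1), by fun_prop⟩
  let q₃ : C(USphere n, V) := ⟨fun v => A'.symm v.1, by fun_prop⟩
  have hq₂ : ∀ v, q₂ v ≠ 0 := fun v => hinv _ (hr0 v)
  have hq₃ : ∀ v, q₃ v ≠ 0 := fun v => hinv _ (hsub v)
  -- Four deformations in the complement of the centre: shrink the sphere to the small time `s₁`,
  -- linearize along segments, rescale the radius from `r` to `1`, and finally use a path of
  -- automorphisms from `A` to the identity. The last one is where the compatibility of the
  -- orientations enters.
  have e1 : ContinuousMap.Homotopic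
      (⟨fun v => ⟨Ψ (1, v), hne 1 v one_ne_zero⟩, by fun_prop⟩ :
        C(USphere n, {x : N // x ≠ b.centre})) (J ⟨w, hwc⟩ hw0) := by
    have hmax : ∀ s : I, max (unitInterval.symm s) s₁ ≠ 0 := fun s h =>
      hs10 (le_antisymm ((le_max_right _ _).trans h.le) s₁.2.1)
    refine homotopic_of_continuous
      (fun z => ⟨Ψ (max (unitInterval.symm z.1) s₁, z.2), hne _ _ (hmax z.1)⟩)
      (Continuous.subtype_mk (by fun_prop) _) (fun v => Subtype.ext ?_) fun v => Subtype.ext ?_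
    · simp only [unitInterval.symm_zero, max_eq_left (show s₁ ≤ 1 from s₁.2.2)]
      rfl
    · simp only [unitInterval.symm_one, max_eq_right (show 0 ≤ s₁ from s₁.2.1)]
      exact (hw v).symm
  have e2 : ContinuousMap.Homotopic (J ⟨w, hwc⟩ hw0)
      (J q₂ hq₂) := by
    refine hJ ⟨w, hwc⟩ q₂ hw0 hq₂ (fun z => A'.symm (A (w z.2) + (z.1 : ℝ) • (r • z.2.1 - A (w z.2))))
      (by fun_prop) (fun v => ?_) (fun v => ?_) fun z => hinv _ fun h => ?_
    · simp [← hAA]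
    · simp [q₂]
    · have h1 := eq_neg_of_add_eq_zero_left h
      have h2 := hest z.2
      have h3 : ‖A (w z.2)‖ = (z.1 : ℝ) * ‖r • z.2.1 - A (w z.2)‖ := by
        conv_lhs => rw [h1]
        rw [norm_neg, norm_smul, Real.norm_of_nonneg z.1.2.1]
      rw [h3] at h2
      nlinarith [z.1.2.2, norm_nonneg (r • z.2.1 - A (w z.2))]
  have e3 : ContinuousMap.Homotopic
      (J q₂ hq₂)
      (J q₃ hq₃) := by
    refine hJ q₂ q₃ hq₂ hq₃ (fun z => A'.symm (((1 - z.1 : ℝ) * r + z.1) • z.2.1))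
      (by fun_prop) (fun v => ?_) (fun v => ?_) fun z => hinv _ (smul_ne_zero ?_ (hsub _))
    · simp [q₂]
    · simp [q₃]
    · have h1 := z.1.2.1
      have h2 := z.1.2.2
      by_cases h : (z.1 : ℝ) = 0
      · rw [h]; simpa using hrpos.ne'
      · have : 0 < (z.1 : ℝ) := lt_of_le_of_ne h1 (Ne.symm h)
        nlinarith
  have e4 : ContinuousMap.Homotopic
      (J q₃ hq₃) b.sphereIncl := by
    obtain ⟨γ, hγ, hγ0, hγ1, hγn⟩ := exists_path_of_det_pos A hAdet
    refine hJ q₃ ⟨fun v => v.1, by fun_prop⟩ hq₃ hsub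
      (fun z => A'.symm (γ (unitInterval.symm z.1, z.2.1))) (by fun_prop)
      (fun v => ?_) (fun v => ?_) fun z => hinv _ (hγn _ _ (hsub _))
    · simp [hγ1, q₃]
    · simp [hγ0, ← hAA]
  obtain ⟨H, hH, hH0, hH1⟩ := (((e1.trans e2).trans e3).trans e4).exists_continuous
  exact ⟨fun z => (H z).1, by fun_prop, fun v => congrArg Subtype.val (hH0 v),
    fun v => congrArg Subtype.val (hH1 v),
    fun z => (H z).2⟩

end SmallSphere

/-! ### The geometric conditions in terms of the boundary map -/

section Criterion

theorem rank_euclideanSpace_gt {n : ℕ} (hn : 2 ≤ n) :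
    1 < Module.rank ℝ (EuclideanSpace ℝ (Fin n)) := by
  rw [← Module.finrank_eq_rank, finrank_euclideanSpace_fin]
  exact_mod_cast hn

theorem pathConnectedSpace_sphere {n : ℕ} (hn : 2 ≤ n) : PathConnectedSpace (USphere n) :=
  isPathConnected_iff_pathConnectedSpace.1
    (isPathConnected_sphere (rank_euclideanSpace_gt hn) 0 zero_le_one)

theorem subsingleton_homotopyGroup_of_totallyDisconnected {F : Type*} [TopologicalSpace F]
    [TotallyDisconnectedSpace F] (k : ℕ) (f₀ : F) : Subsingleton (π_ (k + 1) F f₀) := by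
  have h : ∀ c : Ω^ (Fin (k + 1)) F f₀, c = GenLoop.const := fun c => by
    refine GenLoop.ext _ _ fun t => ?_
    have h1 : (Set.range c).Subsingleton :=
      (isPreconnected_range c.1.continuous).subsingleton
    have h2 : c 0 = f₀ := c.2 0 (zero_mem_boundary k)
    exact (h1 ⟨t, rfl⟩ ⟨0, rfl⟩).trans h2
  refine ⟨fun a b => ?_⟩
  induction a using Quotient.inductionOn
  induction b using Quotient.inductionOn
  exact congrArg _ ((h _).trans (h _).symm)

instance : TotallyDisconnectedSpace (USphere 1) := by
  have h : (Set.univ : Set (USphere 1)).Finite := by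
    refine Set.Finite.subset (s := {v | v.1 0 = 1 ∨ v.1 0 = -1}) ?_ ?_
    · refine Set.Finite.of_injOn (f := fun v : USphere 1 => v.1 0) (t := {1, -1}) ?_ ?_
        (Set.toFinite _)
      · rintro v (hv | hv) <;> simp [hv]
      · intro v _ w _ h
        refine Subtype.ext ?_
        ext i
        rw [Subsingleton.elim i 0]
        exact h
    · intro v _
      have h1 : ‖v.1‖ = 1 := by simp
      rw [EuclideanSpace.norm_eq, Real.sqrt_eq_one] at h1
      simp only [Fin.sum_univ_one, Real.norm_eq_abs, sq_abs] at h1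
      exact mul_self_eq_one_iff.1 ((sq _).symm.trans h1)
  have : Finite (USphere 1) := Set.finite_univ_iff.1 h
  infer_instance

variable {n : ℕ} {N : Type*} [TopologicalSpace N] [T2Space N] [SecondCountableTopology N]
  [ChartedSpace (EuclideanSpace ℝ (Fin n)) N]

theorem pathConnectedSpace_compl [ConnectedSpace N] (hn : 2 ≤ n) (b : SmoothBall n N) :
    PathConnectedSpace {x : N // x ≠ b.centre} := by
  have : LocallyPathConnectedSpace N := ChartedSpace.locallyPathConnectedSpace (EuclideanSpace ℝ (Fin n)) N
  have h1 := isPreconnected_compl_singleton (locEuclidean_of_chartedSpace (EuclideanSpace ℝ (Fin n)) N)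
    (rank_euclideanSpace_gt hn) b.centre
  have h2 : IsConnected ({b.centre}ᶜ : Set N) := by
    obtain ⟨v⟩ := (pathConnectedSpace_sphere hn).nonempty
    exact ⟨⟨_, (b.sphereIncl v).2⟩, h1⟩
  exact isPathConnected_iff_pathConnectedSpace.1
    ((isOpen_compl_singleton.isConnected_iff_isPathConnected).1 h2)

variable [IsManifold (𝓡 n) ∞ N] {g : RMetric n N} {k : ℕ}

theorem existsUnique_tangentBoundaryRel {x₀ : N} (φ : Frame g x₀) (s₀ : USphere n)
    (α : π_ (k + 1) N x₀) : ∃! β : π_ k (USphere n) s₀, TangentBoundaryRel φ s₀ k α β :=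
  (locTransport_unitTangent g).existsUnique_boundaryRel φ.isFibreIncl s₀ α

/-- For `k = 0` the convention agrees with the geometric boundary as soon as `n ≥ 2`, because the
sphere is then path-connected. The case `n = 1`, `k = 0` is excluded, since there the two could
differ a priori. -/
theorem boundary_eq {x₀ : N} {φ : Frame g x₀} {s₀ : USphere n} {α : π_ (k + 1) N x₀}
    {β : π_ k (USphere n) s₀} (h : TangentBoundaryRel φ s₀ k α β) (hnk : 2 ≤ n ∨ 1 ≤ k) :
    boundary φ s₀ k α = β := by
  cases k with
  | zero =>
    have := pathConnectedSpace_sphere (hnk.resolve_right (by omega))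
    exact (subsingleton_homotopyGroup_zero s₀).elim _ _
  | succ k =>
    have h1 : TangentBoundaryRel φ s₀ (k + 1) α (boundary φ s₀ (k + 1) α) :=
      Classical.epsilon_spec ⟨β, h⟩
    exact (existsUnique_tangentBoundaryRel φ s₀ α).unique h1 h

theorem eq_zeroClass_of_dim_one {x₀ : N} {φ : Frame g x₀} {s₀ : USphere n} (hn : n = 1) (hk : 1 ≤ k)
    (β : π_ k (USphere n) s₀) : β = zeroClass k s₀ := by
  subst hn
  obtain ⟨k, rfl⟩ := Nat.exists_eq_add_of_le' hk
  exact (subsingleton_homotopyGroup_of_totallyDisconnected k s₀).elim _ _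

theorem liftsTo_unitTangent_iff {x₀ : N} (φ : Frame g x₀) (s₀ : USphere n)
    (hnk : 2 ≤ n ∨ (n = 1 ∧ 1 ≤ k)) {f : C(USphere (k + 2), N)} (hf : f (pole (k + 1)) = x₀) :
    LiftsTo (fun v : UnitTangent g => v.1.proj) f ↔
      boundary φ s₀ k (sphereClass (k + 1) f hf) = zeroClass k s₀ := by
  obtain ⟨β, hβ, -⟩ := existsUnique_tangentBoundaryRel φ s₀ (sphereClass (k + 1) f hf)
  rw [boundary_eq hβ (hnk.imp_right And.right)]
  rcases hnk with hn | ⟨hn, hk⟩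
  · have := pathConnectedSpace_sphere hn
    exact (locTransport_unitTangent g).liftsTo_iff continuous_unitTangent_proj φ.isFibreIncl hf hβ
  · obtain rfl := eq_zeroClass_of_dim_one (φ := φ) hn hk β
    exact iff_of_true ((locTransport_unitTangent g).liftsTo_of_boundaryRel_zero
      continuous_unitTangent_proj φ.isFibreIncl hf hβ) rfl

/-- Flowing along a lift `G` of `f ∘ collapse` to unit vectors gives the lift `(f ∘ collapse, Ψ (1,
G))` to pairs of distinct points. Its bottom face is the bottom face `c` of `G` followed by the
exponential sphere `y`, and `y` is homotopic to `b.sphereIncl` in the complement of the centre. So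
the obstruction to lifting `f` to `DistinctPairs N` is `j_* ∂ [f]`. -/
theorem not_coincidenceProducing_iff_of_two_le [ConnectedSpace N] (hn : 2 ≤ n) {b : SmoothBall n N}
    {φ : Frame g b.centre} (hφ : φ.Compatible) (s₀ : USphere n) {f : C(USphere (k + 2), N)}
    (hf : f (pole (k + 1)) = b.centre) :
    ¬ CoincidenceProducing f ↔
      inducedMap k b.sphereIncl s₀ (boundary φ s₀ k (sphereClass (k + 1) f hf)) =
        zeroClass k (b.sphereIncl s₀) := by
  have hN := locEuclidean_of_chartedSpace (EuclideanSpace ℝ (Fin n)) N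
  have := pathConnectedSpace_sphere hn
  have := pathConnectedSpace_compl hn b
  rw [not_coincidenceProducing_iff_liftsTo hN]
  obtain ⟨ρ, hρ⟩ := exists_isSubordinate_chartAt (n := n) (N := N)
  obtain ⟨G, c, hpG, hGb, hGc, hrel⟩ := (locTransport_unitTangent g).exists_boundaryRel_sphere
    φ.isFibreIncl s₀ hf
  rw [boundary_eq hrel (Or.inl hn)]
  -- The cube and the fibre sphere are treated as one compact space so that the same exponential map
  -- serves both. Equal unit vectors then have equal images, which identifies the bottom face.
  set K : C((I^(Fin (k + 1))) ⊕ USphere n, UnitTangent g) :=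
    ⟨Sum.elim G φ.fibreIncl, G.continuous.sumElim φ.isFibreIncl.isEmbedding.continuous⟩ with hK
  obtain ⟨Ψ, r, hr, hΨ, h0, hd, hcongr, hne⟩ := exists_exp hρ K
  have hΨr : Continuous fun z : I × USphere n => Ψ (z.1, Sum.inr z.2) := by fun_prop
  obtain ⟨H, hH, hH0, hH1, hHne⟩ := exists_homotopy_exp_sphereIncl hρ hφ hr hΨr
    (fun v => h0 (Sum.inr v)) (fun s v => hd s (Sum.inr v)) fun s v hs => hne s (Sum.inr v) hs
  set y : C(USphere n, {x : N // x ≠ b.centre}) :=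
    ⟨fun v => ⟨Ψ (1, Sum.inr v), hne 1 (Sum.inr v) one_ne_zero⟩, by fun_prop⟩ with hy
  set G' : C(I^(Fin (k + 1)), DistinctPairs N) :=
    ⟨fun t => ⟨(f (collapse (k + 1) t), Ψ (1, Sum.inl t)), by
      rw [← hpG]
      exact (hne 1 (Sum.inl t) one_ne_zero).symm⟩, by fun_prop⟩ with hG'
  have hG'eq : ∀ t v, G t = φ.fibreIncl v → G' t = ⟨(b.centre, (y v).1), (y v).2.symm⟩ := by
    intro t v h
    refine Subtype.ext (Prod.ext ?_ ?_)
    · change f (collapse (k + 1) t) = b.centre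
      rw [← hpG, h]
      rfl
    · exact hcongr 1 (Sum.inl t) (Sum.inr v) h
  set c' : Ω^ (Fin k) {x : N // x ≠ b.centre} (y s₀) :=
    ⟨y.comp c.1, fun t ht => congrArg y (c.2 t ht)⟩ with hc'
  rw [(locTransport_distinctPairs hN).liftsTo_iff_nullIn (by fun_prop)
    (isFibreIncl_distinctPairs b.centre) hf (G := G') (c := c') (fun t => rfl)
    (fun t ht => hG'eq t s₀ (hGb t ht)) fun s => hG'eq _ _ (hGc s)]
  have hHc : ∀ s, ∀ t ∈ Cube.boundary (Fin k), (⟨H (s, c t), hHne _⟩ : {x : N // x ≠ b.centre}) =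
      ⟨H (s, s₀), hHne _⟩ := fun s t ht => by
    exact Subtype.ext (congrArg (fun v => H (s, v)) (c.2 t ht))
  have hcc : Continuous fun t => c t := c.1.continuous
  -- The homotopy between the two spheres moves the base point; `NullIn` allows for this.
  have hjc : NullIn Set.univ (fun s => b.sphereIncl (c s)) ↔ NullIn Set.univ c' := by
    constructor
    · intro h
      refine h.of_homotopy (fun z => ⟨H (z.1, c z.2), hHne _⟩) (by fun_prop)
        (fun t => Subtype.ext (hH0 _)) (fun t => Subtype.ext (hH1 _)) (fun _ => trivial)
        ⟨_, fun s t ht => hHc s t ht⟩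
    · intro h
      refine h.of_homotopy (fun z => ⟨H (unitInterval.symm z.1, c z.2), hHne _⟩) (by fun_prop)
        (fun t => Subtype.ext ?_) (fun t => Subtype.ext ?_) (fun _ => trivial)
        ⟨fun s => ⟨H (unitInterval.symm s, s₀), hHne _⟩, fun s t ht => hHc _ t ht⟩
      · simp only [unitInterval.symm_zero]
        exact hH1 _
      · simp only [unitInterval.symm_one]
        exact hH0 _
  rw [← hjc]
  exact ⟨fun h => mk_eq_zeroClass_of_nullIn (c := (⟨b.sphereIncl.comp c.1,
    fun t ht => congrArg b.sphereIncl (c.2 t ht)⟩ : Ω^ (Fin k) _ (b.sphereIncl s₀))) h,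
    fun h => nullIn_of_mk_eq_zeroClass (c := (⟨b.sphereIncl.comp c.1,
    fun t ht => congrArg b.sphereIncl (c.2 t ht)⟩ : Ω^ (Fin k) _ (b.sphereIncl s₀))) h⟩

end Criterion

/-! ### Equivalence of the three looseness conditions -/

section Equivalence

variable {n : ℕ} {N : Type*} [TopologicalSpace N] [T2Space N] [SecondCountableTopology N]
  [ChartedSpace (EuclideanSpace ℝ (Fin n)) N] [IsManifold (𝓡 n) ∞ N] {g : RMetric n N} {k : ℕ}

theorem loose_not_coincidenceProducing {X Y : Type*} [TopologicalSpace X] [TopologicalSpace Y]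
    {f : C(X, Y)} (h : Loose f f) : ¬ CoincidenceProducing f := fun hf => hf f h

theorem looseBySmallDeformation_iff_liftsTo {X : Type*} [TopologicalSpace X] [CompactSpace X]
    (g : RMetric n N) (f : C(X, N)) :
    LooseBySmallDeformation f ↔ LiftsTo (fun v : UnitTangent g => v.1.proj) f := by
  obtain ⟨ρ, hρ⟩ := exists_isSubordinate_chartAt (n := n) (N := N)
  exact ⟨liftsTo_of_looseBySmallDeformation hρ, looseBySmallDeformation_of_liftsTo hρ⟩

theorem looseBySmallDeformation_loose {X : Type*} [TopologicalSpace X] [CompactSpace X]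
    (g : RMetric n N) {f : C(X, N)} (h : LooseBySmallDeformation f) : Loose f f := by
  obtain ⟨ρ, hρ⟩ := exists_isSubordinate_chartAt (n := n) (N := N)
  exact loose_of_liftsTo hρ (liftsTo_of_looseBySmallDeformation (g := g) hρ h)

theorem inducedMap_zeroClass {X Y : Type*} [TopologicalSpace X] [TopologicalSpace Y] (j : C(X, Y))
    (x : X) : inducedMap k j x (zeroClass k x) = zeroClass k (j x) := rfl

theorem zeroClass_mem_inducedKer {X Y : Type*} [TopologicalSpace X] [TopologicalSpace Y]
    (j : C(X, Y)) (x : X) : zeroClass k x ∈ inducedKer k j x := inducedMap_zeroClass j x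

theorem boundary_zeroClass {x₀ : N} (φ : Frame g x₀) (s₀ : USphere n) :
    boundary φ s₀ k (zeroClass (k + 1) x₀) = zeroClass k s₀ := by
  cases k with
  | zero => rfl
  | succ k =>
    refine boundary_eq ?_ (Or.inr (by omega))
    exact ⟨GenLoop.const, GenLoop.const, ContinuousMap.const _ (φ.fibreIncl s₀), rfl, rfl,
      fun _ => rfl, fun _ _ => rfl, fun _ => rfl⟩

/-- The three parts of the classification which hold for all manifolds. -/
theorem boundary_criterion [ConnectedSpace N] (hn : 1 ≤ n) {b : SmoothBall n N}
    {φ : Frame g b.centre} (hφ : φ.Compatible) (s₀ : USphere n)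
    (hcircle : n = 1 → k = 0 → ∀ f : C(USphere (k + 2), N),
      LiftsTo (fun v : UnitTangent g => v.1.proj) f)
    {f : C(USphere (k + 2), N)} (hf : f (pole (k + 1)) = b.centre) :
    (LiftsTo (fun v : UnitTangent g => v.1.proj) f ↔
      boundary φ s₀ k (sphereClass (k + 1) f hf) = zeroClass k s₀) ∧
    (¬ CoincidenceProducing f ↔
      inducedMap k b.sphereIncl s₀ (boundary φ s₀ k (sphereClass (k + 1) f hf)) =
        zeroClass k (b.sphereIncl s₀)) := by
  by_cases hn2 : 2 ≤ n
  · exact ⟨liftsTo_unitTangent_iff φ s₀ (Or.inl hn2) hf,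
      not_coincidenceProducing_iff_of_two_le hn2 hφ s₀ hf⟩
  have hn1 : n = 1 := by omega
  have hβ : boundary φ s₀ k (sphereClass (k + 1) f hf) = zeroClass k s₀ := by
    rcases Nat.eq_zero_or_pos k with rfl | hk
    · rfl
    · exact eq_zeroClass_of_dim_one (φ := φ) hn1 hk _
  have hl : LiftsTo (fun v : UnitTangent g => v.1.proj) f := by
    rcases Nat.eq_zero_or_pos k with rfl | hk
    · exact hcircle hn1 rfl f
    · exact (liftsTo_unitTangent_iff φ s₀ (Or.inr ⟨hn1, hk⟩) hf).2 hβ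
  refine ⟨iff_of_true hl hβ, iff_of_true ?_ ?_⟩
  · exact loose_not_coincidenceProducing (looseBySmallDeformation_loose g
      ((looseBySmallDeformation_iff_liftsTo g f).2 hl))
  · rw [hβ]
    exact inducedMap_zeroClass _ _

/-- Both extreme conditions are lifting conditions, hence homotopy invariant, and may be tested on
pointed maps. Since every class in `π_(k+1)` comes from a pointed map, the implication from `j_* ∂
[f] = 0` to `∂ [f] = 0` for all `f` is the statement about the image and the kernel. -/
theorem looseness_equivalence [ConnectedSpace N] (hn : 1 ≤ n) {b : SmoothBall n N}
    {φ : Frame g b.centre} (hφ : φ.Compatible) (s₀ : USphere n)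
    (hcircle : n = 1 → k = 0 → ∀ f : C(USphere (k + 2), N),
      LiftsTo (fun v : UnitTangent g => v.1.proj) f) :
    (∀ f : C(USphere (k + 2), N),
        (LooseBySmallDeformation f ↔ Loose f f) ∧ (Loose f f ↔ ¬ CoincidenceProducing f)) ↔
      Set.range (boundary φ s₀ k) ∩ inducedKer k b.sphereIncl s₀ = {zeroClass k s₀} := by
  have hN := locEuclidean_of_chartedSpace (EuclideanSpace ℝ (Fin n)) N
  have : LocallyPathConnectedSpace N :=
    ChartedSpace.locallyPathConnectedSpace (EuclideanSpace ℝ (Fin n)) N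
  have : PathConnectedSpace N := pathConnectedSpace_iff_connectedSpace.2 inferInstance
  constructor
  · intro h
    refine Set.eq_singleton_iff_unique_mem.2 ⟨⟨⟨_, boundary_zeroClass φ s₀⟩,
      zeroClass_mem_inducedKer _ _⟩, ?_⟩
    rintro _ ⟨⟨α, rfl⟩, hα⟩
    induction α using Quotient.inductionOn with
    | h c =>
      obtain ⟨f, hfc⟩ := exists_sphere_map (k := k) c.1 fun t ht => c.2 t ht
      have hf : f (pole (k + 1)) = b.centre := by
        rw [← collapse_of_mem_boundary (k + 1) 0 (zero_mem_boundary k), hfc]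
        exact c.2 _ (zero_mem_boundary k)
      have hcl : sphereClass (k + 1) f hf = Quotient.mk _ c :=
        congrArg (Quotient.mk _) (GenLoop.ext _ _ hfc)
      have h1 := boundary_criterion hn hφ s₀ hcircle hf
      rw [hcl] at h1
      exact h1.1.1 ((looseBySmallDeformation_iff_liftsTo g f).1
        ((h f).1.2 ((h f).2.2 (h1.2.2 hα))))
  · intro h f
    have h1 : ¬ CoincidenceProducing f → LooseBySmallDeformation f := by
      intro hcp
      obtain ⟨f', hff', hf'⟩ := exists_homotopic_pointed f b.centre
      rw [not_coincidenceProducing_iff_liftsTo hN,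
        (locTransport_distinctPairs hN).liftsTo_iff_of_homotopic hff',
        ← not_coincidenceProducing_iff_liftsTo hN,
        (boundary_criterion hn hφ s₀ hcircle hf').2] at hcp
      rw [looseBySmallDeformation_iff_liftsTo g,
        (locTransport_unitTangent g).liftsTo_iff_of_homotopic hff',
        (boundary_criterion hn hφ s₀ hcircle hf').1]
      exact Set.eq_singleton_iff_unique_mem.1 h |>.2 _ ⟨⟨_, rfl⟩, hcp⟩
    have h2 : LooseBySmallDeformation f → Loose f f := looseBySmallDeformation_loose g
    have h3 : Loose f f → ¬ CoincidenceProducing f := loose_not_coincidenceProducing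
    exact ⟨⟨h2, fun h => h1 (h3 h)⟩, ⟨h3, fun h => h2 (h1 h)⟩⟩

/-- The kernel of the map induced by the inclusion of a small sphere is trivial if null-homotopic
maps in the complement of the centre are null-homotopic close to the centre. -/
theorem inducedKer_eq_of_dim (hnk : ¬ (k = 0 ∧ n = 1)) (hn : 1 ≤ n) {b : SmoothBall n N}
    (s₀ : USphere n)
    (h : 2 ≤ n → 1 ≤ k → ∀ c : (I^(Fin k)) → USphere n, Continuous c →
      (∃ v, ∀ t ∈ Cube.boundary (Fin k), c t = v) →
      NullIn {b.centre}ᶜ (fun t => b.toFun (c t)) → NullIn Set.univ c) :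
    inducedKer k b.sphereIncl s₀ = {zeroClass k s₀} := by
  refine Set.eq_singleton_iff_unique_mem.2 ⟨zeroClass_mem_inducedKer _ _, fun β hβ => ?_⟩
  by_cases hn2 : 2 ≤ n
  · rcases Nat.eq_zero_or_pos k with rfl | hk
    · have := pathConnectedSpace_sphere hn2
      exact (subsingleton_homotopyGroup_zero s₀).elim _ _
    · induction β using Quotient.inductionOn with
      | h c =>
        obtain ⟨k, rfl⟩ := Nat.exists_eq_add_of_le' hk
        refine (mk_eq_zeroClass_iff c).2 (h hn2 hk c c.1.continuous ⟨s₀, c.2⟩ ?_)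
        have h1 := nullIn_of_mk_eq_zeroClass (c := (⟨b.sphereIncl.comp c.1,
          fun t ht => congrArg b.sphereIncl (c.2 t ht)⟩ : Ω^ (Fin (k + 1)) _ (b.sphereIncl s₀))) hβ
        exact h1.comp continuous_subtype_val.continuousOn fun x _ => x.2
  · have : n = 1 := by omega
    subst this
    have hk : k ≠ 0 := fun h => hnk ⟨h, rfl⟩
    obtain ⟨k, rfl⟩ := Nat.exists_eq_succ_of_ne_zero hk
    exact (subsingleton_homotopyGroup_of_totallyDisconnected k s₀).elim _ _

end Equivalence

/-! ### Spaces with a local time function -/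

section LocalTime

/-- Local time functions on a one-dimensional space: locally they are coordinates, and they differ
locally by constants. -/
structure LocalTime (S ι : Type*) [TopologicalSpace S] where
  /-- the domain of a local time -/
  dom : ι → Set S
  /-- the local times -/
  time : ι → S → ℝ
  isOpen_dom : ∀ i, IsOpen (dom i)
  exists_mem_dom : ∀ v, ∃ i, v ∈ dom i
  exists_curve : ∀ i, ∀ v ∈ dom i, ∃ (c : ℝ → S) (δ : ℝ), 0 < δ ∧
    (∀ t ∈ Metric.ball (time i v) δ, ContinuousAt c t ∧ c t ∈ dom i ∧ time i (c t) = t) ∧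
    ∀ᶠ w in 𝓝 v, time i w ∈ Metric.ball (time i v) δ ∧ c (time i w) = w
  time_sub : ∀ i j, ∀ v ∈ dom i, v ∈ dom j →
    ∀ᶠ w in 𝓝 v, time j w - time i w = time j v - time i v

variable {S ι : Type*} [TopologicalSpace S] (τ : LocalTime S ι)

/-- Curves parametrized by the local time. -/
def LocalTime.IsCurveAt (c : ℝ → S) (t : ℝ) : Prop :=
  ContinuousAt c t ∧ ∃ i, c t ∈ τ.dom i ∧ ∀ᶠ s in 𝓝 t, τ.time i (c s) - s = τ.time i (c t) - t

variable {τ}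

theorem LocalTime.IsCurveAt.time_sub {c : ℝ → S} {t : ℝ} (h : τ.IsCurveAt c t) {j : ι}
    (hj : c t ∈ τ.dom j) : ∀ᶠ s in 𝓝 t, τ.time j (c s) - s = τ.time j (c t) - t := by
  obtain ⟨hc, i, hi, h⟩ := h
  filter_upwards [h, hc.eventually (τ.time_sub i j _ hi hj)] with s h1 h2
  linarith

theorem LocalTime.IsCurveAt.congr {c c' : ℝ → S} {t : ℝ} (h : τ.IsCurveAt c t)
    (hcc' : c =ᶠ[𝓝 t] c') : τ.IsCurveAt c' t := by
  obtain ⟨hc, i, hi, h⟩ := h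
  refine ⟨hc.congr hcc', i, hcc'.eq_of_nhds ▸ hi, ?_⟩
  filter_upwards [h, hcc'] with s h1 h2
  rw [← h2, ← hcc'.eq_of_nhds, h1]

/-- Near a point the local time is a coordinate, and both curves have the same local time at each
parameter. -/
theorem LocalTime.IsCurveAt.eventuallyEq {c c' : ℝ → S} {t : ℝ} (h : τ.IsCurveAt c t)
    (h' : τ.IsCurveAt c' t) (hcc' : c t = c' t) : c =ᶠ[𝓝 t] c' := by
  obtain ⟨i, hi⟩ := τ.exists_mem_dom (c t)
  obtain ⟨e, δ, -, -, he⟩ := τ.exists_curve i _ hi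
  filter_upwards [h.time_sub hi, h'.time_sub (hcc' ▸ hi), h.1.eventually he,
    h'.1.eventually (hcc' ▸ he)] with s h1 h2 h3 h4
  rw [← h3.2, ← h4.2]
  congr 1
  rw [← hcc'] at h2
  linarith

theorem LocalTime.IsCurveAt.comp_add {c : ℝ → S} {t r : ℝ} (h : τ.IsCurveAt c (t + r)) :
    τ.IsCurveAt (fun s => c (s + r)) t := by
  obtain ⟨hc, i, hi, h⟩ := h
  have h1 : Filter.Tendsto (fun s => s + r) (𝓝 t) (𝓝 (t + r)) :=
    (continuous_add_const r).continuousAt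
  refine ⟨ContinuousAt.comp (x := t) (f := fun s => s + r) hc h1, i, hi, ?_⟩
  filter_upwards [h1.eventually h] with s hs
  linarith

/-- Two curves which agree at one time agree on an interval. -/
theorem LocalTime.eqOn_of_isCurveAt [T2Space S] {c c' : ℝ → S} {J : Set ℝ} (hJ : IsPreconnected J)
    (h : ∀ t ∈ J, τ.IsCurveAt c t) (h' : ∀ t ∈ J, τ.IsCurveAt c' t) {t₀ : ℝ} (ht₀ : t₀ ∈ J)
    (h0 : c t₀ = c' t₀) : ∀ t ∈ J, c t = c' t := by
  have h1 : IsOpen {t : J | c t = c' t} := by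
    rw [isOpen_iff_mem_nhds]
    intro t ht
    exact continuousAt_subtype_val.eventually ((h t t.2).eventuallyEq (h' t t.2) ht)
  have h2 : IsClosed {t : J | c t = c' t} := by
    refine isClosed_eq ?_ ?_
    · exact continuous_iff_continuousAt.2 fun t =>
        ContinuousAt.comp (f := Subtype.val) (h t t.2).1 continuousAt_subtype_val
    · exact continuous_iff_continuousAt.2 fun t =>
        ContinuousAt.comp (f := Subtype.val) (h' t t.2).1 continuousAt_subtype_val
  have := isPreconnected_iff_preconnectedSpace.1 hJ
  have h3 := IsClopen.eq_univ ⟨h2, h1⟩ ⟨⟨t₀, ht₀⟩, h0⟩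
  intro t ht
  exact Set.eq_univ_iff_forall.1 h3 ⟨t, ht⟩

variable (τ) in
/-- The points `u` and `w` lie on a common curve. -/
def LocalTime.Related (u w : S) : Prop :=
  ∃ (c : ℝ → S) (a b s t : ℝ), (∀ r ∈ Set.Ioo a b, τ.IsCurveAt c r) ∧ s ∈ Set.Ioo a b ∧
    t ∈ Set.Ioo a b ∧ c s = u ∧ c t = w

theorem LocalTime.Related.symm {u w : S} (h : τ.Related u w) : τ.Related w u := by
  obtain ⟨c, a, b, s, t, h, hs, ht, hu, hw⟩ := h
  exact ⟨c, a, b, t, s, h, ht, hs, hw, hu⟩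

/-- Shift the second curve in time so that both pass through `v` at the same instant. By uniqueness
they agree on the common interval and glue to one curve. -/
theorem LocalTime.Related.trans [T2Space S] {u v w : S} (h : τ.Related u v) (h' : τ.Related v w) :
    τ.Related u w := by
  classical
  obtain ⟨c, a, b, s, t, h, hs, ht, hu, hv⟩ := h
  obtain ⟨c₁, a₁, b₁, t₁, r₁, h₁, ht₁, hr₁, hv₁, hw₁⟩ := h'
  -- translate the second curve
  obtain ⟨c', a', b', r, h', ht', hr, hv', hw⟩ : ∃ (c' : ℝ → S) (a' b' r : ℝ),
      (∀ r ∈ Set.Ioo a' b', τ.IsCurveAt c' r) ∧ t ∈ Set.Ioo a' b' ∧ r ∈ Set.Ioo a' b' ∧ c' t = v ∧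
      c' r = w := by
    refine ⟨fun x => c₁ (x + (t₁ - t)), a₁ - (t₁ - t), b₁ - (t₁ - t), r₁ - (t₁ - t),
      fun x hx => (h₁ _ ?_).comp_add, ?_, ?_, ?_, ?_⟩
    · exact ⟨by linarith [hx.1], by linarith [hx.2]⟩
    · exact ⟨by linarith [ht₁.1], by linarith [ht₁.2]⟩
    · exact ⟨by linarith [hr₁.1], by linarith [hr₁.2]⟩
    · simp [hv₁]
    · simp [hw₁]
  have hint : Set.Ioo a b ∩ Set.Ioo a' b' = Set.Ioo (max a a') (min b b') := Set.Ioo_inter_Ioo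
  have heq : ∀ x ∈ Set.Ioo a b, x ∈ Set.Ioo a' b' → c x = c' x := fun x hx hx' =>
    LocalTime.eqOn_of_isCurveAt (J := Set.Ioo a b ∩ Set.Ioo a' b') (by
      rw [hint]; exact isPreconnected_Ioo) (fun t ht => h t ht.1) (fun t ht => h' t ht.2)
      ⟨ht, ht'⟩ (hv.trans hv'.symm) x ⟨hx, hx'⟩
  have heq' : ∀ x ∈ Set.Ioo a' b', (if x ∈ Set.Ioo a b then c x else c' x) = c' x := fun x hx => by
    split_ifs with hxa
    · exact heq x hxa hx
    · rfl
  refine ⟨fun x => if x ∈ Set.Ioo a b then c x else c' x, min a a', max b b', s, r, ?_,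
    ⟨(min_le_left _ _).trans_lt hs.1, hs.2.trans_le (le_max_left _ _)⟩,
    ⟨(min_le_right _ _).trans_lt hr.1, hr.2.trans_le (le_max_right _ _)⟩, ?_, ?_⟩
  · intro x hx
    by_cases hxa : x ∈ Set.Ioo a b
    · refine (h x hxa).congr ?_
      filter_upwards [isOpen_Ioo.mem_nhds hxa] with y hy
      rw [if_pos hy]
    · have hxa' : x ∈ Set.Ioo a' b' := by
        rw [Set.mem_Ioo, not_and_or, not_lt, not_lt] at hxa
        rcases hxa with hxa | hxa
        · refine ⟨(min_lt_iff.1 hx.1).resolve_left (not_lt.2 hxa), ?_⟩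
          exact (hxa.trans_lt ht.1).trans ht'.2
        · refine ⟨?_, (lt_max_iff.1 hx.2).resolve_left (not_lt.2 hxa)⟩
          exact (ht'.1.trans ht.2).trans_le hxa
      refine (h' x hxa').congr ?_
      filter_upwards [isOpen_Ioo.mem_nhds hxa'] with y hy
      exact (heq' y hy).symm
  · exact (if_pos hs).trans hu
  · exact (heq' r hr).trans hw

theorem LocalTime.eventually_related (v : S) : ∀ᶠ w in 𝓝 v, τ.Related v w := by
  obtain ⟨i, hi⟩ := τ.exists_mem_dom v
  obtain ⟨c, δ, hδ, hc, hw⟩ := τ.exists_curve i v hi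
  have hv := hw.self_of_nhds
  filter_upwards [hw] with w hw
  refine ⟨c, τ.time i v - δ, τ.time i v + δ, τ.time i v, τ.time i w, fun r hr => ?_, ?_, ?_,
    hv.2, hw.2⟩
  · rw [← Real.ball_eq_Ioo] at hr
    refine ⟨(hc r hr).1, i, (hc r hr).2.1, ?_⟩
    filter_upwards [Metric.isOpen_ball.mem_nhds hr] with s hs
    rw [(hc s hs).2.2, (hc r hr).2.2]
    ring
  · rw [← Real.ball_eq_Ioo]; exact hv.1
  · rw [← Real.ball_eq_Ioo]; exact hw.1

/-- The equivalence classes of `τ.Related` are open, so a path cannot leave the class in which it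
starts. -/
theorem LocalTime.related_of_joined [T2Space S] {v w : S} (h : Joined v w) : τ.Related v w := by
  obtain ⟨γ⟩ := h
  have hrefl : ∀ x, τ.Related x x := fun x => (τ.eventually_related x).self_of_nhds
  have h1 : IsOpen {t : I | τ.Related v (γ t)} := by
    rw [isOpen_iff_mem_nhds]
    intro t ht
    filter_upwards [γ.continuous.continuousAt.eventually (τ.eventually_related (γ t))] with s hs
    exact LocalTime.Related.trans ht hs
  have h2 : IsOpen {t : I | τ.Related v (γ t)}ᶜ := by
    rw [isOpen_iff_mem_nhds]
    intro t ht
    filter_upwards [γ.continuous.continuousAt.eventually (τ.eventually_related (γ t))] with s hs h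
    exact ht (LocalTime.Related.trans h hs.symm)
  have h3 := IsClopen.eq_univ ⟨⟨h2⟩, h1⟩ ⟨0, by
    change τ.Related v (γ 0)
    rw [γ.source]
    exact hrefl v⟩
  have h4 : (1 : I) ∈ {t : I | τ.Related v (γ t)} := h3 ▸ Set.mem_univ _
  simpa using h4

/-- A fixed-point free involution which reverses the time does not join points. -/
theorem LocalTime.not_joined_involution [T2Space S] {ν : S → S} (hν : Continuous ν)
    (hνν : ∀ v, ν (ν v) = v) (hfix : ∀ v, ν v ≠ v) (hdom : ∀ i, ∀ v ∈ τ.dom i, ν v ∈ τ.dom i)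
    (htime : ∀ i, ∀ v ∈ τ.dom i, τ.time i (ν v) = - τ.time i v) (v : S) : ¬ Joined v (ν v) := by
  intro h
  obtain ⟨c, a, b, s, t, hc, hs, ht, hv, hw⟩ := τ.related_of_joined h
  -- Both `ν` and the reflection of the parameter reverse time, so `r ↦ ν (c (s + t - r))` is again
  -- a curve. It agrees with `c` at `s`, hence at the midpoint `(s + t) / 2`, where it yields a
  -- fixed point of `ν`.
  have hc' : ∀ r, s + t - r ∈ Set.Ioo a b → τ.IsCurveAt (fun r => ν (c (s + t - r))) r := by
    intro r hr
    obtain ⟨h1, i, h2, h3⟩ := hc _ hr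
    have h4 : Filter.Tendsto (fun r => s + t - r) (𝓝 r) (𝓝 (s + t - r)) :=
      (by fun_prop : Continuous fun r => s + t - r).continuousAt
    have h5 : ContinuousAt (fun r => c (s + t - r)) r :=
      ContinuousAt.comp (f := fun r => s + t - r) h1 h4
    refine ⟨hν.continuousAt.comp h5, i, hdom i _ h2, ?_⟩
    filter_upwards [h4.eventually h3, h5.eventually ((τ.isOpen_dom i).mem_nhds h2)] with x hx hx'
    rw [htime i _ h2, htime i _ hx']
    linarith
  set J := Set.Ioo a b ∩ Set.Ioo (s + t - b) (s + t - a) with hJ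
  have hmem : ∀ r ∈ J, s + t - r ∈ Set.Ioo a b := fun r hr =>
    ⟨by linarith [hr.2.2], by linarith [hr.2.1]⟩
  have hsJ : s ∈ J := ⟨hs, by linarith [ht.2], by linarith [ht.1]⟩
  have hmJ : (s + t) / 2 ∈ J := by
    obtain ⟨h1, h2⟩ := hs
    obtain ⟨h3, h4⟩ := ht
    exact ⟨⟨by linarith, by linarith⟩, by linarith, by linarith⟩
  have := LocalTime.eqOn_of_isCurveAt (τ := τ) (c := c) (c' := fun r => ν (c (s + t - r))) (J := J)
    (by rw [hJ, Set.Ioo_inter_Ioo]; exact isPreconnected_Ioo) (fun r hr => hc r hr.1)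
    (fun r hr => hc' r (hmem r hr)) hsJ (by simp [hv, hw, hνν]) _ hmJ
  have hm : s + t - (s + t) / 2 = (s + t) / 2 := by ring
  rw [hm] at this
  exact hfix _ this.symm

end LocalTime

/-! ### Arc length on manifolds of dimension one -/

section ArcLength

variable {N : Type*} [TopologicalSpace N] [ChartedSpace (EuclideanSpace ℝ (Fin 1)) N]
  [IsManifold (𝓡 1) ∞ N]

/-- The unit vector of the line. -/
def lineVec : EuclideanSpace ℝ (Fin 1) := EuclideanSpace.single 0 1

theorem coord_smul_lineVec (u : EuclideanSpace ℝ (Fin 1)) : u 0 • lineVec = u := by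
  ext i
  rw [Subsingleton.elim i 0]
  simp [lineVec]

theorem smul_lineVec_coord (y : ℝ) : (y • lineVec) 0 = y := by simp [lineVec]

/-- The chart of the tangent bundle induced by the chart around `p`. -/
def tchart (p : N) : OpenPartialHomeomorph (TangentBundle (𝓡 1) N)
    (EuclideanSpace ℝ (Fin 1) × EuclideanSpace ℝ (Fin 1)) :=
  chartAt (ModelProd (EuclideanSpace ℝ (Fin 1)) (EuclideanSpace ℝ (Fin 1)))
    (⟨p, 0⟩ : TangentBundle (𝓡 1) N)

theorem mem_tchart_source {p : N} {w : TangentBundle (𝓡 1) N} :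
    w ∈ (tchart p).source ↔ w.proj ∈ (chartAt (EuclideanSpace ℝ (Fin 1)) p).source :=
  TangentBundle.mem_chart_source_iff (H := EuclideanSpace ℝ (Fin 1)) _ _

theorem mem_tchart_target {p : N} {u : EuclideanSpace ℝ (Fin 1) × EuclideanSpace ℝ (Fin 1)} :
    u ∈ (tchart p).target ↔ u.1 ∈ (chartAt (EuclideanSpace ℝ (Fin 1)) p).target :=
  TangentBundle.mem_chart_target_iff (H := EuclideanSpace ℝ (Fin 1)) _ _

theorem tchart_fst (p : N) (w : TangentBundle (𝓡 1) N) :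
    (tchart p w).1 = chartAt (EuclideanSpace ℝ (Fin 1)) p w.proj := rfl

theorem tchart_snd (p : N) (w : TangentBundle (𝓡 1) N) :
    (tchart p w).2 = tangentCoordChange (𝓡 1) w.proj p w.proj w.snd := rfl

theorem tchart_symm_proj (p : N) (u : EuclideanSpace ℝ (Fin 1) × EuclideanSpace ℝ (Fin 1)) :
    ((tchart p).symm u).proj = (chartAt (EuclideanSpace ℝ (Fin 1)) p).symm u.1 :=
  TangentBundle.coe_chartAt_symm_fst (H := EuclideanSpace ℝ (Fin 1)) _ _

theorem tchart_scale (p : N) (s : ℝ) (w : TangentBundle (𝓡 1) N) :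
    tchart p (scale s w) = ((tchart p w).1, s • (tchart p w).2) :=
  Prod.ext rfl (map_smul (tangentCoordChange (𝓡 1) w.proj p w.proj) s w.snd)

theorem tchart_symm_smul (p : N) (s : ℝ) {u z : EuclideanSpace ℝ (Fin 1)}
    (hu : u ∈ (chartAt (EuclideanSpace ℝ (Fin 1)) p).target) :
    (tchart p).symm (u, s • z) = scale s ((tchart p).symm (u, z)) := by
  have h1 : (u, z) ∈ (tchart p).target := mem_tchart_target.2 hu
  have h2 : (u, s • z) ∈ (tchart p).target := mem_tchart_target.2 hu
  have h3 : scale s ((tchart p).symm (u, z)) ∈ (tchart p).source :=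
    mem_tchart_source.2 (mem_tchart_source.1 ((tchart p).map_target h1))
  rw [← (tchart p).left_inv h3, tchart_scale, (tchart p).right_inv h1]

theorem tchart_tchart {p q : N} {w : TangentBundle (𝓡 1) N} (hp : w ∈ (tchart p).source)
    (hq : w ∈ (tchart q).source) :
    (tchart q w).2 = tangentCoordChange (𝓡 1) p q w.proj (tchart p w).2 := by
  rw [tchart_snd, tchart_snd]
  refine (tangentCoordChange_comp ⟨⟨mem_extChartAt_source _, ?_⟩, ?_⟩).symm
  · rw [extChartAt_source]; exact mem_tchart_source.1 hp
  · rw [extChartAt_source]; exact mem_tchart_source.1 hq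

variable (g : RMetric 1 N)

/-- The square of the speed of the coordinate curve in the chart around `p`. -/
def gram (p : N) (y : ℝ) : ℝ :=
  g.inner ((tchart p).symm (y • lineVec, lineVec)).proj
    ((tchart p).symm (y • lineVec, lineVec)).snd ((tchart p).symm (y • lineVec, lineVec)).snd

variable {g}

theorem gram_pos {p : N} {y : ℝ}
    (hy : y • lineVec ∈ (chartAt (EuclideanSpace ℝ (Fin 1)) p).target) : 0 < gram g p y := by
  refine inner_self_pos g fun h => ?_
  have h1 : (y • lineVec, lineVec) ∈ (tchart p).target := mem_tchart_target.2 hy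
  have h2 : (tchart p ((tchart p).symm (y • lineVec, lineVec))).2 = 0 := by
    rw [tchart_snd, h]
    exact map_zero (tangentCoordChange (𝓡 1) _ p _)
  rw [(tchart p).right_inv h1] at h2
  have h3 : lineVec 0 = 0 := by
    rw [show lineVec = 0 from h2]; rfl
  simp [lineVec] at h3

theorem continuousOn_gram (p : N) : ContinuousOn (gram g p)
    {y | y • lineVec ∈ (chartAt (EuclideanSpace ℝ (Fin 1)) p).target} := by
  refine (continuous_inner_self g).comp_continuousOn
    ((tchart p).symm.continuousOn.comp (by fun_prop) fun y hy => ?_)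
  exact mem_tchart_target.2 hy

theorem inner_tchart_symm {p : N} {y s : ℝ}
    (hy : y • lineVec ∈ (chartAt (EuclideanSpace ℝ (Fin 1)) p).target) :
    g.inner ((tchart p).symm (y • lineVec, s • lineVec)).proj
      ((tchart p).symm (y • lineVec, s • lineVec)).snd
      ((tchart p).symm (y • lineVec, s • lineVec)).snd = s ^ 2 * gram g p y := by
  rw [tchart_symm_smul p s hy, inner_scale]
  change s * (s * gram g p y) = _
  ring

theorem tchart_symm_coord {p : N} {w : TangentBundle (𝓡 1) N} (hw : w ∈ (tchart p).source) :
    (tchart p).symm ((tchart p w).1 0 • lineVec, (tchart p w).2 0 • lineVec) = w := by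
  rw [coord_smul_lineVec, coord_smul_lineVec]
  exact (tchart p).left_inv hw

theorem coord_target {p : N} {w : TangentBundle (𝓡 1) N} (hw : w ∈ (tchart p).source) :
    (tchart p w).1 0 • lineVec ∈ (chartAt (EuclideanSpace ℝ (Fin 1)) p).target := by
  rw [coord_smul_lineVec]
  exact mem_tchart_target.1 ((tchart p).map_source hw)

theorem sq_mul_gram {p : N} (w : UnitTangent g) (hw : w.1 ∈ (tchart p).source) :
    (tchart p w.1).2 0 ^ 2 * gram g p ((tchart p w.1).1 0) = 1 := by
  rw [← inner_tchart_symm (coord_target hw), tchart_symm_coord hw]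
  exact w.2

/-- The arc length in a chart. -/
theorem exists_arcLength (p : N) : ∃ (B : Set ℝ) (a : ℝ → ℝ), IsOpen B ∧
    chartAt (EuclideanSpace ℝ (Fin 1)) p p 0 ∈ B ∧
    (∀ y ∈ B, y • lineVec ∈ (chartAt (EuclideanSpace ℝ (Fin 1)) p).target) ∧
    Topology.IsOpenEmbedding a ∧ ∀ y ∈ B, HasDerivAt a (√(gram g p y)) y := by
  set y₀ : ℝ := chartAt (EuclideanSpace ℝ (Fin 1)) p p 0 with hy₀
  have hopen : IsOpen {y : ℝ | y • lineVec ∈ (chartAt (EuclideanSpace ℝ (Fin 1)) p).target} :=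
    (chartAt (EuclideanSpace ℝ (Fin 1)) p).open_target.preimage (by fun_prop)
  have hmem : y₀ ∈ {y : ℝ | y • lineVec ∈ (chartAt (EuclideanSpace ℝ (Fin 1)) p).target} := by
    change y₀ • lineVec ∈ (chartAt (EuclideanSpace ℝ (Fin 1)) p).target
    rw [hy₀, coord_smul_lineVec]
    exact mem_chart_target _ p
  obtain ⟨r, hr, hball⟩ := Metric.nhds_basis_closedBall.mem_iff.1 (hopen.mem_nhds hmem)
  rw [Real.closedBall_eq_Icc] at hball
  have hle : y₀ - r ≤ y₀ + r := by linarith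
  -- The speed is extended by constants beyond a compact interval inside the chart, so that its
  -- primitive is defined and strictly increasing on the whole line.
  set h : ℝ → ℝ := Set.IccExtend hle (fun y => √(gram g p y)) with hh
  have hc : Continuous h := by
    refine Continuous.Icc_extend' ?_
    refine Real.continuous_sqrt.comp ?_
    exact continuousOn_iff_continuous_domRestrict.1 ((continuousOn_gram p).mono hball)
  have hpos : ∀ y, 0 < h y := fun y => Real.sqrt_pos.2 (gram_pos (hball (Set.projIcc _ _ hle y).2))
  set a : ℝ → ℝ := fun y => ∫ t in y₀..y, h t with ha
  have hder : ∀ y, HasDerivAt a (h y) y := fun y =>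
    intervalIntegral.integral_hasDerivAt_right (hc.intervalIntegrable _ _)
      (hc.stronglyMeasurableAtFilter _ _) hc.continuousAt
  have hcd : ContDiff ℝ 1 a := by
    rw [contDiff_one_iff_deriv]
    refine ⟨fun y => (hder y).differentiableAt, ?_⟩
    rw [show deriv a = h from funext fun y => (hder y).deriv]
    exact hc
  refine ⟨Metric.ball y₀ r, a, Metric.isOpen_ball, Metric.mem_ball_self hr, fun y hy => hball ?_,
    ?_, fun y hy => ?_⟩
  · rw [Real.ball_eq_Ioo] at hy
    exact Set.Ioo_subset_Icc_self hy
  · have hmono : StrictMono a := strictMono_of_deriv_pos fun y => by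
      rw [(hder y).deriv]; exact hpos y
    refine Topology.IsOpenEmbedding.of_continuous_injective_isOpenMap hcd.continuous hmono.injective ?_
    refine IsOpenMap.of_nhds_le fun y => ?_
    have hs : HasStrictDerivAt a (h y) y :=
      hcd.contDiffAt.hasStrictDerivAt' (hder y) one_ne_zero
    exact (hs.map_nhds_eq (hpos y).ne').ge
  · have := hder y
    rw [Real.ball_eq_Ioo] at hy
    rwa [hh, Set.IccExtend_of_mem hle _ (Set.Ioo_subset_Icc_self hy)] at this

end ArcLength

/-! ### Signed arc length as a local time on the unit tangent bundle of a 1-manifold -/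

section UnitTangentTime

variable {N : Type*} [TopologicalSpace N] [ChartedSpace (EuclideanSpace ℝ (Fin 1)) N]
  [IsManifold (𝓡 1) ∞ N] {g : RMetric 1 N}

/-- The opposite of a unit vector. -/
def UnitTangent.neg (v : UnitTangent g) : UnitTangent g := ⟨scale (-1) v.1, by
  rw [inner_scale, v.2]
  norm_num⟩

/-- The position of the base point of a tangent vector in the chart around `p`. -/
def pos (p : N) (w : UnitTangent g) : ℝ := (tchart p w.1).1 0

/-- The sign of a unit vector with respect to the chart around `p`. -/
def orient (p : N) (w : UnitTangent g) : ℝ := (tchart p w.1).2 0 * √(gram g p (pos p w))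

theorem orient_sq {p : N} {w : UnitTangent g} (hw : w.1 ∈ (tchart p).source) :
    orient p w ^ 2 = 1 := by
  unfold orient pos
  rw [mul_pow, Real.sq_sqrt (gram_pos (coord_target hw)).le]
  exact sq_mul_gram w hw

theorem continuousAt_pos {p : N} {w : UnitTangent g} (hw : w.1 ∈ (tchart p).source) :
    ContinuousAt (pos p) w := by
  have h1 : ContinuousAt (fun w : UnitTangent g => tchart p w.1) w :=
    ContinuousAt.comp (f := Subtype.val) ((tchart p).continuousAt hw) continuousAt_subtype_val
  have h2 : Continuous fun u : EuclideanSpace ℝ (Fin 1) × EuclideanSpace ℝ (Fin 1) => u.1 0 := by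
    fun_prop
  exact h2.continuousAt.comp h1

theorem continuousAt_orient {p : N} {w : UnitTangent g} (hw : w.1 ∈ (tchart p).source) :
    ContinuousAt (orient p) w := by
  have h1 : ContinuousAt (fun w : UnitTangent g => tchart p w.1) w :=
    ContinuousAt.comp (f := Subtype.val) ((tchart p).continuousAt hw) continuousAt_subtype_val
  have h2 : Continuous fun u : EuclideanSpace ℝ (Fin 1) × EuclideanSpace ℝ (Fin 1) => u.2 0 := by
    fun_prop
  have h3 : ContinuousAt (gram g p) (pos p w) := by
    refine (continuousOn_gram p).continuousAt (IsOpen.mem_nhds ?_ (coord_target hw))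
    exact (chartAt (EuclideanSpace ℝ (Fin 1)) p).open_target.preimage (by fun_prop)
  exact (h2.continuousAt.comp h1).mul
    (Real.continuous_sqrt.continuousAt.comp (h3.comp (continuousAt_pos hw)))

theorem eq_one_or_neg_one_of_sq {x : ℝ} (h : x ^ 2 = 1) : x = 1 ∨ x = -1 :=
  mul_self_eq_one_iff.1 ((sq x).symm.trans h)

theorem eventually_orient_eq {p : N} {w : UnitTangent g} (hw : w.1 ∈ (tchart p).source) :
    ∀ᶠ w' in 𝓝 w, w'.1 ∈ (tchart p).source ∧ orient p w' = orient p w := by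
  have h1 := (continuousAt_orient hw).eventually (Metric.ball_mem_nhds _ one_pos)
  have h2 : ∀ᶠ w' : UnitTangent g in 𝓝 w, w'.1 ∈ (tchart p).source :=
    continuousAt_subtype_val.eventually ((tchart p).open_source.mem_nhds hw)
  filter_upwards [h1, h2] with w' h1 h2
  refine ⟨h2, ?_⟩
  rw [Real.dist_eq, abs_lt] at h1
  rcases eq_one_or_neg_one_of_sq (orient_sq hw) with h3 | h3 <;>
    rcases eq_one_or_neg_one_of_sq (orient_sq h2) with h4 | h4 <;> rw [h3, h4] at h1 ⊢ <;>
    norm_num at h1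

/-- The unit vector with a given position and orientation. -/
def unitAt (v : UnitTangent g) (p : N) (ε y : ℝ) : UnitTangent g := by
  classical
  exact if h : y • lineVec ∈ (chartAt (EuclideanSpace ℝ (Fin 1)) p).target ∧ ε ^ 2 = 1 then
    ⟨(tchart p).symm (y • lineVec, (ε / √(gram g p y)) • lineVec), by
      rw [inner_tchart_symm h.1, div_pow, Real.sq_sqrt (gram_pos h.1).le,
        div_mul_cancel₀ _ (gram_pos h.1).ne', h.2]⟩
  else v

variable {v : UnitTangent g} {p : N} {ε y : ℝ}

theorem unitAt_coe (hy : y • lineVec ∈ (chartAt (EuclideanSpace ℝ (Fin 1)) p).target)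
    (hε : ε ^ 2 = 1) : (unitAt v p ε y).1 =
      (tchart p).symm (y • lineVec, (ε / √(gram g p y)) • lineVec) := by
  unfold unitAt
  rw [dif_pos ⟨hy, hε⟩]

theorem unitAt_mem_source (hy : y • lineVec ∈ (chartAt (EuclideanSpace ℝ (Fin 1)) p).target)
    (hε : ε ^ 2 = 1) : (unitAt v p ε y).1 ∈ (tchart p).source := by
  rw [unitAt_coe hy hε]
  exact (tchart p).map_target (mem_tchart_target.2 hy)

theorem tchart_unitAt (hy : y • lineVec ∈ (chartAt (EuclideanSpace ℝ (Fin 1)) p).target)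
    (hε : ε ^ 2 = 1) : tchart p (unitAt v p ε y).1 =
      (y • lineVec, (ε / √(gram g p y)) • lineVec) := by
  rw [unitAt_coe hy hε]
  exact (tchart p).right_inv (mem_tchart_target.2 hy)

theorem pos_unitAt (hy : y • lineVec ∈ (chartAt (EuclideanSpace ℝ (Fin 1)) p).target)
    (hε : ε ^ 2 = 1) : pos p (unitAt v p ε y) = y := by
  unfold pos
  rw [tchart_unitAt hy hε, smul_lineVec_coord]

theorem orient_unitAt (hy : y • lineVec ∈ (chartAt (EuclideanSpace ℝ (Fin 1)) p).target)
    (hε : ε ^ 2 = 1) : orient p (unitAt v p ε y) = ε := by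
  unfold orient
  rw [pos_unitAt hy hε, tchart_unitAt hy hε, smul_lineVec_coord,
    div_mul_cancel₀ _ (Real.sqrt_pos.2 (gram_pos hy)).ne']

theorem unitAt_pos_orient {w : UnitTangent g} (hw : w.1 ∈ (tchart p).source) :
    unitAt v p (orient p w) (pos p w) = w := by
  refine Subtype.ext ?_
  rw [unitAt_coe (y := pos p w) (coord_target hw) (orient_sq hw)]
  unfold orient pos
  rw [mul_div_cancel_right₀ _ (Real.sqrt_pos.2 (gram_pos (coord_target hw))).ne']
  exact tchart_symm_coord hw

theorem continuousAt_unitAt (hy : y • lineVec ∈ (chartAt (EuclideanSpace ℝ (Fin 1)) p).target)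
    (hε : ε ^ 2 = 1) : ContinuousAt (unitAt v p ε) y := by
  have hopen : IsOpen {y : ℝ | y • lineVec ∈ (chartAt (EuclideanSpace ℝ (Fin 1)) p).target} :=
    (chartAt (EuclideanSpace ℝ (Fin 1)) p).open_target.preimage (by fun_prop)
  refine (Topology.IsInducing.continuousAt_iff (g := Subtype.val) ⟨rfl⟩).2 ?_
  have h1 : ContinuousAt (fun y : ℝ => (tchart p).symm
      (y • lineVec, (ε / √(gram g p y)) • lineVec)) y := by
    refine ContinuousAt.comp (f := fun y : ℝ => (y • lineVec, (ε / √(gram g p y)) • lineVec))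
      ((tchart p).symm.continuousAt (mem_tchart_target.2 hy)) ?_
    refine ContinuousAt.prodMk (by fun_prop) (ContinuousAt.fun_smul ?_ continuousAt_const)
    refine continuousAt_const.div (Real.continuous_sqrt.continuousAt.comp
      ((continuousOn_gram p).continuousAt (hopen.mem_nhds hy))) ?_
    exact (Real.sqrt_pos.2 (gram_pos hy)).ne'
  refine h1.congr ?_
  filter_upwards [hopen.mem_nhds hy] with z hz
  exact (unitAt_coe hz hε).symm

/-- The relation between the positions in two charts. -/
theorem hasDerivAt_pos_unitAt {q : N}
    (hy : y • lineVec ∈ (chartAt (EuclideanSpace ℝ (Fin 1)) p).target) (hε : ε ^ 2 = 1)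
    (hq : (unitAt v p ε y).1 ∈ (tchart q).source) :
    HasDerivAt (fun y => pos q (unitAt v p ε y))
      (orient q (unitAt v p ε y) / √(gram g q (pos q (unitAt v p ε y))) *
        (√(gram g p y) / ε)) y := by
  set w := unitAt v p ε y with hw
  have hp : w.1 ∈ (tchart p).source := unitAt_mem_source hy hε
  have hopen : IsOpen {y : ℝ | y • lineVec ∈ (chartAt (EuclideanSpace ℝ (Fin 1)) p).target} :=
    (chartAt (EuclideanSpace ℝ (Fin 1)) p).open_target.preimage (by fun_prop)
  have h1 : HasFDerivWithinAt (extChartAt (𝓡 1) q ∘ (extChartAt (𝓡 1) p).symm)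
      (tangentCoordChange (𝓡 1) p q w.1.proj) (Set.range (𝓡 1)) (extChartAt (𝓡 1) p w.1.proj) := by
    refine hasFDerivWithinAt_tangentCoordChange ⟨?_, ?_⟩
    · rw [extChartAt_source]; exact mem_tchart_source.1 hp
    · rw [extChartAt_source]; exact mem_tchart_source.1 hq
  rw [ModelWithCorners.range_eq_univ] at h1
  have h2 := hasFDerivWithinAt_univ.1 h1
  have hwy : extChartAt (𝓡 1) p w.1.proj = y • lineVec :=
    congrArg Prod.fst (tchart_unitAt (v := v) hy hε)
  rw [hwy] at h2
  have h3 : HasDerivAt (fun y : ℝ => y • lineVec) lineVec y := by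
    simpa using (hasDerivAt_id y).smul_const lineVec
  have h4 := (EuclideanSpace.proj (𝕜 := ℝ) (0 : Fin 1)).hasFDerivAt.comp_hasDerivAt y
    (h2.comp_hasDerivAt y h3)
  have h5 : tangentCoordChange (𝓡 1) p q w.1.proj lineVec 0 =
      orient q w / √(gram g q (pos q w)) * (√(gram g p y) / ε) := by
    have h6 := tchart_tchart hp hq
    rw [tchart_unitAt hy hε, map_smul] at h6
    have h7 : (tchart q w.1).2 0 =
        (ε / √(gram g p y)) * tangentCoordChange (𝓡 1) p q w.1.proj lineVec 0 := by
      rw [h6]; rfl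
    have h8 : √(gram g q (pos q w)) ≠ 0 := (Real.sqrt_pos.2 (gram_pos (coord_target hq))).ne'
    have h9 := (Real.sqrt_pos.2 (gram_pos (g := g) hy)).ne'
    have h10 : ε ≠ 0 := fun h => by rw [h] at hε; norm_num at hε
    unfold orient
    rw [mul_div_cancel_right₀ _ h8, h7]
    field_simp
  rw [← h5]
  refine h4.congr_of_eventuallyEq ?_
  filter_upwards [hopen.mem_nhds hy] with z hz
  unfold pos
  rw [tchart_fst, unitAt_coe hz hε, tchart_symm_proj]
  rfl

theorem pos_neg (p : N) (w : UnitTangent g) : pos p w.neg = pos p w := by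
  unfold pos UnitTangent.neg
  rw [tchart_scale]

theorem orient_neg (p : N) (w : UnitTangent g) : orient p w.neg = - orient p w := by
  unfold orient
  rw [pos_neg]
  unfold UnitTangent.neg
  rw [tchart_scale]
  simp

/-- Arc length is a local time on the unit tangent bundle. -/
theorem exists_localTime (g : RMetric 1 N) : ∃ τ : LocalTime (UnitTangent g) N,
    (∀ i, ∀ v ∈ τ.dom i, v.neg ∈ τ.dom i) ∧
    ∀ i, ∀ v ∈ τ.dom i, τ.time i v.neg = - τ.time i v := by
  choose B a hBo hpB hB ha hder using exists_arcLength (g := g)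
  have hdom : ∀ p, IsOpen {w : UnitTangent g | w.1 ∈ (tchart p).source ∧ pos p w ∈ B p} := by
    intro p
    rw [isOpen_iff_mem_nhds]
    rintro w ⟨hw, hwB⟩
    filter_upwards [(eventually_orient_eq hw),
      (continuousAt_pos hw).eventually ((hBo p).mem_nhds hwB)] with w' h1 h2
    exact ⟨h1.1, h2⟩
  -- The sign makes the time increase when the base point moves in the direction of the vector, in
  -- every chart; passing to the opposite vector reverses it.
  refine ⟨⟨fun p => {w | w.1 ∈ (tchart p).source ∧ pos p w ∈ B p},
    fun p w => orient p w * a p (pos p w), hdom, ?_, ?_, ?_⟩, ?_, ?_⟩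
  · exact fun v => ⟨v.1.proj, mem_tchart_source.2 (mem_chart_source _ _), hpB _⟩
  · rintro p v ⟨hv, hvB⟩
    set ε := orient p v with hε'
    have hε : ε ^ 2 = 1 := orient_sq hv
    have hεε : ε * ε = 1 := by rw [← sq, hε]
    set b := (ha p).toOpenPartialHomeomorph with hb
    have hba : ∀ y, b.symm (a p y) = y := fun y => b.left_inv (by simp [hb])
    have hab : ∀ t ∈ Set.range (a p), a p (b.symm t) = t := by
      rintro _ ⟨y, rfl⟩
      rw [hba]
    have hO : IsOpen ((fun t => ε * t) ⁻¹' (a p '' B p)) :=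
      ((ha p).isOpenMap _ (hBo p)).preimage (by fun_prop)
    obtain ⟨δ, hδ, hball⟩ := Metric.isOpen_iff.1 hO (ε * a p (pos p v)) (by
      rw [Set.mem_preimage, ← mul_assoc, hεε, one_mul]
      exact ⟨_, hvB, rfl⟩)
    -- Since `ε * ε = 1`, the vector of orientation `ε` with local time `t` sits at arc length `ε *
    -- t`.
    refine ⟨fun t => unitAt v p ε (b.symm (ε * t)), δ, hδ, fun t ht => ?_, ?_⟩
    · obtain ⟨y, hy, hyt⟩ := hball ht
      have hyt' : b.symm (ε * t) = y := by
        have : a p y = ε * t := hyt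
        rw [← this, hba]
      refine ⟨?_, ⟨?_, ?_⟩, ?_⟩
      · have h1 : ContinuousAt (unitAt v p ε) (b.symm (ε * t)) := by
          rw [hyt']
          exact continuousAt_unitAt (hB p y hy) hε
        have h2 : ContinuousAt b.symm (ε * t) := by
          refine b.symm.continuousAt ?_
          rw [← show a p y = ε * t from hyt]
          simp [hb]
        have h3 : ContinuousAt (fun t => ε * t) t := by fun_prop
        exact h1.comp (f := fun t => b.symm (ε * t)) (h2.comp (f := fun t => ε * t) h3)
      · dsimp only
        rw [hyt']
        exact unitAt_mem_source (hB p y hy) hε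
      · dsimp only
        rw [hyt', pos_unitAt (hB p y hy) hε]
        exact hy
      · dsimp only
        rw [hyt', pos_unitAt (hB p y hy) hε, orient_unitAt (hB p y hy) hε,
          show a p y = ε * t from hyt, ← mul_assoc, hεε, one_mul]
    · filter_upwards [eventually_orient_eq hv, (hdom p).mem_nhds ⟨hv, hvB⟩,
        ((continuousAt_orient hv).mul ((ha p).continuous.continuousAt.comp
          (continuousAt_pos hv))).eventually (Metric.ball_mem_nhds _ hδ)] with w h1 h2 h3
      refine ⟨h3, ?_⟩
      have h5 : unitAt v p ε (pos p w) = w := by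
        rw [hε', ← h1.2]
        exact unitAt_pos_orient h1.1
      rw [h1.2, ← mul_assoc, hεε, one_mul, hba, h5]
  · rintro p q v ⟨hv, hvB⟩ ⟨hvq, hvBq⟩
    set ε := orient p v with hε'
    have hε : ε ^ 2 = 1 := orient_sq hv
    have hvu : unitAt v p ε (pos p v) = v := unitAt_pos_orient hv
    have hcont : ContinuousAt (unitAt v p ε) (pos p v) := continuousAt_unitAt (hB p _ hvB) hε
    have hev : ∀ᶠ y in 𝓝 (pos p v), y ∈ B p ∧ pos q (unitAt v p ε y) ∈ B q ∧
        (unitAt v p ε y).1 ∈ (tchart q).source ∧ orient q (unitAt v p ε y) = orient q v := by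
      have h1 : ∀ᶠ w in 𝓝 (unitAt v p ε (pos p v)), w.1 ∈ (tchart q).source ∧
          orient q w = orient q v := by
        rw [hvu]
        exact eventually_orient_eq hvq
      have h2 : ∀ᶠ w in 𝓝 (unitAt v p ε (pos p v)), w.1 ∈ (tchart q).source ∧ pos q w ∈ B q := by
        rw [hvu]
        exact (hdom q).mem_nhds ⟨hvq, hvBq⟩
      filter_upwards [(hBo p).mem_nhds hvB, hcont.eventually h1, hcont.eventually h2]
        with y hy h1 h2
      exact ⟨hy, h2.2, h1⟩
    obtain ⟨δ, hδ, hball⟩ := Metric.mem_nhds_iff.1 hev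
    -- the difference of the two times is constant
    set D : ℝ → ℝ := fun y => orient q v * a q (pos q (unitAt v p ε y)) - ε * a p y with hD
    have hDder : ∀ y ∈ Metric.ball (pos p v) δ, HasDerivAt D 0 y := by
      intro y hy
      obtain ⟨hyB, hyq, hys, hyo⟩ := hball hy
      have h1 := hasDerivAt_pos_unitAt (v := v) (hB p y hyB) hε hys
      have h2 := (hder q _ hyq).comp y h1
      refine ((h2.const_mul (orient q v)).sub ((hder p y hyB).const_mul ε)).congr_deriv ?_
      have h3 : √(gram g q (pos q (unitAt v p ε y))) ≠ 0 :=
        (Real.sqrt_pos.2 (gram_pos (coord_target hys))).ne'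
      have h4 : orient q v ^ 2 = 1 := orient_sq hvq
      have h5 : ε ≠ 0 := fun h => by rw [h] at hε; norm_num at hε
      rw [hyo]
      field_simp
      rw [h4, hε]
      ring
    have hconst : ∀ y ∈ Metric.ball (pos p v) δ, D y = D (pos p v) := by
      intro y hy
      refine (convex_ball _ _).is_const_of_fderivWithin_eq_zero (𝕜 := ℝ) (f := D)
        (fun z hz => (hDder z hz).differentiableAt.differentiableWithinAt) (fun z hz => ?_) hy
        (Metric.mem_ball_self hδ)
      rw [fderivWithin_of_isOpen Metric.isOpen_ball hz]
      have := (hDder z hz).hasFDerivAt.fderiv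
      rw [this]
      ext
      simp
    filter_upwards [eventually_orient_eq hv, eventually_orient_eq hvq,
      (continuousAt_pos hv).eventually (Metric.ball_mem_nhds _ hδ)] with w h1 h2 h3
    have h4 := hconst _ h3
    have h5 : unitAt v p ε (pos p w) = w := by
      rw [hε', ← h1.2]
      exact unitAt_pos_orient h1.1
    simp only [hD, h5, hvu] at h4
    rw [h1.2, h2.2]
    exact h4
  · rintro p v ⟨hv, hvB⟩
    refine ⟨mem_tchart_source.2 (mem_tchart_source.1 hv), ?_⟩
    rw [pos_neg]
    exact hvB
  · rintro p v -
    change orient p v.neg * a p (pos p v.neg) = - (orient p v * a p (pos p v))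
    rw [pos_neg, orient_neg]
    ring

end UnitTangentTime

theorem USphere.eq_or_eq_neg (s t : USphere 1) : t = s ∨ t = -s := by
  have h : ∀ u : USphere 1, (u.1 0) ^ 2 = 1 := fun u => by
    have h1 : ‖u.1‖ = 1 := by simp
    rw [EuclideanSpace.norm_eq, Real.sqrt_eq_one] at h1
    simpa using h1
  rcases sq_eq_sq_iff_eq_or_eq_neg.1 ((h t).trans (h s).symm) with h1 | h1
  · left
    refine Subtype.ext ?_
    ext i
    rw [Subsingleton.elim i 0, h1]
  · right
    refine Subtype.ext ?_
    ext i
    rw [Subsingleton.elim i 0, h1]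
    rfl

/-! ### Loops in 1-manifolds -/

section Circle

variable {N : Type*} [TopologicalSpace N] [ChartedSpace (EuclideanSpace ℝ (Fin 1)) N]
  [IsManifold (𝓡 1) ∞ N] {g : RMetric 1 N}

/-- On a 1-manifold, opposite unit vectors cannot be joined in the unit tangent bundle. -/
theorem UnitTangent.not_joined_neg [T2Space N] (v : UnitTangent g) : ¬ Joined v v.neg := by
  have : T2Space (TangentBundle (𝓡 1) N) := t2Space_tangentBundle
  obtain ⟨τ, h1, h2⟩ := exists_localTime g
  refine LocalTime.not_joined_involution (τ := τ) (ν := UnitTangent.neg) ?_ ?_ ?_ h1 h2 v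
  · exact Continuous.subtype_mk (continuous_scale.comp
      (continuous_const.prodMk continuous_subtype_val)) _
  · intro w
    refine Subtype.ext ?_
    change scale (-1) (scale (-1) w.1) = w.1
    rw [scale_scale]
    norm_num [scale_one]
  · intro w hw
    have h3 := orient_neg w.1.proj w
    rw [hw] at h3
    have h4 := orient_sq (p := w.1.proj) (w := w) (mem_tchart_source.2 (mem_chart_source _ _))
    have h5 : orient w.1.proj w = 0 := by linarith
    rw [h5] at h4
    norm_num at h4

/-- Loops in a 1-manifold lift to the unit tangent bundle. -/
theorem liftsTo_unitTangent_circle [T2Space N] [ConnectedSpace N] {x₀ : N} (φ : Frame g x₀)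
    (f : C(USphere 2, N)) : LiftsTo (fun v : UnitTangent g => v.1.proj) f := by
  have : LocallyPathConnectedSpace N :=
    ChartedSpace.locallyPathConnectedSpace (EuclideanSpace ℝ (Fin 1)) N
  have : PathConnectedSpace N := pathConnectedSpace_iff_connectedSpace.2 inferInstance
  have hp := locTransport_unitTangent g
  obtain ⟨f', hff', hf'⟩ := exists_homotopic_pointed (k := 0) f x₀
  refine (hp.liftsTo_iff_of_homotopic hff').2 ?_
  let s₀ : USphere 1 := pole 0
  obtain ⟨G, c, hpG, hGb, hGc, hrel⟩ := hp.exists_boundaryRel_sphere φ.isFibreIncl s₀ hf'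
  -- The bottom face is one point of `S⁰`. If it is `s₀`, the boundary class is trivial and the loop
  -- lifts. If it is `-s₀`, then `G` is a path in the unit tangent bundle between opposite vectors,
  -- which is impossible.
  rcases USphere.eq_or_eq_neg s₀ (c default) with h | h
  · have hc : c = GenLoop.const := by
      refine GenLoop.ext _ _ fun s => ?_
      rw [Subsingleton.elim s default, h]
      rfl
    rw [hc] at hrel
    exact hp.liftsTo_of_boundaryRel_zero continuous_unitTangent_proj φ.isFibreIncl hf' hrel
  · exfalso
    refine UnitTangent.not_joined_neg (φ.fibreIncl s₀) (Joined.symm ⟨⟨⟨fun t => G fun _ => t,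
      by fun_prop⟩, ?_, ?_⟩⟩)
    · have h1 : (fun _ => 0 : I^(Fin 1)) = Fin.cons 0 (default : I^(Fin 0)) := by
        ext i
        rw [Subsingleton.elim i 0]
        rfl
      change G (fun _ => 0) = _
      rw [h1, hGc, h]
      refine Subtype.ext ?_
      simp only [Frame.fibreIncl, UnitTangent.neg, scale, Metric.sphere]
      congr 1
      exact (map_neg φ.toEquiv _).trans (neg_one_smul ℝ _).symm
    · exact hGb _ (Or.inl rfl)

end Circle

/-! ### Null-homotopies near a removed point -/

section Germ

variable {X : Type*} [TopologicalSpace X] {V : Type*} [NormedAddCommGroup V] [NormedSpace ℝ V]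

/-- Small spheroids around `x₀` which are null-homotopic in `S` are null-homotopic in a small
punctured neighbourhood of `x₀`. -/
def GermInjOn (k : ℕ) (S : Set X) (x₀ : X) : Prop :=
  ∀ U ∈ 𝓝 x₀, ∃ W ∈ 𝓝 x₀, ∀ c : (I^(Fin k)) → X, Continuous c →
    (∃ v, ∀ t ∈ Cube.boundary (Fin k), c t = v) → (∀ t, c t ∈ W) → NullIn S c →
    NullIn (U \ {x₀}) c

theorem NullIn.mem {k : ℕ} {S : Set X} {c : (I^(Fin k)) → X} (h : NullIn S c) (t : I^(Fin k)) :
    c t ∈ S := by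
  obtain ⟨H, -, h0, hHS, -⟩ := h
  rw [← h0]
  exact hHS _

/-- The radial retraction of the punctured space onto the punctured ball fixes `c` and pulls the
null-homotopy into the ball. -/
theorem NullIn.in_closedBall {k : ℕ} {q : V} {δ : ℝ} (hδ : 0 < δ) {c : (I^(Fin k)) → V}
    (h : NullIn {q}ᶜ c) (hc : ∀ t, c t ∈ Metric.closedBall q δ) :
    NullIn (Metric.closedBall q δ \ {q}) c := by
  have h1 := h.comp (S' := Metric.closedBall q δ \ {q})
    (g := fun u => q + (min 1 (δ / ‖u - q‖)) • (u - q)) ?_ ?_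
  · convert h1 using 2 with t
    have h2 : 0 < ‖c t - q‖ := norm_pos_iff.2 (sub_ne_zero.2 (h.mem t))
    have h3 := hc t
    rw [mem_closedBall_iff_norm] at h3
    rw [min_eq_left ((one_le_div h2).2 h3)]
    simp
  · refine continuousOn_const.add (ContinuousOn.smul ?_ (by fun_prop))
    refine ContinuousOn.inf continuousOn_const (continuousOn_const.div (by fun_prop) fun u hu => ?_)
    exact norm_ne_zero_iff.2 (sub_ne_zero.2 hu)
  · intro u hu
    have h2 : 0 < ‖u - q‖ := norm_pos_iff.2 (sub_ne_zero.2 hu)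
    have h3 : 0 < min 1 (δ / ‖u - q‖) := lt_min one_pos (div_pos hδ h2)
    refine ⟨?_, fun h => ?_⟩
    · rw [mem_closedBall_iff_norm, add_sub_cancel_left, norm_smul, Real.norm_eq_abs,
        abs_of_pos h3]
      calc _ ≤ δ / ‖u - q‖ * ‖u - q‖ := by gcongr; exact min_le_right _ _
        _ = δ := div_mul_cancel₀ _ h2.ne'
    · have h4 : min 1 (δ / ‖u - q‖) • (u - q) = 0 := by simpa using h
      rcases smul_eq_zero.1 h4 with h5 | h5
      · exact h3.ne' h5
      · exact h2.ne' (by rw [h5, norm_zero])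

/-- Here `κ` is a coordinate at `x₀` with local inverse `τ`. If it can be used to turn
null-homotopies in `S` into null-homotopies in a punctured vector space, these can be retracted into
a small ball and brought back by `τ`. -/
theorem germInjOn_of_map {k : ℕ} {S W₀ : Set X} {x₀ : X} {κ : X → V} {τ : V → X}
    (hκ : ContinuousAt κ x₀) (hτ : ∀ᶠ u in 𝓝 (κ x₀), ContinuousAt τ u)
    (hτκ : ∀ᶠ x in 𝓝 x₀, τ (κ x) = x) (hκτ : ∀ᶠ u in 𝓝 (κ x₀), κ (τ u) = u) (hW₀ : W₀ ∈ 𝓝 x₀)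
    (hS : ∀ c : (I^(Fin k)) → X, Continuous c → (∃ v, ∀ t ∈ Cube.boundary (Fin k), c t = v) →
      (∀ t, c t ∈ W₀) → NullIn S c → NullIn {κ x₀}ᶜ fun t => κ (c t)) :
    GermInjOn k S x₀ := by
  intro U hU
  have h0 : τ (κ x₀) = x₀ := hτκ.self_of_nhds
  have hU' : ∀ᶠ u in 𝓝 (κ x₀), τ u ∈ U := by
    refine hτ.self_of_nhds.eventually ?_
    rw [h0]
    exact hU
  obtain ⟨δ, hδ, hball⟩ := Metric.nhds_basis_closedBall.mem_iff.1 ((hτ.and hκτ).and hU')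
  refine ⟨W₀ ∩ ({x | τ (κ x) = x} ∩ κ ⁻¹' Metric.closedBall (κ x₀) δ),
    Filter.inter_mem hW₀ (Filter.inter_mem hτκ (hκ (Metric.closedBall_mem_nhds _ hδ))),
    fun c hc hcv hcW hnull => ?_⟩
  have h1 := (hS c hc hcv (fun t => (hcW t).1) hnull).in_closedBall hδ fun t => (hcW t).2.2
  have h2 := h1.comp (g := τ) (S' := U \ {x₀})
    (fun u hu => (hball hu.1).1.1.continuousWithinAt) fun u hu => ⟨(hball hu.1).2, fun h => hu.2 ?_⟩
  · convert h2 using 2 with t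
    exact (hcW t).2.1.symm
  · have h3 : κ (τ u) = u := (hball hu.1).1.2
    rw [Set.mem_singleton_iff.1 h] at h3
    exact h3.symm

theorem GermInjOn.homeomorph {k : ℕ} {Y : Type*} [TopologicalSpace Y] (φ : X ≃ₜ Y) {x₀ : X}
    (h : GermInjOn k {φ x₀}ᶜ (φ x₀)) : GermInjOn k {x₀}ᶜ x₀ := by
  intro U hU
  have hU' : φ.symm ⁻¹' U ∈ 𝓝 (φ x₀) := φ.symm.continuous.continuousAt.preimage_mem_nhds (by simpa)
  obtain ⟨W, hW, h1⟩ := h _ hU'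
  refine ⟨φ ⁻¹' W, φ.continuous.continuousAt hW, fun c hc ⟨v, hv⟩ hcW hnull => ?_⟩
  have h2 := h1 (fun t => φ (c t)) (by fun_prop) ⟨φ v, fun t ht => congrArg φ (hv t ht)⟩ hcW
    (hnull.comp (g := φ) φ.continuous.continuousOn fun x hx => fun h => hx (φ.injective h))
  have h3 := h2.comp (g := φ.symm) (S' := U \ {x₀}) φ.symm.continuous.continuousOn
    fun y hy => ⟨hy.1, fun h => hy.2 ?_⟩
  · simpa using h3
  · have h4 : φ.symm y = x₀ := h
    rw [← h4]
    simp

end Germ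

/-! ### From germs to the boundary sphere of a smooth ball -/

section SmoothBall

variable {n : ℕ} {N : Type*} [TopologicalSpace N] [ChartedSpace (EuclideanSpace ℝ (Fin n)) N]
  [IsManifold (𝓡 n) ∞ N]

/-- Shrink the spheroid radially until it is small enough for the germ property, which then provides
a null-homotopy inside the image of the ball's parametrization, away from the centre. Radial
projection carries it to the unit sphere. -/
theorem GermInjOn.nullIn_sphere {k : ℕ} {b : SmoothBall n N}
    (h : GermInjOn k {b.centre}ᶜ b.centre) {c : (I^(Fin k)) → USphere n} (hc : Continuous c)
    (hcv : ∃ v, ∀ t ∈ Cube.boundary (Fin k), c t = v)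
    (hnull : NullIn {b.centre}ᶜ fun t => b.toFun (c t)) : NullIn Set.univ c := by
  have hb := b.isOpenEmbedding
  obtain ⟨v, hv⟩ := hcv
  have hne : ∀ u, u ≠ 0 → b.toFun u ≠ b.centre := fun u hu h => hu (hb.injective h)
  obtain ⟨W, hW, h1⟩ := h (Set.range b.toFun) (hb.isOpen_range.mem_nhds ⟨0, rfl⟩)
  obtain ⟨δ, hδ, hball⟩ := Metric.nhds_basis_closedBall.mem_iff.1
    (hb.continuous.continuousAt.preimage_mem_nhds hW)
  have hcn : ∀ t, ‖(c t).1‖ = 1 := fun t => by simp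
  have hc0 : ∀ t, (c t).1 ≠ 0 := fun t h => by
    have := hcn t
    rw [h, norm_zero] at this
    exact zero_ne_one this
  have hbc := hb.continuous
  have h2 : NullIn {b.centre}ᶜ fun t => b.toFun (δ • (c t).1) := by
    refine hnull.of_homotopy (fun z => b.toFun ((δ * (1 - (z.1 : ℝ)) + z.1) • (c z.2).1))
      (by fun_prop) (fun t => by simp) (fun t => by simp) (fun z => hne _ ?_)
      ⟨fun s => b.toFun ((δ * (1 - (s : ℝ)) + s) • v.1), fun s t ht => by simp only [hv t ht]⟩
    refine smul_ne_zero ?_ (hc0 _)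
    have h3 := z.1.2.1
    have h4 : 0 ≤ 1 - (z.1 : ℝ) := sub_nonneg.2 z.1.2.2
    rcases h3.eq_or_lt with h5 | h5
    · rw [← h5]
      simpa using hδ.ne'
    · positivity
  have h3 := h1 (fun t => b.toFun (δ • (c t).1)) (by fun_prop)
    ⟨b.toFun (δ • v.1), fun t ht => by simp only [hv t ht]⟩ (fun t => hball (by
      simp [norm_smul, hcn, abs_of_pos hδ])) h2
  set β := hb.toOpenPartialHomeomorph with hβ
  have hβb : ∀ u, β.symm (b.toFun u) = u := fun u => β.left_inv (by simp [hβ])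
  refine NullIn.to_subtype ?_
  have h4 := h3.comp (g := fun y => ‖β.symm y‖⁻¹ • β.symm y)
    (S' := Metric.sphere (0 : EuclideanSpace ℝ (Fin n)) 1) ?_ ?_
  · convert h4 using 2 with t
    simp [hβb, norm_smul, hcn, abs_of_pos hδ, smul_smul, hδ.ne']
  · have h5 : ContinuousOn β.symm (Set.range b.toFun \ {b.centre}) :=
      β.continuousOn_symm.mono fun y hy => by simpa [hβ] using hy.1
    refine (h5.norm.inv₀ ?_).smul h5
    rintro _ ⟨⟨u, rfl⟩, hu⟩
    rw [hβb, norm_ne_zero_iff]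
    rintro rfl
    exact hu rfl
  · rintro _ ⟨⟨u, rfl⟩, hu⟩
    have h6 : u ≠ 0 := by
      rintro rfl
      exact hu rfl
    simp [hβb, norm_smul, h6]

end SmoothBall

/-! ### Removing two points from a manifold -/

section TwoPoints

variable {k : ℕ} {M : Type*} [TopologicalSpace M] {V : Type*} [NormedAddCommGroup V]
  [NormedSpace ℝ V] {e : V → M}

/-- If `x = e u`, precompose with the dilation by `‖u‖ / (2 * r)`; the ball of radius `r` then
covers only vectors of norm at most `‖u‖ / 2`. -/
theorem LocEuclidean.exists_notMem_closedBall (hM : LocEuclidean V M) {x y : M} (hxy : x ≠ y)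
    (r : ℝ) (hr : 0 < r) :
    ∃ e : V → M, Topology.IsOpenEmbedding e ∧ e 0 = y ∧ x ∉ e '' Metric.closedBall 0 r := by
  obtain ⟨e, he, rfl⟩ := hM y
  by_cases hx : x ∈ Set.range e
  · obtain ⟨u, rfl⟩ := hx
    have hu : 0 < ‖u‖ := norm_pos_iff.2 fun h => hxy (by rw [h])
    have hs : ‖u‖ / (2 * r) ≠ 0 := by positivity
    refine ⟨fun v => e ((‖u‖ / (2 * r)) • v),
      he.comp (Homeomorph.smulOfNeZero _ hs).isOpenEmbedding, by simp, ?_⟩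
    rintro ⟨v, hv, h⟩
    have h1 := congrArg norm (he.injective h)
    rw [mem_closedBall_zero_iff] at hv
    rw [norm_smul, Real.norm_eq_abs, abs_of_pos (by positivity)] at h1
    have h2 : ‖u‖ / (2 * r) * ‖v‖ ≤ ‖u‖ / (2 * r) * r := by gcongr
    have h3 : ‖u‖ / (2 * r) * r = ‖u‖ / 2 := by field_simp
    linarith
  · exact ⟨e, he, rfl, fun ⟨v, _, h⟩ => hx ⟨v, h⟩⟩

variable [FiniteDimensional ℝ V] [T2Space M]

/-- Pushing `e a` to `e a'` maps the complement of `{x₀, e a}` to that of `{x₀, e a'}` and is the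
identity near `x₀`, so it transports null-homotopies. Points in the ball of radius `2` move by at
most `1`, so none of them reaches `x₀`, which lies outside the image of the ball of radius `3`. -/
theorem GermInjOn.of_push (he : Topology.IsOpenEmbedding e) {x₀ : M}
    (hx₀ : x₀ ∉ e '' Metric.closedBall 0 3) {a a' : V} (ha : ‖a‖ ≤ 1) (haa' : ‖a' - a‖ < 1)
    (h : GermInjOn k {x₀, e a'}ᶜ x₀) : GermInjOn k {x₀, e a}ᶜ x₀ := by
  have hψ : Continuous fun x => push e (x, a, a') := by
    have := continuous_push he
    fun_prop
  have hmaps : Set.MapsTo (fun x => push e (x, a, a')) {x₀, e a}ᶜ {x₀, e a'}ᶜ := by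
    intro x hx hx'
    rcases hx' with h1 | h1
    · change push e (x, a, a') = x₀ at h1
      by_cases h2 : x ∈ e '' Metric.closedBall 0 2
      · obtain ⟨u, hu, rfl⟩ := h2
        rw [push_apply he.injective] at h1
        refine hx₀ ⟨_, ?_, h1⟩
        rw [mem_closedBall_zero_iff] at hu ⊢
        have h3 : |cutoff u| ≤ 1 := by
          unfold cutoff
          rw [abs_of_nonneg (le_max_left _ _)]
          exact max_le zero_le_one (min_le_left _ _)
        calc _ ≤ ‖u‖ + |cutoff u| * ‖a' - a‖ := by
              refine (norm_add_le _ _).trans_eq ?_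
              rw [norm_smul, Real.norm_eq_abs]
          _ ≤ 2 + 1 * 1 := by gcongr
          _ = 3 := by norm_num
      · rw [push_of_notMem_ball he.injective h2] at h1
        exact hx (Or.inl h1)
    · exact hx (Or.inr ((push_eq_iff he.injective ha haa' x).1 h1))
  have hclosed : IsClosed (e '' Metric.closedBall 0 2) :=
    ((isCompact_closedBall 0 2).image he.continuous).isClosed
  have hx₀' : x₀ ∉ e '' Metric.closedBall 0 2 := fun h1 =>
    hx₀ (Set.image_mono (Metric.closedBall_subset_closedBall (by norm_num)) h1)
  intro U hU
  obtain ⟨W, hW, h1⟩ := h U hU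
  refine ⟨W ∩ (e '' Metric.closedBall 0 2)ᶜ,
    Filter.inter_mem hW (hclosed.isOpen_compl.mem_nhds hx₀'), fun c hc hcv hcW hnull => ?_⟩
  refine h1 c hc hcv (fun t => (hcW t).1) ?_
  convert hnull.comp hψ.continuousOn hmaps using 2 with t
  exact (push_of_notMem_ball he.injective (hcW t).2 a a').symm

/-- A map to `V`, defined in the complement of the point `e w`, which vanishes outside a ball. -/
def dipole (e : V → M) (w : V) : M → V :=
  Function.extend e (fun u => (max 0 (‖u - w‖⁻¹ - 1) * ‖u - w‖⁻¹) • (u - w)) 0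

theorem dipole_apply (he : Function.Injective e) (w u : V) :
    dipole e w (e u) = (max 0 (‖u - w‖⁻¹ - 1) * ‖u - w‖⁻¹) • (u - w) :=
  he.extend_apply _ _ _

theorem continuousAt_dipole (he : Topology.IsOpenEmbedding e) (w : V) {x : M} (hx : x ≠ e w) :
    ContinuousAt (dipole e w) x := by
  by_cases h : x ∈ Set.range e
  · obtain ⟨u, rfl⟩ := h
    rw [← he.continuousAt_iff]
    have hu : ‖u - w‖ ≠ 0 := norm_ne_zero_iff.2 (sub_ne_zero.2 fun h => hx (by rw [h]))
    refine ContinuousAt.congr (f := fun u => (max 0 (‖u - w‖⁻¹ - 1) * ‖u - w‖⁻¹) • (u - w)) ?_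
      (Filter.Eventually.of_forall fun u => (dipole_apply he.injective w u).symm)
    have h1 : ContinuousAt (fun u => ‖u - w‖⁻¹) u := ContinuousAt.inv₀ (by fun_prop) hu
    exact ((ContinuousAt.sup continuousAt_const (h1.sub continuousAt_const)).mul h1).smul
      (by fun_prop)
  · have hclosed : IsClosed (e '' Metric.closedBall w 1) :=
      ((isCompact_closedBall w 1).image he.continuous).isClosed
    refine ContinuousAt.congr (f := fun _ => 0) continuousAt_const ?_
    filter_upwards [hclosed.isOpen_compl.mem_nhds fun ⟨v, _, hv⟩ => h ⟨v, hv⟩] with y hy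
    by_cases h1 : y ∈ Set.range e
    · obtain ⟨u, rfl⟩ := h1
      have h2 : 1 < ‖u - w‖ := by
        by_contra! h2
        exact hy ⟨u, mem_closedBall_iff_norm.2 h2, rfl⟩
      rw [dipole_apply he.injective, max_eq_left (sub_nonpos.2 (inv_le_one_of_one_le₀ h2.le)),
        zero_mul, zero_smul]
    · exact (Function.extend_apply' (f := e) _ (0 : M → V) y h1).symm

/-- The inverse of the dipole map. -/
def dipoleInv (e : V → M) (w : V) (v : V) : M := e (w + ((‖v‖ + 1)⁻¹ * ‖v‖⁻¹) • v)

theorem dipole_dipoleInv (he : Function.Injective e) (w : V) {v : V} (hv : v ≠ 0) :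
    dipole e w (dipoleInv e w v) = v := by
  have hv' : 0 < ‖v‖ := norm_pos_iff.2 hv
  unfold dipoleInv
  rw [dipole_apply he, add_sub_cancel_left, norm_smul, Real.norm_eq_abs,
    abs_of_pos (by positivity)]
  have h1 : ((‖v‖ + 1)⁻¹ * ‖v‖⁻¹ * ‖v‖)⁻¹ = ‖v‖ + 1 := by field_simp
  rw [h1, add_sub_cancel_right, max_eq_right hv'.le, smul_smul]
  have h2 : ‖v‖ * (‖v‖ + 1) * ((‖v‖ + 1)⁻¹ * ‖v‖⁻¹) = 1 := by field_simp
  rw [h2, one_smul]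

theorem dipoleInv_dipole (he : Function.Injective e) {w : V} {x : M} (hx : dipole e w x ≠ 0) :
    dipoleInv e w (dipole e w x) = x := by
  by_cases h : x ∈ Set.range e
  · obtain ⟨u, rfl⟩ := h
    rw [dipole_apply he] at hx ⊢
    have huw : 0 < ‖u - w‖ := norm_pos_iff.2 fun h => hx (by rw [h, smul_zero])
    have h1 : 0 < ‖u - w‖⁻¹ - 1 := by
      by_contra! h1
      exact hx (by rw [max_eq_left h1, zero_mul, zero_smul])
    rw [max_eq_right h1.le]
    unfold dipoleInv
    rw [norm_smul, Real.norm_eq_abs, abs_of_pos (by positivity), mul_assoc,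
      inv_mul_cancel₀ huw.ne', mul_one, sub_add_cancel, inv_inv, smul_smul]
    have h2 : ‖u - w‖ * (‖u - w‖⁻¹ - 1)⁻¹ * ((‖u - w‖⁻¹ - 1) * ‖u - w‖⁻¹) = 1 := by
      calc _ = (‖u - w‖ * ‖u - w‖⁻¹) * ((‖u - w‖⁻¹ - 1)⁻¹ * (‖u - w‖⁻¹ - 1)) := by ring
        _ = 1 := by rw [mul_inv_cancel₀ huw.ne', inv_mul_cancel₀ h1.ne', one_mul]
    rw [h2, one_smul]
    congr 1
    abel
  · exact absurd (Function.extend_apply' _ _ _ h) hx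

theorem continuousAt_dipoleInv (he : Continuous e) (w : V) {v : V} (hv : v ≠ 0) :
    ContinuousAt (dipoleInv e w) v := by
  refine ContinuousAt.comp (g := e) he.continuousAt ?_
  have h1 : ‖v‖ + 1 ≠ 0 := by positivity
  refine continuousAt_const.add (ContinuousAt.fun_smul (ContinuousAt.mul ?_ ?_) continuousAt_id)
  · exact ContinuousAt.inv₀ (by fun_prop) h1
  · exact ContinuousAt.inv₀ (by fun_prop) (norm_ne_zero_iff.2 hv)

/-- The map `dipole e w` sends the removed point `e w` to infinity and everything far from it to
`0`, and it is injective where it does not vanish. As `‖w‖ < 1`, its value at `e 0` is nonzero and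
attained only there. So it carries the complement of the two points into a punctured vector space
and is a coordinate at `e 0`. -/
theorem germInjOn_compl_pair_of_near (he : Topology.IsOpenEmbedding e) {w : V} (hw : w ≠ 0)
    (hw1 : ‖w‖ < 1) : GermInjOn k {e 0, e w}ᶜ (e 0) := by
  have hne : e 0 ≠ e w := fun h => hw (he.injective h).symm
  have hw0 : 0 < ‖w‖ := norm_pos_iff.2 hw
  have hq : dipole e w (e 0) ≠ 0 := by
    rw [dipole_apply he.injective, zero_sub, norm_neg]
    have h1 : 0 < ‖w‖⁻¹ - 1 := sub_pos.2 ((one_lt_inv₀ hw0).2 hw1)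
    rw [max_eq_right h1.le]
    exact smul_ne_zero (by positivity) (neg_ne_zero.2 hw)
  have hκ := continuousAt_dipole he w hne
  have hev : ∀ᶠ v in 𝓝 (dipole e w (e 0)), v ≠ 0 := isOpen_ne.mem_nhds hq
  refine germInjOn_of_map (κ := dipole e w) (τ := dipoleInv e w) (W₀ := Set.univ) hκ ?_ ?_ ?_
    Filter.univ_mem ?_
  · filter_upwards [hev] with v hv using continuousAt_dipoleInv he.continuous w hv
  · filter_upwards [hκ.eventually hev] with x hx using dipoleInv_dipole he.injective hx
  · filter_upwards [hev] with v hv using dipole_dipoleInv he.injective w hv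
  · intro c _ _ _ hnull
    refine hnull.comp (fun x hx => ContinuousAt.continuousWithinAt
      (continuousAt_dipole he w fun h => hx (Or.inr h))) fun x hx h => hx (Or.inl ?_)
    have h : dipole e w x = dipole e w (e 0) := h
    rw [← dipoleInv_dipole he.injective hq, ← h, dipoleInv_dipole he.injective]
    rwa [h]

/-- If two points are removed from a manifold then the link of one of them does not bound. -/
theorem germInjOn_compl_pair [PreconnectedSpace M] (hM : LocEuclidean V M)
    (hV : 1 < Module.rank ℝ V) {x₀ y : M} (hy : y ≠ x₀) : GermInjOn k {x₀, y}ᶜ x₀ := by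
  -- Sliding the second point within a ball that stays away from `x₀` does not affect the property.
  have hloc : ∀ y, y ≠ x₀ → ∃ O, IsOpen O ∧ y ∈ O ∧ ∀ z ∈ O,
      (GermInjOn k {x₀, y}ᶜ x₀ ↔ GermInjOn k {x₀, z}ᶜ x₀) := by
    intro y hy
    obtain ⟨e, he, rfl, hx₀⟩ := hM.exists_notMem_closedBall hy.symm 3 (by norm_num)
    refine ⟨e '' Metric.ball 0 1, he.isOpenMap _ Metric.isOpen_ball,
      ⟨0, Metric.mem_ball_self one_pos, rfl⟩, ?_⟩
    rintro _ ⟨u, hu, rfl⟩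
    rw [mem_ball_zero_iff] at hu
    exact ⟨GermInjOn.of_push he hx₀ hu.le (by simpa using hu),
      GermInjOn.of_push he hx₀ (by simp) (by simpa using hu)⟩
  have hopen : ∀ P : M → Prop, (∀ y z, y ≠ x₀ → (GermInjOn k {x₀, y}ᶜ x₀ ↔ GermInjOn k {x₀, z}ᶜ x₀) →
      P y → P z) → IsOpen {y | y ≠ x₀ ∧ P y} := by
    intro P hP
    rw [isOpen_iff_mem_nhds]
    rintro y ⟨hy, hPy⟩
    obtain ⟨O, hO, hyO, h⟩ := hloc y hy
    filter_upwards [hO.mem_nhds hyO, isOpen_ne.mem_nhds hy] with z hz hz' using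
      ⟨hz', hP y z hy (h z hz) hPy⟩
  have : Nontrivial V := by
    rw [← rank_pos_iff_nontrivial (R := ℝ)]
    exact zero_lt_one.trans hV
  -- The property and its negation both define open subsets of the connected complement of `x₀`. The
  -- first is nonempty because it contains points close to `x₀`.
  by_contra hcon
  obtain ⟨e, he, rfl⟩ := hM x₀
  obtain ⟨w, hw⟩ := exists_norm_eq V (c := 1 / 2) (by norm_num)
  have hw0 : w ≠ 0 := norm_pos_iff.1 (by rw [hw]; norm_num)
  have h1 := germInjOn_compl_pair_of_near (k := k) he hw0 (by rw [hw]; norm_num)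
  obtain ⟨z, -, h2, h3⟩ := isPreconnected_compl_singleton hM hV (e 0) _ _
    (hopen (fun y => GermInjOn k {e 0, y}ᶜ (e 0)) fun y z _ h => h.1)
    (hopen (fun y => ¬ GermInjOn k {e 0, y}ᶜ (e 0)) fun y z _ h => mt h.2)
    (fun z hz => (em _).imp (fun h => ⟨hz, h⟩) fun h => ⟨hz, h⟩)
    ⟨e w, fun h => hw0 (he.injective h), fun h => hw0 (he.injective h), h1⟩
    ⟨y, hy, hy, hcon⟩
  exact h3.2 h2.2

end TwoPoints

open CategoryTheory

/-! ### A connected covering with more than one sheet, built from the fundamental groupoid -/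

section UniversalCover

universe u

variable {N : Type u} [TopologicalSpace N]

/-- The class of a path, as a morphism of the fundamental groupoid. -/
def pathHom {x y : N} (γ : Path x y) : FundamentalGroupoid.mk x ⟶ FundamentalGroupoid.mk y :=
  FundamentalGroupoid.fromPath (Path.Homotopic.Quotient.mk γ)

theorem pathHom_trans {x y z : N} (γ : Path x y) (δ : Path y z) :
    pathHom (γ.trans δ) = pathHom γ ≫ pathHom δ := rfl

theorem pathHom_refl (x : N) : pathHom (Path.refl x) = 𝟙 _ := rfl

theorem pathHom_eq_iff {x y : N} {γ δ : Path x y} : pathHom γ = pathHom δ ↔ γ.Homotopic δ :=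
  FundamentalGroupoid.fromPath_eq_iff_homotopic γ δ

theorem exists_pathHom {x y : N} (α : FundamentalGroupoid.mk x ⟶ FundamentalGroupoid.mk y) :
    ∃ γ : Path x y, pathHom γ = α := Quotient.exists_rep α

theorem pathHom_subpath {x y : N} (γ : Path x y) (r s t : I) :
    pathHom (γ.subpath r s) ≫ pathHom (γ.subpath s t) = pathHom (γ.subpath r t) := by
  rw [← pathHom_trans, pathHom_eq_iff]
  exact ⟨Path.Homotopy.subpathTransSubpath γ r s t⟩

theorem pathHom_cast_comp {x z p q : N} (h : x = z) (a : Path z p) (b : Path z q) (c : Path p q)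
    (habc : pathHom a ≫ pathHom c = pathHom b) :
    pathHom (a.cast h rfl) ≫ pathHom c = pathHom (b.cast h rfl) := by
  subst h
  exact habc

/-- A covering by open path-connected sets in which all loops are null-homotopic in `N`. -/
structure IsGoodCovering (S : N → Set N) : Prop where
  isOpen : ∀ i, IsOpen (S i)
  mem : ∀ i, i ∈ S i
  exists_path : ∀ i, ∀ x ∈ S i, ∀ y ∈ S i, ∃ γ : Path x y, ∀ t, γ t ∈ S i
  homotopic : ∀ i (x y : N) (γ δ : Path x y), (∀ t, γ t ∈ S i) → (∀ t, δ t ∈ S i) → γ.Homotopic δ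

/-- Take the images of embeddings of the whole vector space `V`: paths in such a set pull back to
`V`, which is simply connected. -/
theorem exists_isGoodCovering {V : Type*} [NormedAddCommGroup V] [NormedSpace ℝ V]
    (hN : LocEuclidean V N) : ∃ S : N → Set N, IsGoodCovering S := by
  choose e he he0 using hN
  refine ⟨fun i => Set.range (e i), fun i => (he i).isOpen_range, fun i => ⟨0, he0 i⟩, ?_, ?_⟩
  · rintro i _ ⟨u, rfl⟩ _ ⟨v, rfl⟩
    exact ⟨(PathConnectedSpace.somePath u v).map (he i).continuous, fun t => ⟨_, rfl⟩⟩
  · intro i x y γ δ hγ hδ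
    obtain ⟨u, rfl⟩ : x ∈ Set.range (e i) := by simpa using hγ 0
    obtain ⟨v, rfl⟩ : y ∈ Set.range (e i) := by simpa using hγ 1
    set β := (he i).toOpenPartialHomeomorph with hβ
    have hβe : ∀ z ∈ Set.range (e i), e i (β.symm z) = z := fun z hz => by
      simpa [hβ] using β.right_inv (by simpa [hβ] using hz)
    have heβ : ∀ w, β.symm (e i w) = w := fun w => β.left_inv (by simp [hβ])
    have hcont : ContinuousOn β.symm (Set.range (e i)) :=
      β.continuousOn_symm.mono fun z hz => by simpa [hβ] using hz
    have hlift : ∀ γ : Path (e i u) (e i v), (∀ t, γ t ∈ Set.range (e i)) →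
        ∃ γ' : Path u v, γ'.map (he i).continuous = γ := fun γ hγ =>
      ⟨⟨⟨fun t => β.symm (γ t), hcont.comp_continuous γ.continuous hγ⟩, by simp [heβ],
        by simp [heβ]⟩, by
        ext t
        exact hβe _ (hγ t)⟩
    obtain ⟨γ', rfl⟩ := hlift γ hγ
    obtain ⟨δ', rfl⟩ := hlift δ hδ
    exact (SimplyConnectedSpace.paths_homotopic γ' δ').map ⟨e i, (he i).continuous⟩

variable {S : N → Set N} [PathConnectedSpace N] (x₀ : N)

/-- The class of a path from `x₀` to `x` which runs, from the point `i` on, in `S i`. -/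
def viaHom (S : N → Set N) (i x : N) : FundamentalGroupoid.mk x₀ ⟶ FundamentalGroupoid.mk x :=
  open scoped Classical in
  pathHom (PathConnectedSpace.somePath x₀ i) ≫
    if h : ∃ γ : Path i x, ∀ t, γ t ∈ S i then pathHom h.choose
    else pathHom (PathConnectedSpace.somePath i x)

variable {x₀}

/-- The classes `viaHom x₀ S i x` are compatible with all paths inside `S i`, because there two
paths with the same ends are homotopic. They thus trivialize the family of sets of path classes from
`x₀` over `S i`. -/
theorem IsGoodCovering.viaHom_comp (hS : IsGoodCovering S) {i x y : N} (γ : Path x y)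
    (hγ : ∀ t, γ t ∈ S i) : viaHom x₀ S i x ≫ pathHom γ = viaHom x₀ S i y := by
  have hx : x ∈ S i := by simpa using hγ 0
  have hy : y ∈ S i := by simpa using hγ 1
  have h1 := hS.exists_path i i (hS.mem i) x hx
  have h2 := hS.exists_path i i (hS.mem i) y hy
  unfold viaHom
  rw [dif_pos h1, dif_pos h2, Category.assoc, ← pathHom_trans]
  congr 1
  rw [pathHom_eq_iff]
  refine hS.homotopic i _ _ _ _ (fun t => ?_) h2.choose_spec
  have h3 : h1.choose.trans γ t ∈ Set.range (h1.choose.trans γ) := ⟨t, rfl⟩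
  rw [Path.trans_range] at h3
  rcases h3 with ⟨s, hs⟩ | ⟨s, hs⟩
  · rw [← hs]
    exact h1.choose_spec s
  · rw [← hs]
    exact hγ s

variable (x₀) in
/-- The loops at `x₀`, with the discrete topology. -/
def LoopClass : Type u := FundamentalGroupoid.mk x₀ ⟶ FundamentalGroupoid.mk x₀

/-- A morphism of the fundamental groupoid as an element of the discrete space of loops. -/
def LoopClass.of (α : FundamentalGroupoid.mk x₀ ⟶ FundamentalGroupoid.mk x₀) : LoopClass x₀ := α

instance : TopologicalSpace (LoopClass x₀) := ⊥

instance : DiscreteTopology (LoopClass x₀) := ⟨rfl⟩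

theorem comp_inv_comp {C : Type*} [Groupoid C] {X Y Z : C} (a : X ⟶ Y) (f g h : Y ⟶ Z) :
    (a ≫ f ≫ inv g) ≫ g ≫ inv h = a ≫ f ≫ inv h := by
  simp

variable (x₀) in
/-- The transition functions of the universal covering. -/
def universalCore [LocallyPathConnectedSpace N] (hS : IsGoodCovering S) :
    FiberBundleCore N N (LoopClass x₀) where
  baseSet := S
  isOpen_baseSet := hS.isOpen
  indexAt := id
  mem_baseSet_at := hS.mem
  coordChange i j x α := (show FundamentalGroupoid.mk x₀ ⟶ FundamentalGroupoid.mk x₀ from α) ≫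
    viaHom x₀ S i x ≫ inv (viaHom x₀ S j x)
  coordChange_self i x _ α := by
    rw [IsIso.hom_inv_id]
    exact Category.comp_id _
  continuousOn_coordChange i j := by
    rintro ⟨x, α⟩ ⟨⟨hi, hj⟩, -⟩
    refine ContinuousAt.continuousWithinAt ((continuousAt_const
      (y := LoopClass.of ((show FundamentalGroupoid.mk x₀ ⟶ FundamentalGroupoid.mk x₀ from α) ≫
        viaHom x₀ S i x ≫ inv (viaHom x₀ S j x)))).congr ?_)
    -- Within a path-connected part of `S i ∩ S j` both classes `viaHom` change by the class of the
    -- same path, which cancels. So the transition function is locally constant.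
    obtain ⟨W, ⟨hW, hWp⟩, hWS⟩ := (path_connected_basis x).mem_iff.1
      (((hS.isOpen i).inter (hS.isOpen j)).mem_nhds ⟨hi, hj⟩)
    filter_upwards [prod_mem_nhds hW (IsOpen.mem_nhds (isOpen_discrete {α}) rfl)]
    rintro ⟨y, β⟩ ⟨hy, rfl⟩
    obtain ⟨γ, hγ⟩ := hWp.joinedIn x (mem_of_mem_nhds hW) y hy
    dsimp only [LoopClass.of]
    rw [← hS.viaHom_comp γ fun t => (hWS (hγ t)).1, ← hS.viaHom_comp γ fun t => (hWS (hγ t)).2]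
    simp
    rfl
  coordChange_comp i j k x _ α := comp_inv_comp _ _ _ _

variable [LocallyPathConnectedSpace N]

/-- The path over `γ` records at time `t` the class `α` continued along `γ` up to `t`. In the
trivialization at `γ t₀` its fibre coordinate is constant near `t₀`, hence it is continuous. Every
point of the total space arises from such a class, which gives path-connectedness. -/
theorem joined_universalCore (hS : IsGoodCovering S) {x y : N} (γ : Path x y)
    (α : FundamentalGroupoid.mk x₀ ⟶ FundamentalGroupoid.mk x) :
    Joined (⟨x, α ≫ inv (viaHom x₀ S x x)⟩ : (universalCore x₀ hS).TotalSpace)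
      ⟨y, α ≫ pathHom γ ≫ inv (viaHom x₀ S y y)⟩ := by
  set Γ : I → (universalCore x₀ hS).TotalSpace := fun t =>
    ⟨γ t, α ≫ pathHom ((γ.subpath 0 t).cast γ.source.symm rfl) ≫ inv (viaHom x₀ S (γ t) (γ t))⟩
    with hΓ
  have hΓc : Continuous Γ := by
    refine continuous_iff_continuousAt.2 fun t₀ => ?_
    have hnhds : γ ⁻¹' S (γ t₀) ∈ 𝓝 t₀ :=
      γ.continuous.continuousAt ((hS.isOpen _).mem_nhds (hS.mem _))
    rw [((universalCore x₀ hS).localTriv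
      (γ t₀)).toOpenPartialHomeomorph.continuousAt_iff_continuousAt_comp_left (by exact hnhds)]
    refine ContinuousAt.prodMk γ.continuous.continuousAt ?_
    refine (continuousAt_const (y := LoopClass.of (α ≫
      pathHom ((γ.subpath 0 t₀).cast γ.source.symm rfl) ≫ inv (viaHom x₀ S (γ t₀) (γ t₀))))).congr ?_
    obtain ⟨δ, hδ, hball⟩ := Metric.mem_nhds_iff.1 hnhds
    filter_upwards [Metric.ball_mem_nhds t₀ hδ] with t ht
    have h1 : ∀ s, γ.subpath t₀ t s ∈ S (γ t₀) := fun s => by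
      have h2 : γ.subpath t₀ t s ∈ Set.range (γ.subpath t₀ t) := ⟨s, rfl⟩
      rw [Path.range_subpath] at h2
      obtain ⟨r, hr, h3⟩ := h2
      rw [← h3]
      refine hball ?_
      rw [Metric.mem_ball] at ht ⊢
      refine lt_of_le_of_lt ?_ ht
      rw [Subtype.dist_eq, Subtype.dist_eq, dist_comm, dist_comm (t : ℝ)]
      refine Real.dist_left_le_of_mem_uIcc ?_
      rw [Set.mem_uIcc] at hr ⊢
      exact hr
    have h2 : pathHom ((γ.subpath 0 t).cast γ.source.symm rfl) =
        pathHom ((γ.subpath 0 t₀).cast γ.source.symm rfl) ≫ pathHom (γ.subpath t₀ t) :=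
      (pathHom_cast_comp _ _ _ _ (pathHom_subpath γ 0 t₀ t)).symm
    change _ = (α ≫ pathHom ((γ.subpath 0 t).cast γ.source.symm rfl) ≫
      inv (viaHom x₀ S (γ t) (γ t))) ≫ viaHom x₀ S (γ t) (γ t) ≫ inv (viaHom x₀ S (γ t₀) (γ t))
    rw [h2, ← hS.viaHom_comp (γ.subpath t₀ t) h1]
    simp
    rfl
  have h0 : ∀ z (hz : x = z) (η : Path x z), (∀ s, η s = x) →
      (⟨z, α ≫ pathHom η ≫ inv (viaHom x₀ S z z)⟩ : (universalCore x₀ hS).TotalSpace) =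
        ⟨x, α ≫ inv (viaHom x₀ S x x)⟩ := by
    rintro z rfl η hη
    have h1 : η = Path.refl x := by
      ext s
      exact hη s
    rw [h1, pathHom_refl, Category.id_comp]
  have h1 : ∀ z (hz : y = z) (η : Path x z), (∀ s, η s = γ s) →
      (⟨z, α ≫ pathHom η ≫ inv (viaHom x₀ S z z)⟩ : (universalCore x₀ hS).TotalSpace) =
        ⟨y, α ≫ pathHom γ ≫ inv (viaHom x₀ S y y)⟩ := by
    rintro z rfl η hη
    have h1 : η = γ := by
      ext s
      exact hη s
    rw [h1]
  refine ⟨⟨⟨Γ, hΓc⟩, ?_, ?_⟩⟩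
  · exact h0 _ γ.source.symm _ fun s => by simp
  · exact h1 _ γ.target.symm _ fun s => by simp

/-- A connected manifold which is not simply connected has a connected covering with more than one
sheet. -/
theorem exists_covering_two_points {V : Type*} [NormedAddCommGroup V] [NormedSpace ℝ V]
    (hN : LocEuclidean V N) (hsc : ¬ SimplyConnectedSpace N) (x : N) :
    ∃ (M : Type u) (_ : TopologicalSpace M) (p : M → N), IsCoveringMap p ∧ PathConnectedSpace M ∧
      ∃ a b, a ≠ b ∧ p a = x ∧ p b = x := by
  obtain ⟨S, hS⟩ := exists_isGoodCovering hN
  -- An essential loop and the constant loop give two different points of the fibre.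
  obtain ⟨x₀, γ, hγ⟩ : ∃ (x₀ : N) (γ : Path x₀ x₀), ¬ γ.Homotopic (Path.refl x₀) := by
    by_contra! h
    exact hsc (simply_connected_iff_loops_nullhomotopic.2 ⟨inferInstance, h⟩)
  have hγ' : LoopClass.of (pathHom γ) ≠ LoopClass.of (𝟙 (FundamentalGroupoid.mk x₀)) := fun h =>
    hγ (pathHom_eq_iff.1 h)
  refine ⟨(universalCore x₀ hS).TotalSpace, inferInstance, (universalCore x₀ hS).proj,
    FiberBundle.isCoveringMap, ?_, ⟨x, LoopClass.of (pathHom γ)⟩, ⟨x, LoopClass.of (𝟙 _)⟩, ?_,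
    rfl, rfl⟩
  · have h : ∀ z : (universalCore x₀ hS).TotalSpace,
        Joined (⟨x₀, 𝟙 _ ≫ inv (viaHom x₀ S x₀ x₀)⟩ : (universalCore x₀ hS).TotalSpace) z := by
      rintro ⟨y, α⟩
      obtain ⟨δ, hδ⟩ := exists_pathHom
        ((show FundamentalGroupoid.mk x₀ ⟶ FundamentalGroupoid.mk x₀ from α) ≫ viaHom x₀ S y y)
      have h1 := joined_universalCore hS δ (𝟙 _)
      rw [hδ] at h1
      have h2 : ∀ a : FundamentalGroupoid.mk x₀ ⟶ FundamentalGroupoid.mk x₀,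
          𝟙 _ ≫ (a ≫ viaHom x₀ S y y) ≫ inv (viaHom x₀ S y y) = a := by simp
      exact h1.trans (Eq.rec (motive := fun w _ => Joined _ w) (Joined.refl _)
        (congrArg (fun a => (⟨y, a⟩ : (universalCore x₀ hS).TotalSpace)) (h2 α)))
    exact ⟨⟨⟨x, LoopClass.of (𝟙 _)⟩⟩, fun y z => (h y).symm.trans (h z)⟩
  · intro h
    exact hγ' (eq_of_heq (Bundle.TotalSpace.mk.inj h).2)

end UniversalCover

/-! ### Lifting null-homotopies to coverings -/

section Covering

theorem LocEuclidean.of_isCoveringMap {V M N : Type*} [NormedAddCommGroup V] [NormedSpace ℝ V]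
    [TopologicalSpace M] [TopologicalSpace N] {p : M → N} (hp : IsCoveringMap p)
    (hN : LocEuclidean V N) : LocEuclidean V M := by
  choose e he he0 using hN
  choose ψ hψ hψp using hp.isLocalHomeomorph
  let : ChartedSpace V M :=
    { atlas := Set.univ
      chartAt := fun m => (ψ m).trans (he (p m)).toOpenPartialHomeomorph.symm
      mem_chart_source := fun m => by
        refine ⟨hψ m, ?_⟩
        have h : p m ∈ Set.range (e (p m)) := ⟨0, he0 _⟩
        simpa [← hψp m] using h
      chart_mem_atlas := fun _ => trivial }
  exact locEuclidean_of_chartedSpace V M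

theorem IsCoveringMap.t2Space {M N : Type*} [TopologicalSpace M] [TopologicalSpace N] [T2Space N]
    {p : M → N} (hp : IsCoveringMap p) : T2Space M := by
  refine ⟨fun x y hxy => ?_⟩
  by_cases h : p x = p y
  · exact hp.isSeparatedMap x y h hxy
  · obtain ⟨u, v, hu, hv, hxu, hyv, huv⟩ := t2_separation h
    exact ⟨p ⁻¹' u, p ⁻¹' v, hu.preimage hp.continuous, hv.preimage hp.continuous, hxu, hyv,
      huv.preimage p⟩

/-- Null-homotopies can be lifted to coverings. -/
theorem NullIn.lift {k : ℕ} {M N : Type*} [TopologicalSpace M] [TopologicalSpace N]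
    {p : M → N} (hp : IsCoveringMap p) {S : Set N} {c : (I^(Fin k)) → M} (hc : Continuous c)
    (hcv : ∃ v, ∀ t ∈ Cube.boundary (Fin k), c t = v) (h : NullIn S fun t => p (c t)) :
    NullIn (p ⁻¹' S) c := by
  obtain ⟨H, hH, h0, hHS, ⟨τ, hτ⟩, y, hy⟩ := h
  obtain ⟨v, hv⟩ := hcv
  set K := hp.liftHomotopy ⟨H, hH⟩ ⟨c, hc⟩ h0 with hK
  have hpK : ∀ z, p (K z) = H z := fun z => congrFun (hp.liftHomotopy_lifts ⟨H, hH⟩ ⟨c, hc⟩ h0) z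
  have hK0 : ∀ t, K (0, t) = c t := fun t => hp.liftHomotopy_zero ⟨H, hH⟩ ⟨c, hc⟩ h0 t
  refine ⟨K, K.continuous, hK0, fun z => ?_, ?_, K (1, fun _ => 0), fun t => ?_⟩
  · rw [Set.mem_preimage, hpK]
    exact hHS z
  · by_cases hne : ∃ t₀, t₀ ∈ Cube.boundary (Fin k)
    · obtain ⟨t₀, ht₀⟩ := hne
      refine ⟨fun s => K (s, t₀), fun s t ht => ?_⟩
      refine congrFun (hp.eq_of_comp_eq (g₁ := fun s => K (s, t)) (g₂ := fun s => K (s, t₀))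
        (by fun_prop) (by fun_prop) (funext fun s => ?_) 0 ?_) s
      · simp only [Function.comp_apply, hpK, hτ _ _ ht, hτ _ _ ht₀]
      · simp only [hK0, hv t ht, hv t₀ ht₀]
    · exact ⟨fun s => K (s, fun _ => 0), fun s t ht => absurd ⟨t, ht⟩ hne⟩
  · refine congrFun (hp.eq_of_comp_eq (g₁ := fun t => K (1, t))
      (g₂ := fun _ => K (1, fun _ => 0)) (by fun_prop) (by fun_prop) (funext fun s => ?_)
      (fun _ => 0) rfl) t
    simp only [Function.comp_apply, hpK, hy]

variable {V N : Type*} [NormedAddCommGroup V] [NormedSpace ℝ V] [FiniteDimensional ℝ V]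
  [TopologicalSpace N] [T2Space N] [PathConnectedSpace N] [LocallyPathConnectedSpace N]

/-- A null-homotopy in the complement of `x₀` lifts to a covering, where it avoids every point over
`x₀`, in particular two of them. Then `germInjOn_compl_pair` localizes it near one of these points,
on whose neighbourhood the covering is injective. -/
theorem germInjOn_of_not_simplyConnected (hN : LocEuclidean V N) (hV : 1 < Module.rank ℝ V)
    (hsc : ¬ SimplyConnectedSpace N) (k : ℕ) (x₀ : N) : GermInjOn k {x₀}ᶜ x₀ := by
  obtain ⟨M, _, p, hp, _, a, b, hab, ha, hb⟩ := exists_covering_two_points hN hsc x₀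
  have := IsCoveringMap.t2Space hp
  have h := germInjOn_compl_pair (k := k) (LocEuclidean.of_isCoveringMap hp hN) hV hab.symm
  obtain ⟨ψ, haψ, hψp⟩ := hp.isLocalHomeomorph a
  subst ha
  intro U hU
  obtain ⟨W, hW, h1⟩ := h (ψ.source ∩ p ⁻¹' U)
    (Filter.inter_mem (ψ.open_source.mem_nhds haψ) (hp.continuous.continuousAt hU))
  have ha' : p a ∈ ψ.target := by
    rw [hψp]
    exact ψ.map_source haψ
  have hψa : ψ.symm (p a) = a := by
    rw [hψp]
    exact ψ.left_inv haψ
  refine ⟨ψ.target ∩ ψ.symm ⁻¹' W, Filter.inter_mem (ψ.open_target.mem_nhds ha')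
    ((ψ.symm.continuousAt ha') (by rwa [hψa])), fun c hc ⟨v, hv⟩ hcW hnull => ?_⟩
  have hpψ : ∀ t, p (ψ.symm (c t)) = c t := fun t => by
    rw [hψp]
    exact ψ.right_inv (hcW t).1
  have hc' : Continuous fun t => ψ.symm (c t) :=
    ψ.continuousOn_symm.comp_continuous hc fun t => (hcW t).1
  have hcv' : ∃ v, ∀ t ∈ Cube.boundary (Fin k), ψ.symm (c t) = v :=
    ⟨ψ.symm v, fun t ht => by rw [hv t ht]⟩
  have h2 := NullIn.lift hp (c := fun t => ψ.symm (c t)) (S := {p a}ᶜ) hc' hcv' (by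
    simpa only [hpψ] using hnull)
  have h3 := (h1 _ hc' hcv' (fun t => (hcW t).2) (h2.mono fun m hm hm' => hm (by
    rcases hm' with rfl | rfl
    · rfl
    · exact hb))).comp (g := p) (S' := U \ {p a}) hp.continuous.continuousOn
      fun m hm => ⟨hm.1.2, fun h => hm.2 (ψ.injOn hm.1.1 haψ (by rw [← hψp]; exact h))⟩
  simpa only [hpψ] using h3

end Covering

/-! ### Lifting homotopies of spheroids -/

section HomotopyLifting

variable {E B : Type*} [TopologicalSpace E] [TopologicalSpace B] {p : E → B} {k : ℕ}

/-- Homotopies of spheroids can be lifted to spaces with local transport. -/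
theorem LocTransport.exists_homotopy_lift (hp : LocTransport p)
    {H : I × (I^(Fin (k + 1))) → B} (hH : Continuous H)
    (hτ : ∃ τ : I → B, ∀ s, ∀ t ∈ Cube.boundary (Fin (k + 1)), H (s, t) = τ s)
    {e : (I^(Fin (k + 1))) → E} (he : Continuous e)
    (hev : ∃ v, ∀ t ∈ Cube.boundary (Fin (k + 1)), e t = v) (hpe : ∀ t, p (e t) = H (0, t)) :
    ∃ K : I × (I^(Fin (k + 1))) → E, Continuous K ∧ (∀ z, p (K z) = H z) ∧
      (∀ t, K (0, t) = e t) ∧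
      ∃ τ : I → E, ∀ s, ∀ t ∈ Cube.boundary (Fin (k + 1)), K (s, t) = τ s := by
  obtain ⟨H', hH', hHc⟩ := exists_homotopy_of_cube H hH hτ
  obtain ⟨v, hv⟩ := hev
  obtain ⟨e', hec⟩ := exists_sphere_map ⟨e, he⟩ hv
  -- All stages `s` are lifted simultaneously, the stage `s` along the homotopy `r ↦ H' (s * r, x)`.
  -- This is stationary for `s = 0`, so regularity preserves the given initial lift. Working on the
  -- sphere keeps the boundary of the cube at one point.
  obtain ⟨K, hK, hpK, hK0⟩ := hp.exists_lift (Z := I × USphere (k + 2))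
    (H := fun z => H' (z.1.1 * z.2, z.1.2)) (by fun_prop) (e := fun z => e' z.2) (by fun_prop)
    (by
      rintro ⟨s, x⟩
      obtain ⟨t, rfl⟩ := collapse_surjective k x
      simp only [mul_zero]
      rw [hec, hHc]
      exact hpe t)
  refine ⟨fun z => K (z.1, collapse (k + 1) z.2), by fun_prop, fun z => ?_, fun t => ?_,
    fun s => K (s, pole (k + 1)), fun s t ht => ?_⟩
  · rw [hpK, mul_one, hHc]
  · exact (hK0 (0, collapse (k + 1) t) fun s => by simp only [zero_mul]).trans (hec t)
  · dsimp only
    rw [collapse_of_mem_boundary _ t ht]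

end HomotopyLifting

/-! ### Projective spaces and the tautological bundle without zero -/

section Projective

variable {𝕂 : Type} [NormedDivisionRing 𝕂] {r : ℕ}

/-- The line spanned by a vector. -/
def toProj (v : {v : Fin (r + 1) → 𝕂 // v ≠ 0}) : ProjSpace 𝕂 r := Projectivization.mk 𝕂 v.1 v.2

theorem isQuotientMap_toProj : Topology.IsQuotientMap (toProj (𝕂 := 𝕂) (r := r)) :=
  isQuotientMap_quotient_mk'

theorem continuous_toProj : Continuous (toProj (𝕂 := 𝕂) (r := r)) := isQuotientMap_toProj.continuous

theorem toProj_surjective : Function.Surjective (toProj (𝕂 := 𝕂) (r := r)) :=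
  isQuotientMap_toProj.surjective

theorem toProj_eq_iff {v w : {v : Fin (r + 1) → 𝕂 // v ≠ 0}} :
    toProj v = toProj w ↔ ∃ a : 𝕂, a ≠ 0 ∧ v.1 = a • w.1 := by
  refine (Projectivization.mk_eq_mk_iff 𝕂 v.1 w.1 v.2 w.2).trans ⟨?_, ?_⟩
  · rintro ⟨a, ha⟩
    exact ⟨a, a.ne_zero, ha.symm⟩
  · rintro ⟨a, ha, h⟩
    exact ⟨Units.mk0 a ha, h.symm⟩

/-- A spanning vector of a line. -/
def lineRep (x : ProjSpace 𝕂 r) : {v : Fin (r + 1) → 𝕂 // v ≠ 0} :=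
  Function.surjInv toProj_surjective x

theorem toProj_lineRep (x : ProjSpace 𝕂 r) : toProj (lineRep x) = x :=
  Function.surjInv_eq toProj_surjective x

theorem exists_lineRep_toProj (v : {v : Fin (r + 1) → 𝕂 // v ≠ 0}) :
    ∃ a : 𝕂, a ≠ 0 ∧ (lineRep (toProj v)).1 = a • v.1 :=
  toProj_eq_iff.1 (toProj_lineRep (toProj v))

theorem continuous_coord (i : Fin (r + 1)) :
    Continuous fun v : {v : Fin (r + 1) → 𝕂 // v ≠ 0} => v.1 i :=
  (continuous_apply i).comp continuous_subtype_val

/-- The spanning vector whose `i`-th coordinate is `1` (it is zero if there is no such vector). -/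
def affineRep (i : Fin (r + 1)) (x : ProjSpace 𝕂 r) : Fin (r + 1) → 𝕂 :=
  ((lineRep x).1 i)⁻¹ • (lineRep x).1

theorem affineRep_toProj (i : Fin (r + 1)) (v : {v : Fin (r + 1) → 𝕂 // v ≠ 0}) :
    affineRep i (toProj v) = (v.1 i)⁻¹ • v.1 := by
  obtain ⟨a, ha, h⟩ := exists_lineRep_toProj v
  unfold affineRep
  rw [h, Pi.smul_apply, smul_eq_mul, mul_inv_rev, smul_smul, mul_assoc, inv_mul_cancel₀ ha, mul_one]

/-- The lines on which the `i`-th coordinate does not vanish. -/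
def affineSet (i : Fin (r + 1)) : Set (ProjSpace 𝕂 r) := {x | (lineRep x).1 i ≠ 0}

theorem toProj_mem_affineSet {i : Fin (r + 1)} {v : {v : Fin (r + 1) → 𝕂 // v ≠ 0}} :
    toProj v ∈ affineSet i ↔ v.1 i ≠ 0 := by
  obtain ⟨a, ha, h⟩ := exists_lineRep_toProj v
  simp [affineSet, h, ha]

theorem isOpen_affineSet (i : Fin (r + 1)) : IsOpen (affineSet (𝕂 := 𝕂) i) := by
  rw [← isQuotientMap_toProj.isOpen_preimage]
  have h : toProj ⁻¹' affineSet (𝕂 := 𝕂) i = {v | v.1 i ≠ 0} :=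
    Set.ext fun v => toProj_mem_affineSet
  rw [h]
  exact isOpen_ne.preimage (continuous_coord i)

theorem continuousOn_affineRep (i : Fin (r + 1)) :
    ContinuousOn (affineRep (𝕂 := 𝕂) i) (affineSet i) := by
  rw [isQuotientMap_toProj.continuousOn_isOpen_iff (isOpen_affineSet i)]
  have h : ContinuousOn (fun v : {v : Fin (r + 1) → 𝕂 // v ≠ 0} => (v.1 i)⁻¹ • v.1)
      (toProj ⁻¹' affineSet i) := by
    refine ContinuousOn.smul ((continuous_coord i).continuousOn.inv₀ fun v hv => ?_)
      continuous_subtype_val.continuousOn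
    exact toProj_mem_affineSet.1 hv
  exact h.congr fun v _ => affineRep_toProj i v

theorem affineRep_apply_self {i : Fin (r + 1)} {x : ProjSpace 𝕂 r} (hx : x ∈ affineSet i) :
    affineRep i x i = 1 := inv_mul_cancel₀ hx

theorem exists_mem_affineSet (x : ProjSpace 𝕂 r) : ∃ i, x ∈ affineSet i := by
  by_contra! h
  exact (lineRep x).2 (funext fun i => not_not.1 (h i))

open scoped Classical in
/-- The complement of zero has local transport over the projective space. -/
theorem locTransport_toProj : LocTransport (toProj (𝕂 := 𝕂) (r := r)) := by
  intro x
  obtain ⟨i, hi⟩ := exists_mem_affineSet x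
  have hne : ∀ v : {v : Fin (r + 1) → 𝕂 // v ≠ 0}, ∀ y : ProjSpace 𝕂 r,
      toProj v ∈ affineSet i → y ∈ affineSet i →
      v.1 i • affineRep i y ≠ 0 := fun v y hv hy h => by
    have h1 := congrFun h i
    rw [Pi.smul_apply, affineRep_apply_self hy, smul_eq_mul, mul_one] at h1
    exact toProj_mem_affineSet.1 hv h1
  refine ⟨affineSet i, (isOpen_affineSet i).mem_nhds hi,
    fun z => if h : z.1.1 i • affineRep i z.2 ≠ 0 then ⟨_, h⟩ else z.1, ?_, ?_, ?_⟩
  · refine (Topology.IsInducing.continuousOn_iff (g := Subtype.val) ⟨rfl⟩).2 ?_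
    have h : ContinuousOn (fun z : {v : Fin (r + 1) → 𝕂 // v ≠ 0} × ProjSpace 𝕂 r =>
        z.1.1 i • affineRep i z.2) {z | toProj z.1 ∈ affineSet i ∧ z.2 ∈ affineSet i} := by
      refine ContinuousOn.smul ((continuous_coord i).comp continuous_fst).continuousOn ?_
      exact (continuousOn_affineRep i).comp continuous_snd.continuousOn fun z hz => hz.2
    refine h.congr fun z hz => ?_
    simp only [Function.comp_apply]
    rw [dif_pos (hne z.1 z.2 hz.1 hz.2)]
  · intro v y hv hy
    dsimp only
    rw [dif_pos (hne v y hv hy)]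
    refine (toProj_eq_iff.2 ⟨v.1 i * ((lineRep y).1 i)⁻¹,
      mul_ne_zero (toProj_mem_affineSet.1 hv) (inv_ne_zero hy), ?_⟩).trans (toProj_lineRep y)
    rw [← smul_smul]
    rfl
  · intro v hv
    have h : v.1 i • affineRep i (toProj v) = v.1 := by
      rw [affineRep_toProj, smul_smul, mul_inv_cancel₀ (toProj_mem_affineSet.1 hv), one_smul]
    refine Subtype.ext ?_
    dsimp only
    rw [dif_pos (hne v _ hv hv)]
    exact h

/-- Spheroids in a line, without zero, are null-homotopic in the complement of zero. -/
theorem nullIn_of_line [NormedAlgebra ℝ 𝕂] {k : ℕ} (hr : 1 ≤ r)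
    {c : (I^(Fin k)) → {v : Fin (r + 1) → 𝕂 // v ≠ 0}}
    (hc : Continuous c) (hcv : ∃ v, ∀ t ∈ Cube.boundary (Fin k), c t = v) {y : ProjSpace 𝕂 r}
    (hy : ∀ t, toProj (c t) = y) : NullIn {0}ᶜ fun t => (c t).1 := by
  obtain ⟨w, rfl⟩ := toProj_surjective y
  -- There are at least two coordinates, so some vector `z` lies off the line. The segments from the
  -- points of the line, other than zero, to `z` avoid zero.
  obtain ⟨z, hz⟩ : ∃ z : Fin (r + 1) → 𝕂, ∀ a : 𝕂, a • w.1 ≠ z := by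
    have h01 : (0 : Fin (r + 1)) ≠ ⟨1, by omega⟩ := by simp [Fin.ext_iff]
    by_contra! h
    obtain ⟨a, ha⟩ := h (Pi.single 0 1)
    obtain ⟨b, hb⟩ := h (Pi.single ⟨1, by omega⟩ 1)
    have h1 := congrFun ha 0
    have h2 := congrFun ha ⟨1, by omega⟩
    have h3 := congrFun hb ⟨1, by omega⟩
    rw [Pi.smul_apply, Pi.single_eq_same] at h1 h3
    rw [Pi.smul_apply, Pi.single_eq_of_ne h01.symm] at h2
    rcases smul_eq_zero.1 h2 with h4 | h4
    · rw [h4, zero_smul] at h1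
      exact zero_ne_one h1
    · rw [h4, smul_zero] at h3
      exact zero_ne_one h3
  obtain ⟨v, hv⟩ := hcv
  refine ⟨fun x => (1 - (x.1 : ℝ)) • (c x.2).1 + (x.1 : ℝ) • z, by fun_prop, fun t => by simp,
    fun x hx => ?_, ⟨fun s => (1 - (s : ℝ)) • v.1 + (s : ℝ) • z, fun s t ht => by
      simp only [hv t ht]⟩, z, fun t => by simp⟩
  have hx0 : (1 - (x.1 : ℝ)) • (c x.2).1 + (x.1 : ℝ) • z = 0 := hx
  by_cases hs : (x.1 : ℝ) = 0
  · rw [hs] at hx0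
    simp at hx0
    exact (c x.2).2 hx0
  · obtain ⟨a, -, ha⟩ := toProj_eq_iff.1 (hy x.2)
    refine hz ((-((x.1 : ℝ)⁻¹ * (1 - (x.1 : ℝ)))) • a) ?_
    have h1 : (x.1 : ℝ) • z = -((1 - (x.1 : ℝ)) • (c x.2).1) := eq_neg_of_add_eq_zero_right hx0
    calc _ = (x.1 : ℝ)⁻¹ • -((1 - (x.1 : ℝ)) • (c x.2).1) := by
          rw [ha, smul_assoc, neg_smul, smul_neg, smul_smul]
      _ = z := by rw [← h1, smul_smul, inv_mul_cancel₀ hs, one_smul]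

end Projective

/-! ### Projection of a projective space from a point -/

section ProjectionFromPoint

variable {𝕂 : Type} [NormedDivisionRing 𝕂] {r : ℕ}

/-- The linear projection with centre `u`, where the `i`-th coordinate of `u` is `1`. -/
def dropLine (i : Fin (r + 2)) (u v : Fin (r + 2) → 𝕂) (j : Fin (r + 1)) : 𝕂 :=
  v (i.succAbove j) - v i * u (i.succAbove j)

/-- The point of an affine hyperplane with a given projection. -/
def liftLine (i : Fin (r + 2)) (u : Fin (r + 2) → 𝕂) (w : Fin (r + 1) → 𝕂) : Fin (r + 2) → 𝕂 :=
  i.insertNth 1 fun j => w j + u (i.succAbove j)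

variable {i : Fin (r + 2)} {u : Fin (r + 2) → 𝕂}

theorem dropLine_smul (a : 𝕂) (v : Fin (r + 2) → 𝕂) :
    dropLine i u (a • v) = a • dropLine i u v := by
  funext j
  simp [dropLine, mul_sub, mul_assoc]

theorem dropLine_liftLine (w : Fin (r + 1) → 𝕂) : dropLine i u (liftLine i u w) = w := by
  funext j
  simp [dropLine, liftLine]

theorem liftLine_ne_zero (w : Fin (r + 1) → 𝕂) : liftLine i u w ≠ 0 := fun h => by
  have h1 := congrFun h i
  simp [liftLine] at h1

theorem liftLine_dropLine {v : Fin (r + 2) → 𝕂} (hv : v i = 1) :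
    liftLine i u (dropLine i u v) = v := by
  funext j
  refine Fin.succAboveCases i ?_ (fun j => ?_) j
  · simp [liftLine, hv]
  · simp [liftLine, dropLine, hv]

theorem dropLine_self (hu : u i = 1) : dropLine i u u = 0 := by
  funext j
  simp [dropLine, hu]

theorem eq_smul_of_dropLine_eq_zero {v : Fin (r + 2) → 𝕂} (hu : u i = 1)
    (hv : dropLine i u v = 0) : v = v i • u := by
  funext j
  refine Fin.succAboveCases i ?_ (fun j => ?_) j
  · simp [hu]
  · exact sub_eq_zero.1 (congrFun hv j)

theorem continuous_dropLine : Continuous (dropLine i u) := by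
  unfold dropLine
  fun_prop

theorem continuous_liftLine : Continuous (liftLine i u) := by
  refine continuous_pi fun j => ?_
  refine Fin.succAboveCases i ?_ (fun j => ?_) j
  · simp only [liftLine, Fin.insertNth_apply_same]
    exact continuous_const
  · simp only [liftLine, Fin.insertNth_apply_succAbove]
    fun_prop

variable {x₀ : ProjSpace 𝕂 (r + 1)}

theorem dropLine_eq_zero_iff (hx₀ : x₀ ∈ affineSet i)
    (v : {v : Fin (r + 2) → 𝕂 // v ≠ 0}) :
    dropLine i (affineRep i x₀) v.1 = 0 ↔ toProj v = x₀ := by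
  have hu := affineRep_apply_self hx₀
  constructor
  · intro h
    have h1 := eq_smul_of_dropLine_eq_zero hu h
    have h2 : v.1 i ≠ 0 := fun h2 => v.2 (by rw [h1, h2, zero_smul])
    rw [← toProj_lineRep x₀, toProj_eq_iff]
    refine ⟨v.1 i * ((lineRep x₀).1 i)⁻¹, mul_ne_zero h2 (inv_ne_zero hx₀), h1.trans ?_⟩
    rw [← smul_smul]
    rfl
  · rintro rfl
    have hv := toProj_mem_affineSet.1 hx₀
    have h1 : v.1 = v.1 i • affineRep i (toProj v) := by
      rw [affineRep_toProj, smul_smul, mul_inv_cancel₀ hv, one_smul]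
    rw [h1, dropLine_smul]
    simp only [affineRep_toProj] at hu ⊢
    rw [dropLine_self hu, smul_zero]

open scoped Classical in
/-- The projection with centre `x₀` of the projective space to a projective hyperplane. -/
def projFrom (i : Fin (r + 2)) (x₀ x : ProjSpace 𝕂 (r + 1)) : ProjSpace 𝕂 r :=
  if h : dropLine i (affineRep i x₀) (lineRep x).1 ≠ 0 then toProj ⟨_, h⟩
  else toProj ⟨fun _ => 1, fun h => one_ne_zero (congrFun h 0)⟩

theorem projFrom_toProj (v : {v : Fin (r + 2) → 𝕂 // v ≠ 0})
    (hv : dropLine i (affineRep i x₀) v.1 ≠ 0) :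
    projFrom i x₀ (toProj v) = toProj ⟨dropLine i (affineRep i x₀) v.1, hv⟩ := by
  obtain ⟨a, ha, h⟩ := exists_lineRep_toProj v
  have h1 : dropLine i (affineRep i x₀) (lineRep (toProj v)).1 =
      a • dropLine i (affineRep i x₀) v.1 := by
    rw [h, dropLine_smul]
  have h2 : dropLine i (affineRep i x₀) (lineRep (toProj v)).1 ≠ 0 := by
    rw [h1]
    exact smul_ne_zero ha hv
  unfold projFrom
  rw [dif_pos h2]
  exact toProj_eq_iff.2 ⟨a, ha, h1⟩

theorem isClosed_singleton_projSpace (x₀ : ProjSpace 𝕂 (r + 1)) : IsClosed {x₀} := by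
  obtain ⟨i, hi⟩ := exists_mem_affineSet x₀
  rw [← isQuotientMap_toProj.isClosed_preimage]
  have h : toProj ⁻¹' {x₀} = {v | dropLine i (affineRep i x₀) v.1 = 0} :=
    Set.ext fun v => (dropLine_eq_zero_iff hi v).symm
  rw [h]
  exact isClosed_eq (continuous_dropLine.comp continuous_subtype_val) continuous_const

theorem continuousOn_projFrom (hx₀ : x₀ ∈ affineSet i) : ContinuousOn (projFrom i x₀) {x₀}ᶜ := by
  rw [isQuotientMap_toProj.continuousOn_isOpen_iff (isClosed_singleton_projSpace x₀).isOpen_compl,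
    continuousOn_iff_continuous_domRestrict]
  have hne : ∀ v : (toProj ⁻¹' {x₀}ᶜ : Set {v : Fin (r + 2) → 𝕂 // v ≠ 0}),
      dropLine i (affineRep i x₀) v.1.1 ≠ 0 := fun v h =>
    v.2 ((dropLine_eq_zero_iff hx₀ v.1).1 h)
  refine (continuous_toProj.comp (Continuous.subtype_mk (continuous_dropLine.comp
    (continuous_subtype_val.comp continuous_subtype_val)) hne)).congr fun v => ?_
  exact (projFrom_toProj v.1 (hne v)).symm

/-- The link of a point of a projective space does not bound in the complement of the point. -/
theorem germInjOn_projSpace [NormedAlgebra ℝ 𝕂] (hr : 1 ≤ r) (k : ℕ)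
    (x₀ : ProjSpace 𝕂 (r + 1)) : GermInjOn (k + 1) {x₀}ᶜ x₀ := by
  obtain ⟨i, hi⟩ := exists_mem_affineSet x₀
  set u := affineRep i x₀ with hu
  have hui : u i = 1 := affineRep_apply_self hi
  -- The affine coordinate centred at `x₀`, with inverse `τ`. The line spanned by `κ x` is the
  -- projection of `x` from `x₀`.
  set κ : ProjSpace 𝕂 (r + 1) → (Fin (r + 1) → 𝕂) := fun x => dropLine i u (affineRep i x) with hκ
  set τ : (Fin (r + 1) → 𝕂) → ProjSpace 𝕂 (r + 1) := fun w =>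
    toProj ⟨liftLine i u w, liftLine_ne_zero w⟩ with hτ
  have hOmem := (isOpen_affineSet i).mem_nhds hi
  have hκO : ContinuousOn κ (affineSet i) :=
    continuous_dropLine.comp_continuousOn (continuousOn_affineRep i)
  have hκ0 : κ x₀ = 0 := dropLine_self hui
  have hτκ : ∀ x ∈ affineSet i, τ (κ x) = x := by
    intro x hx
    refine Eq.trans (toProj_eq_iff.2 ⟨((lineRep x).1 i)⁻¹, inv_ne_zero hx, ?_⟩) (toProj_lineRep x)
    exact liftLine_dropLine (affineRep_apply_self hx)
  have hκτ : ∀ w, κ (τ w) = w := by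
    intro w
    have h1 : liftLine i u w i = 1 := by simp [liftLine]
    simp only [hκ, hτ]
    rw [affineRep_toProj]
    dsimp only
    rw [h1, inv_one, one_smul, dropLine_liftLine]
  have hτc : Continuous τ := continuous_toProj.comp (continuous_liftLine.subtype_mk _)
  refine germInjOn_of_map (hκO.continuousAt hOmem) (.of_forall fun w => hτc.continuousAt)
    (Filter.mem_of_superset hOmem hτκ) (.of_forall hκτ) hOmem ?_
  rintro c hc ⟨v, hv⟩ hcO hnull
  rw [hκ0]
  have hκc : Continuous fun t => κ (c t) := hκO.comp_continuous hc hcO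
  have hne : ∀ t, κ (c t) ≠ 0 := fun t h => hnull.mem t (by
    have h1 := hτκ _ (hcO t)
    rw [h, ← hκ0, hτκ _ hi] at h1
    exact h1.symm)
  obtain ⟨H, hH, hH0, hHS, ⟨σ', hσ'⟩, y, hy⟩ := hnull
  have hproj : ∀ t, toProj ⟨κ (c t), hne t⟩ = projFrom i x₀ (c t) := by
    intro t
    have h1 : (affineRep i (c t)) ≠ 0 := fun h => by
      have h2 := affineRep_apply_self (hcO t)
      rw [h] at h2
      exact zero_ne_one h2
    have h2 : toProj ⟨affineRep i (c t), h1⟩ = c t :=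
      (toProj_eq_iff.2 ⟨((lineRep (c t)).1 i)⁻¹, inv_ne_zero (hcO t), rfl⟩).trans
        (toProj_lineRep (c t))
    rw [← projFrom_toProj (x₀ := x₀) ⟨affineRep i (c t), h1⟩ (hne t), h2]
  -- The projection from `x₀` is defined along the whole null-homotopy. Its lift to nonzero vectors
  -- deforms `κ ∘ c` to a spheroid in a single line, which `nullIn_of_line` contracts.
  obtain ⟨K, hK, hpK, hK0, τ', hτ'⟩ := locTransport_toProj.exists_homotopy_lift
    (H := fun z => projFrom i x₀ (H z)) ((continuousOn_projFrom hi).comp_continuous hH hHS)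
    ⟨fun s => projFrom i x₀ (σ' s), fun s t ht => by rw [hσ' s t ht]⟩
    (e := fun t => ⟨κ (c t), hne t⟩) (hκc.subtype_mk _)
    ⟨⟨κ (c fun _ => 0), hne _⟩, fun t ht => Subtype.ext (congrArg κ
      ((hv t ht).trans (hv _ (zero_mem_boundary k)).symm))⟩ (fun t => by rw [hproj, hH0])
  have hfin : NullIn {0}ᶜ fun t => (K (1, t)).1 :=
    nullIn_of_line hr (c := fun t => K (1, t)) (by fun_prop) ⟨τ' 1, hτ' 1⟩
      (y := projFrom i x₀ y) fun t => by rw [hpK, hy]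
  exact hfin.of_homotopy (fun z => (K z).1) (by fun_prop) (fun t => by rw [hK0]) (fun _ => rfl)
    (fun z => (K z).2) ⟨fun s => (τ' s).1, fun s t ht => by rw [hτ' s t ht]⟩

theorem IsProjSpace.germInjOn {N : Type*} [TopologicalSpace N] (hN : IsProjSpace N) (k : ℕ)
    (x₀ : N) : GermInjOn (k + 1) {x₀}ᶜ x₀ := by
  obtain ⟨r, hr, h⟩ := hN
  obtain ⟨r, rfl⟩ := Nat.exists_eq_add_of_le' (Nat.one_le_of_lt hr)
  have hr' : 1 ≤ r := by omega
  rcases h with ⟨⟨φ⟩⟩ | ⟨⟨φ⟩⟩ | ⟨⟨φ⟩⟩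
  · exact GermInjOn.homeomorph φ (germInjOn_projSpace hr' k _)
  · exact GermInjOn.homeomorph φ (germInjOn_projSpace hr' k _)
  · exact GermInjOn.homeomorph φ (germInjOn_projSpace hr' k _)

end ProjectionFromPoint

/-! ### The kernel for manifolds that are not simply connected and for projective spaces -/

section Kernel

variable {n : ℕ} {N : Type*} [TopologicalSpace N] [ChartedSpace (EuclideanSpace ℝ (Fin n)) N]
  [IsManifold (𝓡 n) ∞ N]

/-- In manifolds which are not simply connected, and in projective spaces, the essential spheroids
in the boundary of a ball are essential in the complement of the centre. -/
theorem nullIn_sphere_of_examples [T2Space N] [ConnectedSpace N] {k : ℕ}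
    (hN : ¬ SimplyConnectedSpace N ∨ IsProjSpace N) (hn : 2 ≤ n) (hk : 1 ≤ k) {b : SmoothBall n N}
    {c : (I^(Fin k)) → USphere n} (hc : Continuous c)
    (hcv : ∃ v, ∀ t ∈ Cube.boundary (Fin k), c t = v)
    (h : NullIn {b.centre}ᶜ fun t => b.toFun (c t)) : NullIn Set.univ c := by
  obtain ⟨k, rfl⟩ := Nat.exists_eq_add_of_le' hk
  refine GermInjOn.nullIn_sphere ?_ hc hcv h
  rcases hN with hN | hN
  · have : LocallyPathConnectedSpace N :=
      ChartedSpace.locallyPathConnectedSpace (EuclideanSpace ℝ (Fin n)) N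
    have : PathConnectedSpace N := pathConnectedSpace_iff_connectedSpace.2 inferInstance
    exact germInjOn_of_not_simplyConnected (locEuclidean_of_chartedSpace _ N)
      (rank_euclideanSpace_gt hn) hN _ _
  · exact hN.germInjOn k _

end Kernel

end Coincidence

end

/-! ### The theorem, for maps of the sphere of dimension `m = k + 1` -/

theorem mainTheorem8 (n k : ℕ) (hn : 1 ≤ n)
    (N : Type*) [TopologicalSpace N] [T2Space N] [SecondCountableTopology N] [ConnectedSpace N]
    [ChartedSpace (EuclideanSpace ℝ (Fin n)) N] [IsManifold (𝓡 n) ∞ N]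
    (g : Coincidence.RMetric n N) (b : Coincidence.SmoothBall n N)
    (φ : Coincidence.Frame g b.centre) (hφ : φ.Compatible)
    (s₀ : Coincidence.USphere n) :
    -- the boundary map is well defined
    (1 ≤ k → ∀ α : π_ (k + 1) N b.centre, ∃! β : π_ k (Coincidence.USphere n) s₀,
      Coincidence.TangentBoundaryRel φ s₀ k α β) ∧
    -- loose by small deformation implies loose, which implies not coincidence producing
    (∀ f : C(Coincidence.USphere (k + 2), N),
      (Coincidence.LooseBySmallDeformation f → Coincidence.Loose f f) ∧
      (Coincidence.Loose f f → ¬ Coincidence.CoincidenceProducing f)) ∧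
    -- not coincidence producing is equivalent to the vanishing of the class j_* (∂ [f])
    (∀ (f : C(Coincidence.USphere (k + 2), N)) (hf : f (Coincidence.pole (k + 1)) = b.centre),
      ¬ Coincidence.CoincidenceProducing f ↔
        Coincidence.inducedMap k b.sphereIncl s₀
          (Coincidence.boundary φ s₀ k (Coincidence.sphereClass (k + 1) f hf)) =
        Coincidence.zeroClass k (b.sphereIncl s₀)) ∧
    -- the criterion for the three geometric conditions to be equivalent for all maps
    ((∀ f : C(Coincidence.USphere (k + 2), N),
        (Coincidence.LooseBySmallDeformation f ↔ Coincidence.Loose f f) ∧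
        (Coincidence.Loose f f ↔ ¬ Coincidence.CoincidenceProducing f)) ↔
      Set.range (Coincidence.boundary φ s₀ k) ∩ Coincidence.inducedKer k b.sphereIncl s₀ =
        {Coincidence.zeroClass k s₀}) ∧
    -- examples
    ((¬ SimplyConnectedSpace N ∨ Coincidence.IsProjSpace N) →
      Set.range (Coincidence.boundary φ s₀ k) ∩ Coincidence.inducedKer k b.sphereIncl s₀ =
        {Coincidence.zeroClass k s₀} ∧
      (¬ (k = 0 ∧ n = 1) →
        Coincidence.inducedKer k b.sphereIncl s₀ = {Coincidence.zeroClass k s₀})) := by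
  have hcircle : n = 1 → k = 0 → ∀ f : C(Coincidence.USphere (k + 2), N),
      Coincidence.LiftsTo (fun v : Coincidence.UnitTangent g => v.1.proj) f := by
    rintro rfl rfl f
    exact Coincidence.liftsTo_unitTangent_circle φ f
  have hker : (¬ SimplyConnectedSpace N ∨ Coincidence.IsProjSpace N) → 2 ≤ n → 1 ≤ k →
      ∀ c : (I^(Fin k)) → Coincidence.USphere n, Continuous c →
      (∃ v, ∀ t ∈ Cube.boundary (Fin k), c t = v) →
      Coincidence.NullIn {b.centre}ᶜ (fun t => b.toFun (c t)) →
      Coincidence.NullIn Set.univ c :=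
    fun hN hn2 hk c hc hcv h => Coincidence.nullIn_sphere_of_examples hN hn2 hk hc hcv h
  refine ⟨fun _ α => Coincidence.existsUnique_tangentBoundaryRel φ s₀ α,
    fun f => ⟨Coincidence.looseBySmallDeformation_loose g,
      Coincidence.loose_not_coincidenceProducing⟩,
    fun f hf => (Coincidence.boundary_criterion hn hφ s₀ hcircle hf).2,
    Coincidence.looseness_equivalence hn hφ s₀ hcircle, fun hN => ?_⟩
  have h1 : ¬ (k = 0 ∧ n = 1) →
      Coincidence.inducedKer k b.sphereIncl s₀ = {Coincidence.zeroClass k s₀} := fun hnk =>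
    Coincidence.inducedKer_eq_of_dim hnk hn s₀ (hker hN)
  refine ⟨?_, h1⟩
  have h0 := Coincidence.boundary_zeroClass (k := k) φ s₀
  -- For `m = n = 1` the kernel is not controlled, but there the boundary map is trivial by
  -- convention.
  by_cases hnk : k = 0 ∧ n = 1
  · obtain ⟨rfl, -⟩ := hnk
    refine Set.eq_singleton_iff_unique_mem.2 ⟨⟨⟨_, h0⟩,
      Coincidence.zeroClass_mem_inducedKer _ _⟩, ?_⟩
    rintro _ ⟨⟨α, rfl⟩, -⟩
    rfl
  · rw [h1 hnk]
    exact Set.inter_eq_right.2 (Set.singleton_subset_iff.2 ⟨_, h0⟩)
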